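/- Let $V:\mathbb R\to\mathbb R$ be smooth, $T>0$, $\gamma>0$, with $\int e^{-V(r)/T}\,dr<\infty$, and let $\mu$ be the probability measure on configurations $(r_x,p_x)_{x\in\mathbb Z}\in(\mathbb R\times\mathbb R)^{\mathbb Z}$ under which all coordinates are independent, each $r_x$ has density proportional to $e^{-V(r)/T}$ and each $p_x$ is centered Gaussian with variance $T$ (the Gibbs measure at temperature $T$ and pressure $0$). Assume that $V'(r_0)$ and $V''(r_0)$ are square integrable with respect to $\mu$; $\mathrm{Var}$ denotes the variance under $\mu$. Let $\theta_x$ be the shift by $x$, let $$\ll f,g\gg=\sum_{x\in\mathbb Z}\{\mu(f\,\theta_xg)-\mu(f)\mu(g)\}$$ for square integrable local functions $f,g$, and let $\mathcal H$ be the Hilbert space obtained by completing the space of these functions with respect to the semi-inner product $\ll\cdot,\cdot\gg$. Define $$\mathfrak A=\sum_{x}\left[(p_x-p_{x-1})\partial_{r_x}+(V'(r_{x+1})-V'(r_x))\partial_{p_x}\right],\qquad (\mathfrak Sf)(\omega)=\sum_x\left[f(\omega^x)-f(\omega)\right],$$ $$\mathfrak S'=\tfrac12\sum_x\left(p_{x+1}\partial_{p_x}-p_x\partial_{p_{x+1}}\right)^2,\qquad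 \mathfrak L'=\mathfrak A+\gamma(\mathfrak S+\mathfrak S'),$$ where $\omega^x$ is $\omega$ with the sign of $p_x$ changed, and where $\mathfrak L'$ is first defined on the linear span of the compactly supported local $C^2$ functions and then closed in $\mathcal H$. Assume that $V$ is such that $\mathfrak L'$ generates a strongly continuous semigroup on $\mathcal H$. Let $j_{0,1}=-p_0V'(r_1)$. Then for every $\lambda>0$ the equation $(\lambda-\mathfrak L')u=j_{0,1}$ has exactly one solution $u=(\lambda-\mathfrak L')^{-1}j_{0,1}$ in the domain of $\mathfrak L'$, the limit $$\sigma'(j_{0,1},j_{0,1})=\lim_{\lambda\downarrow0}\ll j_{0,1},(\lambda-\mathfrak L')^{-1}j_{0,1}\gg$$ exists (and is finite), and $$\sigma'(j_{0,1},j_{0,1})\ \ge\ \frac{T^2\,[\mathrm{Var}\,V'(r_0)]^2}{6\gamma T\,\mathrm{Var}\,V'(r_0)+2T^2\gamma^{-1}\,\mathrm{Var}\,V''(r_0)}.$$ -/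

import Mathlib

open MeasureTheory ProbabilityTheory Filter Topology
open scoped NNReal

noncomputable section

namespace OscillatorChain

/-! ### The infinite chain and its Gibbs measure -/

/-- A configuration `ω = (r, p)` of the infinite chain: `(ω x).1 = r_x` is the interparticle
distance and `(ω x).2 = p_x` is the momentum at the site `x`. -/
abbrev Config : Type := ℤ → ℝ × ℝ

/-- The data of the chain in equilibrium at zero pressure: a smooth interaction potential `V`
and a temperature `T > 0` for which the Gibbs measure exists and the force `V'` is square
integrable. -/
structure Chain where
  /-- the interaction potential -/
  V : ℝ → ℝ
  /-- the temperature -/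
  T : ℝ
  smooth : ContDiff ℝ (⊤ : ℕ∞) V
  T_pos : 0 < T
  integrable_exp : Integrable (fun r : ℝ => Real.exp (-V r / T))
  memLp_force : MemLp (deriv V) 2 ((volume : Measure ℝ).tilted fun r => -V r / T)

namespace Chain

variable (C : Chain)

/-- The law `Z⁻¹ exp (-V(r)/T) dr` of one interparticle distance. -/
def lengthLaw : Measure ℝ := (volume : Measure ℝ).tilted fun r => -C.V r / C.T

/-- The law of `(r_x, p_x)`: distance and momentum are independent, and the momentum is a centered
Gaussian variable with variance `T`. -/
def siteLaw : Measure (ℝ × ℝ) := C.lengthLaw.prod (gaussianReal 0 C.T.toNNReal)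

/-- The infinite volume Gibbs measure `μ_{0,T}` at zero pressure and temperature `T`. -/
def gibbs : Measure Config := Measure.infinitePi fun _ : ℤ => C.siteLaw

instance : IsProbabilityMeasure C.lengthLaw := isProbabilityMeasure_tilted C.integrable_exp

instance : IsProbabilityMeasure C.siteLaw := by unfold siteLaw; infer_instance

instance : IsProbabilityMeasure C.gibbs := by unfold gibbs; infer_instance

end Chain

/-- The shift `(θ_x ω)_z = ω_{x+z}`. -/
def shift (x : ℤ) (ω : Config) : Config := fun z => ω (x + z)

lemma measurable_shift (x : ℤ) : Measurable (shift x) :=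
  measurable_pi_lambda _ fun z => measurable_pi_apply (x + z)

namespace Chain

variable (C : Chain)

lemma measurePreserving_shift (x : ℤ) : MeasurePreserving (shift x) C.gibbs C.gibbs := by
  refine ⟨measurable_shift x, ?_⟩
  refine Measure.eq_infinitePi _ ?_
  intro s t ht
  rw [Measure.map_apply (measurable_shift x)
    (MeasurableSet.pi s.countable_toSet fun i _ => ht i)]
  have h : shift x ⁻¹' (Set.pi (s : Set ℤ) t) =
      Set.pi ((s.map (addLeftEmbedding x) : Finset ℤ) : Set ℤ) (fun z => t (z - x)) := by
    ext ω
    simp only [Set.mem_preimage, Set.mem_pi, shift, Finset.mem_coe, Finset.mem_map,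
      addLeftEmbedding_apply]
    constructor
    · rintro h1 _ ⟨i, hi, rfl⟩
      rw [add_sub_cancel_left]
      exact h1 i hi
    · intro h1 i hi
      have h2 := h1 (x + i) ⟨i, hi, rfl⟩
      rwa [add_sub_cancel_left] at h2
  rw [h, gibbs, Measure.infinitePi_pi _ (by
    intro i hi
    obtain ⟨j, hj, rfl⟩ := Finset.mem_map.1 hi
    simpa using ht j), Finset.prod_map]
  refine Finset.prod_congr rfl fun i _ => ?_
  rw [addLeftEmbedding_apply, add_sub_cancel_left]

/-- The square integrable local functions: the measurable functions in `L²(μ_{0,T})` which depend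
on finitely many coordinates only. -/
def localSubmodule : Submodule ℝ (Config → ℝ) where
  carrier := {f | Measurable f ∧ MemLp f 2 C.gibbs ∧ ∃ Λ : Finset ℤ, DependsOn f (Λ : Set ℤ)}
  zero_mem' := ⟨measurable_const, MemLp.zero, ∅, fun _ _ _ => rfl⟩
  add_mem' := by
    rintro f g ⟨hf, hf2, Λ, hΛ⟩ ⟨hg, hg2, Λ', hΛ'⟩
    refine ⟨hf.add hg, hf2.add hg2, Λ ∪ Λ', fun a b hab => ?_⟩
    have h1 := hΛ (x := a) (y := b) fun i hi => hab i (by simp at hi ⊢; exact Or.inl hi)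
    have h2 := hΛ' (x := a) (y := b) fun i hi => hab i (by simp at hi ⊢; exact Or.inr hi)
    simp [h1, h2]
  smul_mem' := by
    rintro c f ⟨hf, hf2, Λ, hΛ⟩
    refine ⟨hf.const_smul c, hf2.const_smul c, Λ, fun a b hab => ?_⟩
    simp [hΛ hab]

/-- The space of square integrable local functions (a type of its own, because it carries the
topology of the semi-inner product below and not that of pointwise convergence). -/
def LocalFun : Type := C.localSubmodule

instance : AddCommGroup C.LocalFun := inferInstanceAs (AddCommGroup C.localSubmodule)

instance : Module ℝ C.LocalFun := inferInstanceAs (Module ℝ C.localSubmodule)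

instance : CoeFun C.LocalFun fun _ => Config → ℝ := ⟨Subtype.val⟩

/-- The semi-inner product `≪f, g≫ = ∑_x (μ(f θ_x g) - μ(f) μ(g))`. For local functions the sum
has finitely many nonzero terms. -/
def corr (f g : Config → ℝ) : ℝ :=
  ∑' x : ℤ, ((∫ ω, f ω * g (shift x ω) ∂C.gibbs) - (∫ ω, f ω ∂C.gibbs) * ∫ ω, g ω ∂C.gibbs)


variable {C}

lemma memLp_shift {g : Config → ℝ} (hg : MemLp g 2 C.gibbs) (x : ℤ) :
    MemLp (fun ω => g (shift x ω)) 2 C.gibbs :=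
  hg.comp_measurePreserving (C.measurePreserving_shift x)

lemma integral_shift {g : Config → ℝ} (hg : Measurable g) (x : ℤ) :
    ∫ ω, g (shift x ω) ∂C.gibbs = ∫ ω, g ω ∂C.gibbs := by
  have h := C.measurePreserving_shift x
  conv_rhs => rw [← h.map_eq]
  rw [integral_map h.measurable.aemeasurable hg.aestronglyMeasurable]

lemma corr_eq_tsum_covariance {f g : Config → ℝ} (hf : f ∈ C.localSubmodule)
    (hg : g ∈ C.localSubmodule) :
    C.corr f g = ∑' x : ℤ, cov[f, fun ω => g (shift x ω); C.gibbs] := by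
  unfold corr
  congr 1
  ext x
  rw [covariance_eq_sub hf.2.1 (memLp_shift hg.2.1 x), integral_shift hg.1]
  rfl

/-- Functions with disjoint supports are independent. -/
lemma indepFun_of_dependsOn {f g : Config → ℝ} {Λ Λ' : Finset ℤ} (hd : Disjoint Λ Λ')
    (hf : Measurable f) (hg : Measurable g)
    (hΛ : DependsOn f (Λ : Set ℤ)) (hΛ' : DependsOn g (Λ' : Set ℤ)) :
    IndepFun f g C.gibbs := by
  have hi : iIndepFun (fun (i : ℤ) (ω : Config) => ω i) C.gibbs :=
    iIndepFun_infinitePi (P := fun _ : ℤ => C.siteLaw) (X := fun _ z => z)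
      (fun _ => measurable_id)
  have key := hi.indepFun_finset Λ Λ' hd fun i => measurable_pi_apply i
  let e (S : Finset ℤ) (v : S → ℝ × ℝ) : Config := fun z => if h : z ∈ S then v ⟨z, h⟩ else 0
  have he (S : Finset ℤ) : Measurable (e S) := by
    refine measurable_pi_lambda _ fun z => ?_
    by_cases h : z ∈ S
    · simpa [e, h] using measurable_pi_apply (⟨z, h⟩ : S)
    · simp [e, h]
  have h1 : f = (fun v => f (e Λ v)) ∘ fun (ω : Config) (i : Λ) => ω i := by
    ext ω
    refine hΛ fun i hi => ?_
    have : i ∈ Λ := hi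
    simp [e, this]
  have h2 : g = (fun v => g (e Λ' v)) ∘ fun (ω : Config) (i : Λ') => ω i := by
    ext ω
    refine hΛ' fun i hi => ?_
    have : i ∈ Λ' := hi
    simp [e, this]
  rw [h1, h2]
  exact key.comp (hf.comp (he Λ)) (hg.comp (he Λ'))

lemma exists_covariance_eq_zero {f g : Config → ℝ} (hf : f ∈ C.localSubmodule)
    (hg : g ∈ C.localSubmodule) :
    ∃ M : ℕ, ∀ x : ℤ, (M : ℤ) < |x| → cov[f, fun ω => g (shift x ω); C.gibbs] = 0 := by
  obtain ⟨hf1, hf2, Λ, hΛ⟩ := hf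
  obtain ⟨hg1, hg2, Λ', hΛ'⟩ := hg
  refine ⟨∑ i ∈ Λ, i.natAbs + ∑ i ∈ Λ', i.natAbs, fun x hx => ?_⟩
  have hd : Disjoint Λ (Λ'.map (addLeftEmbedding x)) := by
    rw [Finset.disjoint_left]
    intro i hi hi'
    obtain ⟨j, hj, hji⟩ := Finset.mem_map.1 hi'
    have h1 := Finset.single_le_sum (f := fun i : ℤ => i.natAbs) (fun _ _ => Nat.zero_le _) hi
    have h2 := Finset.single_le_sum (f := fun i : ℤ => i.natAbs) (fun _ _ => Nat.zero_le _) hj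
    simp only [addLeftEmbedding_apply] at hji h1 h2
    rw [lt_abs] at hx
    omega
  refine (indepFun_of_dependsOn hd hf1 (hg1.comp (measurable_shift x)) hΛ ?_).covariance_eq_zero
    hf2 (memLp_shift hg2 x)
  intro a b hab
  refine hΛ' fun i hi => ?_
  exact hab (x + i) (by simpa using hi)

lemma corr_eq_sum {f g : Config → ℝ} (hf : f ∈ C.localSubmodule)
    (hg : g ∈ C.localSubmodule) {M : ℕ}
    (hM : ∀ x : ℤ, (M : ℤ) < |x| → cov[f, fun ω => g (shift x ω); C.gibbs] = 0) :
    C.corr f g = ∑ x ∈ Finset.Icc (-(M : ℤ)) M, cov[f, fun ω => g (shift x ω); C.gibbs] := by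
  rw [corr_eq_tsum_covariance hf hg]
  refine tsum_eq_sum fun x hx => hM x ?_
  simp only [Finset.mem_Icc, not_and_or, not_le] at hx
  rw [lt_abs]
  omega

lemma covariance_shift {f g : Config → ℝ} (hf : Measurable f) (hg : Measurable g) (x y : ℤ) :
    cov[fun ω => f (shift x ω), fun ω => g (shift y ω); C.gibbs] =
      cov[f, fun ω => g (shift (y - x) ω); C.gibbs] := by
  have h := C.measurePreserving_shift x
  have h2 : Measurable fun ω => g (shift (y - x) ω) := hg.comp (measurable_shift _)
  conv_rhs => rw [← h.map_eq]
  rw [covariance_map_fun hf.aestronglyMeasurable h2.aestronglyMeasurable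
    h.measurable.aemeasurable]
  have e (ω : Config) : shift (y - x) (shift x ω) = shift y ω := by
    ext z : 1
    simp only [shift]
    congr 1
    ring
  simp only [e]

lemma corr_comm {f g : Config → ℝ} (hf : f ∈ C.localSubmodule) (hg : g ∈ C.localSubmodule) :
    C.corr g f = C.corr f g := by
  rw [corr_eq_tsum_covariance hf hg, corr_eq_tsum_covariance hg hf, ← (Equiv.neg ℤ).tsum_eq]
  congr 1
  ext x
  have := covariance_shift (C := C) hg.1 hf.1 x 0
  simp only [zero_sub] at this
  rw [Equiv.neg_apply, ← this, covariance_comm]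
  congr 1
  ext ω
  congr 1
  ext z : 1
  simp [shift]

lemma corr_add_left {f g h : Config → ℝ} (hf : f ∈ C.localSubmodule)
    (hg : g ∈ C.localSubmodule) (hh : h ∈ C.localSubmodule) :
    C.corr (f + g) h = C.corr f h + C.corr g h := by
  have s {f : Config → ℝ} (hf : f ∈ C.localSubmodule) :
      Summable fun x : ℤ => cov[f, fun ω => h (shift x ω); C.gibbs] := by
    obtain ⟨M, hM⟩ := exists_covariance_eq_zero hf hh
    refine summable_of_ne_finset_zero (s := Finset.Icc (-(M : ℤ)) M) fun x hx => hM x ?_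
    simp only [Finset.mem_Icc, not_and_or, not_le] at hx
    rw [lt_abs]
    omega
  rw [corr_eq_tsum_covariance hf hh, corr_eq_tsum_covariance hg hh,
    corr_eq_tsum_covariance (add_mem hf hg) hh, ← (s hf).tsum_add (s hg)]
  congr 1
  ext x
  exact covariance_add_left hf.2.1 hg.2.1 (memLp_shift hh.2.1 x)

lemma corr_smul_left {f g : Config → ℝ} (c : ℝ) (hf : f ∈ C.localSubmodule)
    (hg : g ∈ C.localSubmodule) : C.corr (c • f) g = c * C.corr f g := by
  rw [corr_eq_tsum_covariance hf hg,
    corr_eq_tsum_covariance (C.localSubmodule.smul_mem c hf) hg, ← tsum_mul_left]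
  congr 1
  ext x
  exact covariance_smul_left c

/-- `≪f, f≫` is nonnegative, because `n ≪f, f≫` differs from the variance of
`∑_{x < n} θ_x f` by a bounded amount. -/
lemma corr_self_nonneg {f : Config → ℝ} (hf : f ∈ C.localSubmodule) : 0 ≤ C.corr f f := by
  obtain ⟨M, hM⟩ := exists_covariance_eq_zero hf hf
  set c : ℤ → ℝ := fun x => cov[f, fun ω => f (shift x ω); C.gibbs] with hc
  have hS : C.corr f f = ∑ x ∈ Finset.Icc (-(M : ℤ)) M, c x := corr_eq_sum hf hf hM
  set K : ℝ := ∑ x ∈ Finset.Icc (-(M : ℤ)) M, |c x| with hK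
  have hvar (n : ℕ) : 0 ≤ ∑ x ∈ Finset.range n, ∑ y ∈ Finset.range n, c ((y : ℤ) - x) := by
    have h1 := covariance_fun_sum_fun_sum' (μ := C.gibbs) (s := Finset.range n)
      (t := Finset.range n) (X := fun (x : ℕ) ω => f (shift (x : ℤ) ω))
      (Y := fun (x : ℕ) ω => f (shift (x : ℤ) ω))
      (fun i _ => memLp_shift hf.2.1 i) (fun i _ => memLp_shift hf.2.1 i)
    simp only [covariance_shift hf.1 hf.1] at h1
    have h2 : Measurable fun ω => ∑ i ∈ Finset.range n, f (shift (i : ℤ) ω) :=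
      Finset.measurable_fun_sum _ fun i _ => hf.1.comp (measurable_shift i)
    rw [← h1, covariance_self h2.aemeasurable]
    exact variance_nonneg _ _
  have hrow (n x : ℕ) : ∑ y ∈ Finset.range n, c ((y : ℤ) - x) =
      ∑ z ∈ (Finset.Icc (-(M : ℤ)) M).filter (fun z => -(x : ℤ) ≤ z ∧ z < n - x), c z := by
    have h2 : ∑ y ∈ Finset.range n, c ((y : ℤ) - x) =
        ∑ z ∈ (Finset.range n).image (fun y : ℕ => (y : ℤ) - x), c z := by
      rw [Finset.sum_image]
      intro a _ b _ h
      simpa using h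
    rw [h2]
    symm
    refine Finset.sum_subset ?_ ?_
    · intro z hz
      simp only [Finset.mem_filter, Finset.mem_Icc] at hz
      simp only [Finset.mem_image, Finset.mem_range]
      exact ⟨(z + x).toNat, by omega, by omega⟩
    · intro z hz hz'
      simp only [Finset.mem_image, Finset.mem_range] at hz
      obtain ⟨y, hy, rfl⟩ := hz
      refine hM _ ?_
      simp only [Finset.mem_filter, Finset.mem_Icc, not_and_or, not_le, not_lt] at hz'
      rw [lt_abs]
      omega
  have hle (n x : ℕ) : ∑ y ∈ Finset.range n, c ((y : ℤ) - x) ≤ K := by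
    rw [hrow]
    refine (Finset.sum_le_sum fun z _ => le_abs_self (c z)).trans ?_
    exact Finset.sum_le_sum_of_subset_of_nonneg (Finset.filter_subset _ _)
      fun z _ _ => abs_nonneg _
  have heq (n x : ℕ) (h1 : M ≤ x) (h2 : x + M < n) :
      ∑ y ∈ Finset.range n, c ((y : ℤ) - x) = C.corr f f := by
    rw [hrow, hS, Finset.filter_true_of_mem]
    intro z hz
    simp only [Finset.mem_Icc] at hz
    omega
  have hbound (n : ℕ) : 0 ≤ (n : ℝ) * C.corr f f + (2 * M + 1) * K := by
    have h := hvar (M + n + (M + 1))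
    rw [Finset.sum_range_add _ (M + n), Finset.sum_range_add _ M] at h
    have a1 : ∑ x ∈ Finset.range M,
        ∑ y ∈ Finset.range (M + n + (M + 1)), c ((y : ℤ) - x) ≤ M * K := by
      refine (Finset.sum_le_sum fun x _ => hle _ x).trans ?_
      simp
    have a2 : ∑ x ∈ Finset.range n,
        ∑ y ∈ Finset.range (M + n + (M + 1)), c ((y : ℤ) - ((M + x : ℕ) : ℤ)) =
          n * C.corr f f := by
      rw [Finset.sum_congr rfl fun x hx => heq _ (M + x) (by omega) (by
        have := Finset.mem_range.1 hx
        omega)]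
      simp
    have a3 : ∑ x ∈ Finset.range (M + 1),
        ∑ y ∈ Finset.range (M + n + (M + 1)), c ((y : ℤ) - ((M + n + x : ℕ) : ℤ)) ≤
          (M + 1) * K := by
      refine (Finset.sum_le_sum fun x _ => hle _ (M + n + x)).trans ?_
      simp
    rw [a2] at h
    linarith
  by_contra hneg
  push Not at hneg
  obtain ⟨n, hn⟩ := exists_nat_gt ((2 * M + 1) * K / -C.corr f f)
  rw [div_lt_iff₀ (by linarith)] at hn
  linarith [hbound n]

variable (C)

/-- The semi-inner product on the local functions. -/
@[reducible] def preCore : PreInnerProductSpace.Core ℝ C.LocalFun where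
  inner f g := C.corr f g
  conj_inner_symm f g := corr_comm f.2 g.2
  re_inner_nonneg f := corr_self_nonneg f.2
  add_left f g h := corr_add_left f.2 g.2 h.2
  smul_left f g c := corr_smul_left c f.2 g.2

instance : SeminormedAddCommGroup C.LocalFun :=
  @InnerProductSpace.Core.toSeminormedAddCommGroup ℝ C.LocalFun _ _ _ C.preCore

instance : InnerProductSpace ℝ C.LocalFun := InnerProductSpace.ofCore C.preCore

/-- The Hilbert space `𝓗`: the completion of the local functions for `≪·,·≫` (in which the
functions of seminorm zero, such as the discrete gradients, vanish). -/
abbrev H : Type := UniformSpace.Completion C.LocalFun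

/-- The class in `𝓗` of a square integrable local function. -/
def toH (f : C.LocalFun) : C.H := (f : UniformSpace.Completion C.LocalFun)

lemma inner_toH (f g : C.LocalFun) : inner ℝ (C.toH f) (C.toH g) = C.corr f g :=
  UniformSpace.Completion.inner_coe f g

end Chain

/-! ### The generator -/

/-- The partial derivative `∂_{r_x} f`. -/
def derivR (x : ℤ) (f : Config → ℝ) (ω : Config) : ℝ :=
  deriv (fun s : ℝ => f (Function.update ω x (s, (ω x).2))) (ω x).1

/-- The partial derivative `∂_{p_x} f`. -/
def derivP (x : ℤ) (f : Config → ℝ) (ω : Config) : ℝ :=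
  deriv (fun s : ℝ => f (Function.update ω x ((ω x).1, s))) (ω x).2

/-- The configuration `ω^x`, in which the momentum at `x` has changed its sign. -/
def flip (x : ℤ) (ω : Config) : Config := Function.update ω x ((ω x).1, -(ω x).2)

/-- The flip noise `(𝔖 f)(ω) = ∑_x (f(ω^x) - f(ω))`. -/
def flipNoise (f : Config → ℝ) (ω : Config) : ℝ := ∑' x : ℤ, (f (flip x ω) - f ω)

/-- The vector field `p_{x+1} ∂_{p_x} - p_x ∂_{p_{x+1}}`. -/
def rotation (x : ℤ) (f : Config → ℝ) (ω : Config) : ℝ :=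
  (ω (x + 1)).2 * derivP x f ω - (ω x).2 * derivP (x + 1) f ω

/-- The second noise `𝔖' = (1/2) ∑_x (p_{x+1} ∂_{p_x} - p_x ∂_{p_{x+1}})²`. -/
def exchangeNoise (f : Config → ℝ) (ω : Config) : ℝ :=
  (1 / 2) * ∑' x : ℤ, rotation x (rotation x f) ω

/-- The compactly supported local functions of class `C²`: the functions `φ((ω_x)_{x ∈ Λ})` with
`Λ` finite and `φ` of class `C²` with compact support. -/
def IsTestFunction (f : Config → ℝ) : Prop :=
  ∃ (Λ : Finset ℤ) (φ : (Λ → ℝ × ℝ) → ℝ),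
    ContDiff ℝ 2 φ ∧ HasCompactSupport φ ∧ f = fun ω => φ (fun x => ω x)

namespace Chain

variable (C : Chain)

/-- The Liouville operator
`𝔄 = ∑_x ((p_x - p_{x-1}) ∂_{r_x} + (V'(r_{x+1}) - V'(r_x)) ∂_{p_x})`. -/
def liouville (f : Config → ℝ) (ω : Config) : ℝ :=
  ∑' x : ℤ, (((ω x).2 - (ω (x - 1)).2) * derivR x f ω
    + (deriv C.V (ω (x + 1)).1 - deriv C.V (ω x).1) * derivP x f ω)

/-- The formal generator `𝔏' = 𝔄 + γ (𝔖 + 𝔖')`. -/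
def formalGenerator (γ : ℝ) (f : Config → ℝ) (ω : Config) : ℝ :=
  C.liouville f ω + γ * (flipNoise f ω + exchangeNoise f ω)

/-- The graph of the operator `𝔏'` in `𝓗`: the closure in `𝓗 × 𝓗` of the graph of the formal
generator on the linear span of the test functions. (For a test function `f` the function `𝔏' f` is
again local, and it is square integrable since `V'` is and since the derivatives of `f` are bounded,
so that some `g` as below exists for every `f`.) -/
def generator (γ : ℝ) : Submodule ℝ (C.H × C.H) :=
  (Submodule.span ℝ {z : C.H × C.H | ∃ f g : C.LocalFun, IsTestFunction f ∧
    (∀ ω, g ω = C.formalGenerator γ f ω) ∧ z = (C.toH f, C.toH g)}).topologicalClosure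

end Chain

/-- A strongly continuous semigroup of bounded operators on a Banach space. -/
structure IsC0Semigroup {E : Type*} [NormedAddCommGroup E] [NormedSpace ℝ E]
    (P : ℝ≥0 → E →L[ℝ] E) : Prop where
  zero : P 0 = ContinuousLinearMap.id ℝ E
  add : ∀ s t, P (s + t) = (P s).comp (P t)
  continuous : ∀ x, Continuous fun t => P t x

/-- `IsGeneratorOf G P`: the linear relation `G` is the graph of the infinitesimal generator of
`P`, i.e. `(x, y) ∈ G` if and only if `(P_h x - x) / h → y` as `h ↓ 0`. -/
def IsGeneratorOf {E : Type*} [NormedAddCommGroup E] [NormedSpace ℝ E]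
    (G : Submodule ℝ (E × E)) (P : ℝ≥0 → E →L[ℝ] E) : Prop :=
  ∀ x y : E, (x, y) ∈ G ↔
    Tendsto (fun h : ℝ≥0 => (h : ℝ)⁻¹ • (P h x - x)) (𝓝[>] 0) (𝓝 y)

namespace Chain

variable (C : Chain)

/-- The energy current `j_{0,1} = -p_0 V'(r_1)`, as a function of the configuration. -/
def currentFun (ω : Config) : ℝ := -(ω 0).2 * deriv C.V (ω 1).1

lemma currentFun_mem : C.currentFun ∈ C.localSubmodule := by
  have hV : Continuous (deriv C.V) := C.smooth.continuous_deriv (by simp)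
  have hm : Measurable C.currentFun := by
    unfold currentFun
    fun_prop
  have e (i : ℤ) : MeasurePreserving (fun ω : Config => ω i) C.gibbs C.siteLaw :=
    measurePreserving_eval_infinitePi (fun _ : ℤ => C.siteLaw) i
  have h0 : MemLp (fun ω : Config => -(ω 0).2) 2 C.gibbs := by
    have h := (memLp_id_gaussianReal (μ := 0) (v := C.T.toNNReal) 2)
    exact ((h.comp_measurePreserving (measurePreserving_snd (μ := C.lengthLaw))
      ).comp_measurePreserving (e 0)).neg
  have h1 : MemLp (fun ω : Config => deriv C.V (ω 1).1) 2 C.gibbs :=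
    (C.memLp_force.comp_measurePreserving (measurePreserving_fst (μ := C.lengthLaw)
      (ν := gaussianReal 0 C.T.toNNReal))).comp_measurePreserving (e 1)
  have hind : IndepFun (fun ω : Config => -(ω 0).2) (fun ω : Config => deriv C.V (ω 1).1)
      C.gibbs := by
    refine indepFun_of_dependsOn (Λ := {0}) (Λ' := {1}) (by simp) (by fun_prop) (by fun_prop)
      (fun a b h => ?_) (fun a b h => ?_)
    · simp [h 0 (by simp)]
    · simp [h 1 (by simp)]
  refine ⟨hm, ?_, {0, 1}, fun a b h => ?_⟩
  · rw [memLp_two_iff_integrable_sq hm.aestronglyMeasurable]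
    have h2 := (hind.comp (φ := fun t : ℝ => t ^ 2) (ψ := fun t : ℝ => t ^ 2) (by fun_prop)
      (by fun_prop)).integrable_mul h0.integrable_sq h1.integrable_sq
    refine h2.congr (ae_of_all _ fun ω => ?_)
    simp [currentFun, mul_pow]
  · simp [currentFun, h 0 (by simp), h 1 (by simp)]

/-- The class of the energy current `j_{0,1}` in `𝓗`. -/
def current : C.H := C.toH ⟨C.currentFun, C.currentFun_mem⟩

end Chain
end OscillatorChain

/-! Momentum reversal `R : p ↦ -p` turns the non-reversible problem into a symmetric one. The
Liouville part is antisymmetric and changes sign under `R`; the noise is symmetric and commutes with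
`R`. Hence `R 𝔏'` is symmetric, while the current `j` is odd. Moreover the flips have a spectral gap
on odd functions, so the Dirichlet form controls `‖u - R u‖²` with the constant `γ / 2`
(`inner_generator_le`).

Existence of the limit (`exists_tendsto_inner_resolvent`): for `g(l) = ≪j, u_l≫`, symmetry gives
`g'(l) = ≪R u_l, u_l≫`, which is the squared norm of the even part of `u_l` minus that of its odd
part. By the gap the odd part is bounded uniformly in `l`, so `g(l) + K l` is increasing for a
suitable `K`; as `g ≥ 0`, it has a finite limit at `0`.

The lower bound is a Cauchy–Schwarz argument with an odd trial vector `f`. If `≪f, 𝔏' u≫² ≤ D ≪u,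
-𝔏' u≫` on the domain, then inserting `𝔏' u_l = l u_l - j` and letting `l ↓ 0` gives `≪f, j≫² ≤ D
σ`; the term `l ≪f, u_l≫` disappears because it only sees the odd part of `u_l`.

The trial function is `f = -p_0 (V'(r_0) + V'(r_1))`, with `≪f, j≫ = T Var V'`. The sum of two
forces is chosen so that `𝔄 p_0 = V'(r_1) - V'(r_0)` produces a difference of squares, that is, a
discrete gradient, which is null in `𝓗`. Up to gradients the rest of `𝔄 f` equals `-X_0 (p_0 p_1
(V''(r_1) - m))`, where `X_0` is the rotation of `(p_0, p_1)` (`liouville_trialFun_add_rotation`);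
thus `≪𝔄 f, u≫` is also controlled by the exchange part of the Dirichlet form. Any constant `m` is
allowed, since `p_1² - p_0²` is a gradient; the mean of `V''` turns the second moment into a
variance.

On the core, both the Dirichlet form and `≪f, 𝔏' u≫` are genuine `L²(μ)` pairings with the functions
`D = gather (flipDiff · u)` and `X = gather (rotation · u)`, formally the increment and the rotation
at `0` of `∑_x θ_x u`. Cauchy–Schwarz for the pair `(D, X)` then yields the constant in
`sq_corr_trialFun_le`. Closedness carries each estimate from the core to the whole generator
(`generator_induction`). -/

namespace OscillatorChain

/-! ### Dissipative generators -/

section Semigroup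

variable {E : Type*} [NormedAddCommGroup E] [NormedSpace ℝ E]

lemma tendsto_coe_nhdsGT_zero :
    Tendsto (fun h : ℝ≥0 => (h : ℝ)) (𝓝[>] 0) (𝓝[>] 0) := by
  refine tendsto_nhdsWithin_iff.2 ⟨?_, ?_⟩
  · have : Tendsto (fun h : ℝ≥0 => (h : ℝ)) (𝓝 0) (𝓝 ((0 : ℝ≥0) : ℝ)) :=
      NNReal.continuous_coe.tendsto 0
    exact this.mono_left nhdsWithin_le_nhds
  · filter_upwards [self_mem_nhdsWithin] with h hh
    exact NNReal.coe_pos.2 hh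

lemma tendsto_toNNReal_sub_nhdsGT (t : ℝ) :
    Tendsto (fun s : ℝ => (s - t).toNNReal) (𝓝[>] t) (𝓝[>] 0) := by
  refine tendsto_nhdsWithin_iff.2 ⟨?_, ?_⟩
  · have : Tendsto (fun s : ℝ => (s - t).toNNReal) (𝓝 t) (𝓝 (t - t).toNNReal) :=
      (continuous_real_toNNReal.comp (continuous_id.sub continuous_const)).tendsto t
    simp only [sub_self, Real.toNNReal_zero] at this
    exact this.mono_left nhdsWithin_le_nhds
  · filter_upwards [self_mem_nhdsWithin] with s hs
    exact Real.toNNReal_pos.2 (sub_pos.2 hs)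

/-- The discounted orbit of a semigroup, extended to negative times by its value at `0`. -/
def discountedOrbit (P : ℝ≥0 → E →L[ℝ] E) (l : ℝ) (x : E) (s : ℝ) : E :=
  Real.exp (-(l * s)) • P s.toNNReal x

lemma continuous_discountedOrbit {P : ℝ≥0 → E →L[ℝ] E} (hP : IsC0Semigroup P) (l : ℝ) (x : E) :
    Continuous (discountedOrbit P l x) := by
  unfold discountedOrbit
  exact (Real.continuous_exp.comp (continuous_const.mul continuous_id).neg).smul
    ((hP.continuous x).comp continuous_real_toNNReal)

/-- The semigroup law moves the window of integration from `[0, a]` to `[h, a + h]`; the discount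
factor lost in the translation is `exp (l h)`. -/
lemma apply_integral_discountedOrbit [CompleteSpace E] {P : ℝ≥0 → E →L[ℝ] E}
    (hP : IsC0Semigroup P) (l : ℝ)
    (x : E) {a : ℝ} (ha : 0 ≤ a) (h : ℝ≥0) :
    P h (∫ s in (0 : ℝ)..a, discountedOrbit P l x s) =
      Real.exp (l * h) • ((∫ s in (0 : ℝ)..(a + h), discountedOrbit P l x s) -
        ∫ s in (0 : ℝ)..h, discountedOrbit P l x s) := by
  have hc := continuous_discountedOrbit hP l x
  have hi (u v : ℝ) : IntervalIntegrable (discountedOrbit P l x) volume u v :=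
    hc.intervalIntegrable u v
  rw [intervalIntegral.integral_interval_sub_left (hi _ _) (hi _ _),
    ← ContinuousLinearMap.intervalIntegral_comp_comm _ (hi _ _)]
  have h1 : (∫ s in (h : ℝ)..(a + h), discountedOrbit P l x s) =
      ∫ s in (0 : ℝ)..a, discountedOrbit P l x (s + h) := by
    rw [intervalIntegral.integral_comp_add_right (fun s => discountedOrbit P l x s), zero_add]
  rw [h1, ← intervalIntegral.integral_smul]
  refine intervalIntegral.integral_congr fun s hs => ?_
  rw [Set.uIcc_of_le ha] at hs
  simp only [discountedOrbit, map_smul]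
  rw [smul_smul, ← Real.exp_add, Real.toNNReal_add hs.1 h.coe_nonneg, Real.toNNReal_coe, add_comm _ h,
    hP.add]
  simp only [ContinuousLinearMap.comp_apply]
  congr 2
  ring

/-- Differentiating `apply_integral_discountedOrbit` at `h = 0` gives one term from the exponential
and one from each end of the window. As `a → ∞` the second component tends formally to `l w - x`:
this is a truncated resolvent. -/
lemma integral_discountedOrbit_mem [CompleteSpace E] {P : ℝ≥0 → E →L[ℝ] E} {G : Submodule ℝ (E × E)}
    (hP : IsC0Semigroup P) (hG : IsGeneratorOf G P) (l : ℝ) (x : E) {a : ℝ} (ha : 0 ≤ a) :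
    ((∫ s in (0 : ℝ)..a, discountedOrbit P l x s),
      l • (∫ s in (0 : ℝ)..a, discountedOrbit P l x s) + (discountedOrbit P l x a - x)) ∈ G := by
  have hc := continuous_discountedOrbit hP l x
  rw [hG]
  have hd (b : ℝ) : HasDerivAt (fun u => ∫ s in (0 : ℝ)..u, discountedOrbit P l x s)
      (discountedOrbit P l x b) b :=
    intervalIntegral.integral_hasDerivAt_right (hc.intervalIntegrable _ _)
      hc.stronglyMeasurable.stronglyMeasurableAtFilter hc.continuousAt
  have h1 : HasDerivAt (fun h : ℝ => ∫ s in (0 : ℝ)..(a + h), discountedOrbit P l x s)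
      (discountedOrbit P l x a) 0 := by
    have := HasDerivAt.comp_const_add (f := fun u => ∫ s in (0 : ℝ)..u, discountedOrbit P l x s)
      a 0 (by simpa using hd a)
    simpa using this
  have h2 : HasDerivAt (fun h : ℝ => Real.exp (l * h)) l 0 := by
    have := ((hasDerivAt_id (0 : ℝ)).const_mul l).exp
    simpa using this
  have h3 := (h2.fun_smul (h1.sub (hd 0))).tendsto_slope_zero_right
  have h4 := h3.comp tendsto_coe_nhdsGT_zero
  have h0 : discountedOrbit P l x 0 = x := by simp [discountedOrbit, hP.zero]
  simp only [h0] at h4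
  convert h4 using 2 with h
  · simp [apply_integral_discountedOrbit hP l x ha h]
  · simp [add_comm]

/-- The domain of the generator of a strongly continuous semigroup is dense. -/
lemma closure_domain_eq_univ [CompleteSpace E] {P : ℝ≥0 → E →L[ℝ] E} {G : Submodule ℝ (E × E)}
    (hP : IsC0Semigroup P) (hG : IsGeneratorOf G P) :
    closure {x : E | ∃ y, (x, y) ∈ G} = Set.univ := by
  refine Set.eq_univ_of_forall fun x => ?_
  have hc := continuous_discountedOrbit hP 0 x
  have hd : HasDerivAt (fun u => ∫ s in (0 : ℝ)..u, discountedOrbit P 0 x s)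
      (discountedOrbit P 0 x 0) 0 :=
    intervalIntegral.integral_hasDerivAt_right (hc.intervalIntegrable _ _)
      hc.stronglyMeasurable.stronglyMeasurableAtFilter hc.continuousAt
  have h0 : discountedOrbit P 0 x 0 = x := by simp [discountedOrbit, hP.zero]
  rw [h0] at hd
  -- With `l = 0`, the averages `a⁻¹ ∫_0^a P_s x ds` lie in the domain and converge to `x`.
  refine mem_closure_of_tendsto hd.tendsto_slope_zero_right ?_
  filter_upwards [self_mem_nhdsWithin] with a ha
  have := integral_discountedOrbit_mem hP hG 0 x (le_of_lt ha)
  refine ⟨a⁻¹ • ((0 : ℝ) • (∫ s in (0 : ℝ)..a, discountedOrbit P 0 x s) +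
    (discountedOrbit P 0 x a - x)), ?_⟩
  simpa using G.smul_mem a⁻¹ this

/-- The operators `P s` and `P t` commute, so `P t` maps difference quotients at `x` to difference
quotients at `P t x`. -/
lemma apply_mem_of_mem {P : ℝ≥0 → E →L[ℝ] E} {G : Submodule ℝ (E × E)}
    (hP : IsC0Semigroup P) (hG : IsGeneratorOf G P) {x y : E} (h : (x, y) ∈ G) (t : ℝ≥0) :
    (P t x, P t y) ∈ G := by
  rw [hG] at h ⊢
  have := ((P t).continuous.tendsto y).comp h
  refine this.congr fun s => ?_
  have e : P s (P t x) = P t (P s x) := by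
    rw [← ContinuousLinearMap.comp_apply, ← hP.add, add_comm, hP.add,
      ContinuousLinearMap.comp_apply]
  simp [e]

end Semigroup

/-! ### Contractivity, resolvents and the abstract variational bound in a Hilbert space. -/

section Hilbert

variable {E : Type*} [NormedAddCommGroup E] [InnerProductSpace ℝ E]

/-- On the domain, `‖P_t x‖²` has right derivative `2 ⟪P_t x, P_t y⟫ ≤ 0`; density of the domain
does the rest. Only right derivatives are available, because the generator is defined by a one-sided
limit. -/
lemma norm_apply_le_of_dissipative [CompleteSpace E] {P : ℝ≥0 → E →L[ℝ] E}
    {G : Submodule ℝ (E × E)}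
    (hP : IsC0Semigroup P) (hG : IsGeneratorOf G P) (hdis : ∀ z ∈ G, inner ℝ z.1 z.2 ≤ 0)
    (t : ℝ≥0) (x : E) : ‖P t x‖ ≤ ‖x‖ := by
  have hcl : IsClosed {x : E | ‖P t x‖ ≤ ‖x‖} :=
    isClosed_le (P t).continuous.norm continuous_norm
  have hdom : {x : E | ∃ y, (x, y) ∈ G} ⊆ {x : E | ‖P t x‖ ≤ ‖x‖} := by
    rintro x ⟨y, hxy⟩
    have hcont : Continuous fun s : ℝ => P s.toNNReal x :=
      (hP.continuous x).comp continuous_real_toNNReal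
    have hder (s : ℝ) (hs : 0 ≤ s) :
        HasDerivWithinAt (fun s : ℝ => P s.toNNReal x) (P s.toNNReal y) (Set.Ici s) s := by
      rw [← hasDerivWithinAt_Ioi_iff_Ici, hasDerivWithinAt_iff_tendsto_slope' (by simp)]
      have h1 := (hG _ _).1 (apply_mem_of_mem hP hG hxy s.toNNReal)
      refine (h1.comp (tendsto_toNNReal_sub_nhdsGT s)).congr' ?_
      filter_upwards [self_mem_nhdsWithin] with r hr
      have hr' : 0 ≤ r - s := (sub_pos.2 hr).le
      have e : r.toNNReal = (r - s).toNNReal + s.toNNReal := by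
        rw [← Real.toNNReal_add hr' hs, sub_add_cancel]
      simp only [Function.comp_apply, slope_def_module]
      rw [e, hP.add, ContinuousLinearMap.comp_apply, Real.coe_toNNReal _ hr']
    have h2 := image_le_of_deriv_right_le_deriv_boundary (a := 0) (b := (t : ℝ))
      (f := fun s : ℝ => ‖P s.toNNReal x‖ ^ 2)
      (f' := fun s => 2 * inner ℝ (P s.toNNReal x) (P s.toNNReal y))
      (B := fun _ => ‖x‖ ^ 2) (B' := fun _ => 0)
      (hcont.norm.pow 2).continuousOn (fun s hs => (hder s hs.1).norm_sq)
      (by simp [hP.zero]) continuousOn_const (fun s _ => hasDerivWithinAt_const _ _ _)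
      (fun s _ => by
        have := hdis _ (apply_mem_of_mem hP hG hxy s.toNNReal)
        simp only at this
        linarith)
      (x := (t : ℝ)) ⟨t.2, le_rfl⟩
    simp only [Real.toNNReal_coe] at h2
    exact (pow_le_pow_iff_left₀ (norm_nonneg _) (norm_nonneg _) two_ne_zero).1 h2
  have := closure_minimal hdom hcl
  rw [closure_domain_eq_univ hP hG] at this
  exact this (Set.mem_univ x)

/-- Pairing the equation with `w` gives `l ‖w‖² ≤ ⟪w, y⟫`. This a priori bound yields uniqueness,
the Cauchy property of the truncated resolvents and continuity in `l`. -/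
lemma norm_le_of_dissipative {G : Submodule ℝ (E × E)} (hdis : ∀ z ∈ G, inner ℝ z.1 z.2 ≤ 0)
    {l : ℝ} {w y : E} (h : (w, l • w - y) ∈ G) : l * ‖w‖ ≤ ‖y‖ := by
  have h1 := hdis _ h
  simp only [inner_sub_right, inner_smul_right, real_inner_self_eq_norm_sq] at h1
  have h2 := real_inner_le_norm w y
  rcases (norm_nonneg w).eq_or_lt with h0 | h0
  · rw [← h0]; simp
  · nlinarith

/-- The resolvent equation of a dissipative generator is uniquely solvable. -/
theorem existsUnique_resolvent [CompleteSpace E] {P : ℝ≥0 → E →L[ℝ] E} {G : Submodule ℝ (E × E)}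
    (hP : IsC0Semigroup P) (hG : IsGeneratorOf G P) (hcl : IsClosed (G : Set (E × E)))
    (hdis : ∀ z ∈ G, inner ℝ z.1 z.2 ≤ 0) {l : ℝ} (hl : 0 < l) (y : E) :
    ∃! w : E, (w, l • w - y) ∈ G := by
  set I : ℕ → E := fun n => ∫ s in (0 : ℝ)..n, discountedOrbit P l y s with hI
  have hmem (n : ℕ) : (I n, l • I n + (discountedOrbit P l y n - y)) ∈ G :=
    integral_discountedOrbit_mem hP hG l y (Nat.cast_nonneg n)
  have hexp : Tendsto (fun n : ℕ => Real.exp (-(l * n)) * ‖y‖) atTop (𝓝 0) := by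
    have : Tendsto (fun n : ℕ => -(l * n)) atTop atBot :=
      tendsto_neg_atTop_atBot.comp (tendsto_natCast_atTop_atTop.const_mul_atTop hl)
    simpa using (Real.tendsto_exp_atBot.comp this).mul_const ‖y‖
  have hnorm (n : ℕ) : ‖discountedOrbit P l y n‖ ≤ Real.exp (-(l * n)) * ‖y‖ := by
    rw [discountedOrbit, norm_smul, Real.norm_eq_abs, abs_of_pos (Real.exp_pos _)]
    gcongr
    exact norm_apply_le_of_dissipative hP hG hdis _ _
  have horb : Tendsto (fun n : ℕ => discountedOrbit P l y n) atTop (𝓝 0) :=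
    squeeze_zero_norm hnorm hexp
  have hcauchy : CauchySeq I := by
    refine cauchySeq_of_le_tendsto_0 (fun n : ℕ => l⁻¹ * (2 * (Real.exp (-(l * n)) * ‖y‖))) ?_ ?_
    · intro n m k hn hm
      -- The difference of two truncated resolvents solves a resolvent equation whose datum is a
      -- difference of discounted orbits. The a priori bound makes it exponentially small, so no
      -- improper integral is needed.
      have h1 := G.sub_mem (hmem n) (hmem m)
      have h2 : (I n - I m, l • (I n - I m) -
          (discountedOrbit P l y m - discountedOrbit P l y n)) ∈ G := by
        convert h1 using 1
        ext
        · rfl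
        · simp only [Prod.snd_sub, smul_sub]
          abel
      have h3 := norm_le_of_dissipative hdis h2
      have h4 := norm_sub_le (discountedOrbit P l y m) (discountedOrbit P l y n)
      have hle (i : ℕ) (hi : k ≤ i) : ‖discountedOrbit P l y i‖ ≤ Real.exp (-(l * k)) * ‖y‖ := by
        refine (hnorm i).trans ?_
        gcongr
      rw [dist_eq_norm, ← div_eq_inv_mul, le_div_iff₀ hl, mul_comm]
      linarith [hle n hn, hle m hm]
    · simpa using (hexp.const_mul 2).const_mul l⁻¹
  obtain ⟨w, hw⟩ := cauchySeq_tendsto_of_complete hcauchy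
  have hlim : (w, l • w - y) ∈ G := by
    have : Tendsto (fun n => (I n, l • I n + (discountedOrbit P l y n - y))) atTop
        (𝓝 (w, l • w + (0 - y))) :=
      hw.prodMk_nhds ((hw.const_smul l).add (horb.sub_const y))
    have := hcl.mem_of_tendsto this (Eventually.of_forall hmem)
    simpa [sub_eq_add_neg] using this
  refine ⟨w, hlim, fun w' hw' => ?_⟩
  have h1 := G.sub_mem hw' hlim
  have h2 : (w' - w, l • (w' - w) - 0) ∈ G := by
    convert h1 using 1
    ext
    · rfl
    · simp only [Prod.snd_sub, smul_sub]
      abel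
  have h3 := norm_le_of_dissipative hdis h2
  rw [norm_zero] at h3
  have : ‖w' - w‖ = 0 := le_antisymm (by nlinarith [norm_nonneg (w' - w)]) (norm_nonneg _)
  exact sub_eq_zero.1 (norm_eq_zero.1 this)

/-- Resolvent identity: `u m - u l` solves the equation at `m` with datum `(l - m) u l`, so the a
priori bound applies twice. -/
lemma continuousAt_resolvent {G : Submodule ℝ (E × E)} (hdis : ∀ z ∈ G, inner ℝ z.1 z.2 ≤ 0)
    {y : E} {u : ℝ → E} (hu : ∀ l, 0 < l → (u l, l • u l - y) ∈ G) {l : ℝ} (hl : 0 < l) :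
    ContinuousAt u l := by
  rw [ContinuousAt, tendsto_iff_norm_sub_tendsto_zero]
  have hb : Tendsto (fun m : ℝ => m⁻¹ * (|l - m| * (l⁻¹ * ‖y‖))) (𝓝 l)
      (𝓝 (l⁻¹ * (|l - l| * (l⁻¹ * ‖y‖)))) :=
    (tendsto_inv₀ hl.ne').mul (((tendsto_const_nhds.sub tendsto_id).abs).mul_const _)
  simp only [sub_self, abs_zero, zero_mul, mul_zero] at hb
  refine squeeze_zero' (Eventually.of_forall fun m => norm_nonneg _) ?_ hb
  filter_upwards [lt_mem_nhds hl] with m hm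
  have h1 := G.sub_mem (hu m hm) (hu l hl)
  have h2 : (u m - u l, m • (u m - u l) - (l - m) • u l) ∈ G := by
    convert h1 using 1
    ext
    · rfl
    · simp only [Prod.snd_sub, smul_sub, sub_smul]
      abel
  have h3 := norm_le_of_dissipative hdis h2
  have h4 := norm_le_of_dissipative hdis (hu l hl)
  rw [norm_smul, Real.norm_eq_abs] at h3
  rw [← div_eq_inv_mul, le_div_iff₀ hm, mul_comm]
  refine h3.trans ?_
  gcongr
  rw [← div_eq_inv_mul, le_div_iff₀ hl, mul_comm]
  exact h4

/-- Abstract Green–Kubo bound: if a generator `G` is dissipative with a spectral gap on the vectors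
that are odd under the time reversal `R`, is symmetric up to `R`, and controls the functional
`⟨f, ·⟩` by its Dirichlet form, then the resolvent quadratic form of an odd vector `j` has a limit
at `0`, and this limit is bounded below. -/
theorem exists_tendsto_inner_resolvent [CompleteSpace E] {P : ℝ≥0 → E →L[ℝ] E}
    {G : Submodule ℝ (E × E)}
    (hP : IsC0Semigroup P) (hG : IsGeneratorOf G P) (hcl : IsClosed (G : Set (E × E)))
    (R : E → E) (hR : ∀ x y, inner ℝ (R x) y = inner ℝ x (R y)) (hRR : ∀ x, R (R x) = x)
    {c : ℝ} (hc : 0 < c) (hgap : ∀ z ∈ G, inner ℝ z.1 z.2 ≤ -c * ‖z.1 - R z.1‖ ^ 2)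
    (hsym : ∀ z ∈ G, ∀ w ∈ G, inner ℝ (R z.1) w.2 = inner ℝ z.2 (R w.1))
    {j f : E} (hj : R j = -j) (hf : R f = -f) {D : ℝ} (hD0 : 0 ≤ D)
    (hD : ∀ z ∈ G, inner ℝ f z.2 ^ 2 ≤ D * -inner ℝ z.1 z.2) :
    ∃ (u : ℝ → E) (σ : ℝ), (∀ l : ℝ, 0 < l → ∀ w, (w, l • w - j) ∈ G ↔ w = u l) ∧
      Tendsto (fun l => inner ℝ j (u l)) (𝓝[>] 0) (𝓝 σ) ∧ 0 ≤ σ ∧ inner ℝ f j ^ 2 ≤ D * σ := by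
  have hdis : ∀ z ∈ G, inner ℝ z.1 z.2 ≤ 0 := fun z hz =>
    (hgap z hz).trans (by have := sq_nonneg ‖z.1 - R z.1‖; nlinarith)
  have hex : ∀ l : ℝ, ∃ w, 0 < l → ((w, l • w - j) ∈ G ∧ ∀ w', (w', l • w' - j) ∈ G → w' = w) := by
    intro l
    by_cases hl : 0 < l
    · obtain ⟨w, hw, hw'⟩ := existsUnique_resolvent hP hG hcl hdis hl j
      exact ⟨w, fun _ => ⟨hw, hw'⟩⟩
    · exact ⟨0, fun h => absurd h hl⟩
  choose u hu using hex
  have hmem : ∀ l, 0 < l → (u l, l • u l - j) ∈ G := fun l hl => (hu l hl).1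
  set g : ℝ → ℝ := fun l => inner ℝ j (u l) with hg
  -- An odd vector only sees the odd part of `x`.
  have hodd (k x : E) (hk : R k = -k) : inner ℝ k x = (1 / 2) * inner ℝ k (x - R x) := by
    rw [inner_sub_right, ← hR, hk, inner_neg_left]
    ring
  have hself (l : ℝ) : inner ℝ (u l) (l • u l - j) = l * ‖u l‖ ^ 2 - g l := by
    rw [inner_sub_right, inner_smul_right, real_inner_self_eq_norm_sq, hg,
      real_inner_comm j (u l)]
  -- The gap gives `c ‖u - R u‖² ≤ g`, and oddness of `j` gives `g ≤ ‖j‖ ‖u - R u‖ / 2`. The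
  -- resulting bound does not depend on `l`.
  have hO (l : ℝ) (hl : 0 < l) : ‖u l - R (u l)‖ ≤ ‖j‖ / (2 * c) := by
    have h1 := hgap _ (hmem l hl)
    simp only [hself] at h1
    have h2 : g l = (1 / 2) * inner ℝ j (u l - R (u l)) := hodd j (u l) hj
    have h3 := real_inner_le_norm j (u l - R (u l))
    have h4 : 0 ≤ l * ‖u l‖ ^ 2 := by positivity
    rw [le_div_iff₀ (by positivity)]
    rcases (norm_nonneg (u l - R (u l))).eq_or_lt with h0 | h0
    · rw [← h0]; simp
    · nlinarith
  set K : ℝ := (‖j‖ / (2 * c)) ^ 2 with hK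
  have hg0 (l : ℝ) (hl : 0 < l) : 0 ≤ g l := by
    have h1 := hdis _ (hmem l hl)
    simp only [hself] at h1
    have : 0 ≤ l * ‖u l‖ ^ 2 := by positivity
    linarith
  -- Symmetry up to `R`, applied to the two resolvent equations; each term with `j` becomes `g(l)`
  -- or `g(m)` because `R j = -j`.
  have hdiff (l m : ℝ) (hl : 0 < l) (hm : 0 < m) :
      g m - g l = (m - l) * inner ℝ (R (u l)) (u m) := by
    have h1 := hsym _ (hmem l hl) _ (hmem m hm)
    simp only [inner_sub_right, inner_sub_left, inner_smul_right, real_inner_smul_left] at h1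
    rw [hR (u l) j, hj, inner_neg_right, ← hR j, hj, inner_neg_left, real_inner_comm j (u l),
      ← hR (u l) (u m)] at h1
    simp only [hg]
    linarith
  have hRn (x : E) : ‖R x‖ = ‖x‖ := by
    rw [← sq_eq_sq₀ (norm_nonneg _) (norm_nonneg _), ← real_inner_self_eq_norm_sq,
      ← real_inner_self_eq_norm_sq, hR, hRR]
  have hderiv (l : ℝ) (hl : 0 < l) : HasDerivAt g (inner ℝ (R (u l)) (u l)) l := by
    rw [hasDerivAt_iff_tendsto_slope]
    have h1 : Tendsto (fun m => inner ℝ (R (u l)) (u m)) (𝓝[≠] l)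
        (𝓝 (inner ℝ (R (u l)) (u l))) :=
      (tendsto_const_nhds.inner (continuousAt_resolvent hdis hmem hl)).mono_left nhdsWithin_le_nhds
    refine h1.congr' ?_
    filter_upwards [self_mem_nhdsWithin, nhdsWithin_le_nhds (lt_mem_nhds hl)] with m hm1 hm2
    rw [slope_def_field, hdiff l m hl hm2, mul_div_cancel_left₀ _ (sub_ne_zero.2 hm1)]
  -- `⟪R u, u⟫` is the squared norm of the even part of `u` minus that of the odd part, and the
  -- latter is at most `K`.
  have hlower (l : ℝ) (hl : 0 < l) : -K ≤ inner ℝ (R (u l)) (u l) := by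
    have h1 : ‖u l - R (u l)‖ ^ 2 ≤ K := by
      rw [hK]
      gcongr
      exact hO l hl
    have h2 := norm_sub_sq_real (u l) (R (u l))
    rw [hRn, real_inner_comm] at h2
    nlinarith [sq_nonneg ‖u l‖, norm_nonneg (u l + R (u l)), norm_add_sq_real (u l) (R (u l))]
  -- Since `g' ≥ -K`, adding `K l` makes `g` increasing; with the lower bound `0` this forces a
  -- limit at `0`, without any upper estimate.
  have hmono : MonotoneOn (fun l => g l + K * l) (Set.Ioi 0) := by
    have hd (l : ℝ) (hl : 0 < l) :
        HasDerivAt (fun l => g l + K * l) (inner ℝ (R (u l)) (u l) + K * 1) l :=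
      (hderiv l hl).add ((hasDerivAt_id l).const_mul K)
    refine monotoneOn_of_deriv_nonneg (convex_Ioi 0)
      (fun l hl => (hd l hl).continuousAt.continuousWithinAt)
      (fun l hl => (hd l (by simpa using hl)).differentiableAt.differentiableWithinAt) ?_
    intro l hl
    rw [interior_Ioi] at hl
    rw [(hd l hl).deriv]
    linarith [hlower l hl]
  have hbdd : BddBelow ((fun l => g l + K * l) '' Set.Ioi 0) := by
    refine ⟨0, ?_⟩
    rintro _ ⟨l, hl, rfl⟩
    have : 0 ≤ K * l := mul_nonneg (sq_nonneg _) (le_of_lt hl)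
    linarith [hg0 l hl]
  have hlim := hmono.tendsto_nhdsGT hbdd
  set σ : ℝ := sInf ((fun l => g l + K * l) '' Set.Ioi 0) with hσ
  have hid : Tendsto (fun l : ℝ => l) (𝓝[>] 0) (𝓝 0) := tendsto_id.mono_left nhdsWithin_le_nhds
  have hgσ : Tendsto g (𝓝[>] 0) (𝓝 σ) := by
    have := hlim.sub (hid.const_mul K)
    simpa using this
  refine ⟨u, σ, fun l hl w => ⟨(hu l hl).2 w, fun h => h ▸ hmem l hl⟩, hgσ, ?_, ?_⟩
  · refine ge_of_tendsto hgσ ?_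
    filter_upwards [self_mem_nhdsWithin] with l hl using hg0 l hl
  -- Although `u l` itself may blow up as `l ↓ 0`, the odd vector `f` only sees its bounded odd
  -- part.
  have hfu : Tendsto (fun l => l * inner ℝ f (u l)) (𝓝[>] 0) (𝓝 0) := by
    have hb : Tendsto (fun l : ℝ => l * (1 / 2 * (‖f‖ * (‖j‖ / (2 * c))))) (𝓝[>] 0) (𝓝 0) := by
      simpa using hid.mul_const (1 / 2 * (‖f‖ * (‖j‖ / (2 * c))))
    refine squeeze_zero_norm' ?_ hb
    filter_upwards [self_mem_nhdsWithin] with l hl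
    have hl' : 0 < l := hl
    rw [hodd f (u l) hf, norm_mul, norm_mul, Real.norm_of_nonneg hl'.le,
      Real.norm_of_nonneg (by norm_num : (0 : ℝ) ≤ 1 / 2)]
    gcongr
    refine (norm_inner_le_norm _ _).trans ?_
    gcongr
    exact hO l hl'
  have hlhs := (hfu.sub_const (inner ℝ f j)).pow 2
  simp only [zero_sub, neg_sq] at hlhs
  refine le_of_tendsto_of_tendsto hlhs (hgσ.const_mul D) ?_
  filter_upwards [self_mem_nhdsWithin] with l hl
  have hl' : 0 < l := hl
  have h1 := hD _ (hmem l hl)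
  simp only [hself, inner_sub_right f, inner_smul_right] at h1
  refine h1.trans (mul_le_mul_of_nonneg_left ?_ hD0)
  have : 0 ≤ l * ‖u l‖ ^ 2 := by positivity
  linarith

end Hilbert

end OscillatorChain

namespace OscillatorChain

/-! ### Functions of controlled growth -/

namespace Chain

variable {C : Chain}

lemma continuous_force : Continuous (deriv C.V) := C.smooth.continuous_deriv (by simp)

lemma contDiff_force : ContDiff ℝ (⊤ : ℕ∞) (deriv C.V) :=
  ((contDiff_infty_iff_deriv (𝕜 := ℝ)).1 C.smooth).2

lemma continuous_deriv_force : Continuous (deriv (deriv C.V)) :=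
  contDiff_force.continuous_deriv (by simp)

lemma hasDerivAt_force (r : ℝ) : HasDerivAt (deriv C.V) (deriv (deriv C.V) r) r :=
  (contDiff_force.differentiable (by simp)).differentiableAt.hasDerivAt

lemma hasDerivAt_potential (r : ℝ) : HasDerivAt C.V (deriv C.V r) r :=
  (C.smooth.differentiable (by simp)).differentiableAt.hasDerivAt

variable (C) in
/-- The single-site weight `(1 + |p|)^k (1 + |V'(r)| + |V''(r)|)^a`. -/
def weight (k a : ℕ) (z : ℝ × ℝ) : ℝ :=
  (1 + |z.2|) ^ k * (1 + |deriv C.V z.1| + |deriv (deriv C.V) z.1|) ^ a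

lemma one_le_weight (k a : ℕ) (z : ℝ × ℝ) : 1 ≤ C.weight k a z := by
  unfold weight
  have h1 : 1 ≤ (1 + |z.2|) ^ k := one_le_pow₀ (by linarith [abs_nonneg z.2])
  have h2 : 1 ≤ (1 + |deriv C.V z.1| + |deriv (deriv C.V) z.1|) ^ a :=
    one_le_pow₀ (by linarith [abs_nonneg (deriv C.V z.1), abs_nonneg (deriv (deriv C.V) z.1)])
  nlinarith

lemma weight_mono {k k' a a' : ℕ} (hk : k ≤ k') (ha : a ≤ a') (z : ℝ × ℝ) :
    C.weight k a z ≤ C.weight k' a' z := by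
  unfold weight
  have h1 : 1 ≤ 1 + |z.2| := by linarith [abs_nonneg z.2]
  have h2 : 1 ≤ 1 + |deriv C.V z.1| + |deriv (deriv C.V) z.1| := by
    linarith [abs_nonneg (deriv C.V z.1), abs_nonneg (deriv (deriv C.V) z.1)]
  gcongr

lemma weight_mul (k k' a a' : ℕ) (z : ℝ × ℝ) :
    C.weight k a z * C.weight k' a' z = C.weight (k + k') (a + a') z := by
  unfold weight
  rw [pow_add, pow_add]
  ring

lemma prod_weight_mono {k k' a a' : ℕ} {Λ Λ' : Finset ℤ} (hk : k ≤ k') (ha : a ≤ a')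
    (hΛ : Λ ⊆ Λ') (ω : Config) :
    ∏ i ∈ Λ, C.weight k a (ω i) ≤ ∏ i ∈ Λ', C.weight k' a' (ω i) :=
  (Finset.prod_le_prod (fun _ _ => zero_le_one.trans (one_le_weight k a _))
    fun _ _ => weight_mono hk ha _).trans
    (Finset.prod_le_prod_of_subset_of_one_le hΛ
      (fun _ _ => zero_le_one.trans (one_le_weight _ _ _)) fun _ _ _ => one_le_weight _ _ _)

lemma one_le_prod_weight (k a : ℕ) (Λ : Finset ℤ) (ω : Config) :
    1 ≤ ∏ i ∈ Λ, C.weight k a (ω i) :=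
  Finset.one_le_prod fun i _ => one_le_weight k a (ω i)

variable (C) in
/-- Measurable local functions which grow at most polynomially in the momenta and at most like the
power `a` of `V'` and `V''` in the distances. -/
def Tame (a : ℕ) (h : Config → ℝ) : Prop :=
  Measurable h ∧ ∃ (K : ℝ) (k : ℕ) (Λ : Finset ℤ), DependsOn h (Λ : Set ℤ) ∧
    ∀ ω, |h ω| ≤ K * ∏ i ∈ Λ, C.weight k a (ω i)

lemma dependsOn_mono {h : Config → ℝ} {Λ Λ' : Finset ℤ} (hh : DependsOn h (Λ : Set ℤ))
    (hΛ : Λ ⊆ Λ') : DependsOn h (Λ' : Set ℤ) :=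
  fun _ _ hab => hh fun i hi => hab i (hΛ hi)

namespace Tame

variable {a b : ℕ} {h k : Config → ℝ}

lemma mono (hh : C.Tame a h) (hab : a ≤ b) : C.Tame b h := by
  obtain ⟨hm, K, k, Λ, hd, hb⟩ := hh
  have hK : 0 ≤ K := by
    have h1 := (abs_nonneg _).trans (hb 0)
    have h2 := one_le_prod_weight (C := C) k a Λ 0
    nlinarith
  exact ⟨hm, K, k, Λ, hd, fun ω => (hb ω).trans
    (mul_le_mul_of_nonneg_left (prod_weight_mono le_rfl hab le_rfl ω) hK)⟩

lemma exists_bound (hh : C.Tame a h) : ∃ (K : ℝ) (k : ℕ) (Λ : Finset ℤ), 0 ≤ K ∧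
    DependsOn h (Λ : Set ℤ) ∧ ∀ ω, |h ω| ≤ K * ∏ i ∈ Λ, C.weight k a (ω i) := by
  obtain ⟨-, K, k, Λ, hd, hb⟩ := hh
  refine ⟨K, k, Λ, ?_, hd, hb⟩
  have h1 := (abs_nonneg _).trans (hb 0)
  have h2 := one_le_prod_weight (C := C) k a Λ 0
  nlinarith

/-- The exponent of the forces is additive, which makes it a budget: `1` ensures square
integrability, `2` integrability. Powers of the momenta are free. -/
lemma mul (hh : C.Tame a h) (hk : C.Tame b k) : C.Tame (a + b) (fun ω => h ω * k ω) := by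
  refine ⟨hh.1.mul hk.1, ?_⟩
  obtain ⟨K, m, Λ, hK, hd, hb⟩ := hh.exists_bound
  obtain ⟨K', m', Λ', hK', hd', hb'⟩ := hk.exists_bound
  refine ⟨K * K', m + m', Λ ∪ Λ', fun x y hxy => ?_, fun ω => ?_⟩
  · exact congrArg₂ (· * ·) (dependsOn_mono hd Finset.subset_union_left hxy)
      (dependsOn_mono hd' Finset.subset_union_right hxy)
  · rw [abs_mul]
    simp only [← weight_mul, Finset.prod_mul_distrib]
    have h1 := (hb ω).trans (mul_le_mul_of_nonneg_left (prod_weight_mono (C := C) (le_refl m)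
      (le_refl a) (Finset.subset_union_left (s₁ := Λ) (s₂ := Λ')) ω) hK)
    have h2 := (hb' ω).trans (mul_le_mul_of_nonneg_left (prod_weight_mono (C := C) (le_refl m')
      (le_refl b) (Finset.subset_union_right (s₁ := Λ) (s₂ := Λ')) ω) hK')
    have := mul_le_mul h1 h2 (abs_nonneg _) ((abs_nonneg _).trans h1)
    linarith

lemma add (hh : C.Tame a h) (hk : C.Tame a k) : C.Tame a (fun ω => h ω + k ω) := by
  refine ⟨hh.1.add hk.1, ?_⟩
  obtain ⟨K, m, Λ, hK, hd, hb⟩ := hh.exists_bound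
  obtain ⟨K', m', Λ', hK', hd', hb'⟩ := hk.exists_bound
  refine ⟨K + K', m + m', Λ ∪ Λ', fun x y hxy => ?_, fun ω => ?_⟩
  · exact congrArg₂ (· + ·) (dependsOn_mono hd Finset.subset_union_left hxy)
      (dependsOn_mono hd' Finset.subset_union_right hxy)
  · have h1 := (hb ω).trans (mul_le_mul_of_nonneg_left (prod_weight_mono (C := C)
      (Nat.le_add_right m m') (le_refl a) (Finset.subset_union_left (s₁ := Λ) (s₂ := Λ')) ω) hK)
    have h2 := (hb' ω).trans (mul_le_mul_of_nonneg_left (prod_weight_mono (C := C)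
      (Nat.le_add_left m' m) (le_refl a) (Finset.subset_union_right (s₁ := Λ) (s₂ := Λ')) ω) hK')
    have := abs_add_le (h ω) (k ω)
    linarith

lemma const (c : ℝ) : C.Tame a (fun _ => c) :=
  ⟨measurable_const, |c|, 0, ∅, fun _ _ _ => rfl, fun ω => by simp⟩

lemma const_mul (hh : C.Tame a h) (c : ℝ) : C.Tame a (fun ω => c * h ω) := by
  simpa using (const (C := C) (a := 0) c).mul hh

lemma neg (hh : C.Tame a h) : C.Tame a (fun ω => -h ω) := by
  simpa using hh.const_mul (-1)

lemma sub (hh : C.Tame a h) (hk : C.Tame a k) : C.Tame a (fun ω => h ω - k ω) := by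
  simpa [sub_eq_add_neg] using hh.add hk.neg

lemma sum {ι : Type*} (s : Finset ι) {F : ι → Config → ℝ} (hF : ∀ i ∈ s, C.Tame a (F i)) :
    C.Tame a (fun ω => ∑ i ∈ s, F i ω) := by
  classical
  induction s using Finset.induction_on with
  | empty => simpa using const (C := C) 0
  | insert i s hi ih =>
    simp only [Finset.sum_insert hi]
    exact (hF i (by simp)).add (ih fun j hj => hF j (by simp [hj]))

lemma of_bounded (hm : Measurable h) {Λ : Finset ℤ} (hd : DependsOn h (Λ : Set ℤ)) {K : ℝ}
    (hK : ∀ ω, |h ω| ≤ K) : C.Tame a h := by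
  refine ⟨hm, K, 0, Λ, hd, fun ω => (hK ω).trans ?_⟩
  have h1 := one_le_prod_weight (C := C) 0 a Λ ω
  have h2 := (abs_nonneg _).trans (hK ω)
  nlinarith

lemma momentum (x : ℤ) : C.Tame a (fun ω => (ω x).2) := by
  refine ⟨by fun_prop, 1, 1, {x}, fun ω η h => by simp [h x (by simp)], fun ω => ?_⟩
  have h1 : 1 ≤ (1 + |deriv C.V (ω x).1| + |deriv (deriv C.V) (ω x).1|) ^ a :=
    one_le_pow₀ (by
      have h2 := abs_nonneg (deriv C.V (ω x).1)
      have h3 := abs_nonneg (deriv (deriv C.V) (ω x).1)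
      linarith)
  simp only [Finset.prod_singleton, weight, pow_one, one_mul]
  nlinarith [abs_nonneg (ω x).2]

lemma force (x : ℤ) : C.Tame 1 (fun ω => deriv C.V (ω x).1) := by
  have := continuous_force (C := C)
  refine ⟨by fun_prop, 1, 0, {x}, fun ω η h => by simp [h x (by simp)], fun ω => ?_⟩
  simp only [Finset.prod_singleton, weight, pow_one, one_mul, pow_zero]
  linarith [abs_nonneg (deriv (deriv C.V) (ω x).1)]

lemma deriv_force (x : ℤ) : C.Tame 1 (fun ω => deriv (deriv C.V) (ω x).1) := by
  have := continuous_deriv_force (C := C)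
  refine ⟨by fun_prop, 1, 0, {x}, fun ω η h => by simp [h x (by simp)], fun ω => ?_⟩
  simp only [Finset.prod_singleton, weight, pow_one, one_mul, pow_zero]
  linarith [abs_nonneg (deriv C.V (ω x).1)]

end Tame

variable (C) in
/-- The hypothesis that `V''` is square integrable. -/
abbrev StiffnessL2 : Prop := MemLp (deriv (deriv C.V)) 2 C.lengthLaw

lemma stiffnessL2_of_gibbs
    (h : MemLp (fun ω : Config => deriv (deriv C.V) (ω 0).1) 2 C.gibbs) : C.StiffnessL2 := by
  have e : MeasurePreserving (fun ω : Config => (ω 0).1) C.gibbs C.lengthLaw :=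
    (measurePreserving_fst (μ := C.lengthLaw) (ν := gaussianReal 0 C.T.toNNReal)).comp
      (measurePreserving_eval_infinitePi (fun _ : ℤ => C.siteLaw) 0)
  rw [StiffnessL2, ← e.map_eq, memLp_map_measure_iff
    continuous_deriv_force.aestronglyMeasurable e.measurable.aemeasurable]
  exact h

lemma integrable_gaussian_one_add_abs_pow (v : ℝ≥0) (k : ℕ) :
    Integrable (fun p : ℝ => (1 + |p|) ^ k) (gaussianReal 0 v) := by
  have h : MemLp (fun p : ℝ => p) (k : ENNReal) (gaussianReal 0 v) :=
    memLp_id_gaussianReal' k (ENNReal.natCast_ne_top k)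
  have h' : MemLp (fun p : ℝ => 1 + ‖p‖) (k : ENNReal) (gaussianReal 0 v) :=
    (memLp_const (1 : ℝ)).add h.norm
  have h2 : (fun p : ℝ => ‖1 + ‖p‖‖ ^ k) = fun p => (1 + |p|) ^ k := by
    ext p
    rw [Real.norm_of_nonneg (by positivity), Real.norm_eq_abs]
  rw [← h2]
  exact h'.integrable_norm_pow'

lemma integrable_lengthLaw_sq (hV : C.StiffnessL2) :
    Integrable (fun r : ℝ => (1 + |deriv C.V r| + |deriv (deriv C.V) r|) ^ 2) C.lengthLaw := by
  have h1 : MemLp (deriv C.V) 2 C.lengthLaw := C.memLp_force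
  have h2 : MemLp (fun r => 1 + |deriv C.V r| + |deriv (deriv C.V) r|) 2 C.lengthLaw :=
    ((memLp_const (1 : ℝ)).add h1.abs).add hV.abs
  exact h2.integrable_sq

/-- The exponent `2` is what square integrability of `V'` and `V''` provides; every power of the
momentum is integrable since it is Gaussian. -/
lemma integrable_weight (hV : C.StiffnessL2) (k : ℕ) : Integrable (C.weight k 2) C.siteLaw := by
  have h := (integrable_lengthLaw_sq hV).mul_prod
    (integrable_gaussian_one_add_abs_pow C.T.toNNReal k)
  have e : C.weight k 2 = fun z : ℝ × ℝ =>
      (1 + |deriv C.V z.1| + |deriv (deriv C.V) z.1|) ^ 2 * (1 + |z.2|) ^ k := by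
    ext z
    exact mul_comm _ _
  rw [e]
  exact h

/-- The dominating weight is a product over the sites of a finite set, hence integrable for the
corresponding marginal product measure. -/
lemma Tame.integrable (hV : C.StiffnessL2) {h : Config → ℝ} (hh : C.Tame 2 h) :
    Integrable h C.gibbs := by
  obtain ⟨K, k, Λ, -, -, hb⟩ := hh.exists_bound
  have h1 : Integrable (fun v : Λ → ℝ × ℝ => ∏ i, C.weight k 2 (v i))
      (Measure.pi fun _ : Λ => C.siteLaw) :=
    Integrable.fintype_prod fun _ => integrable_weight hV k
  have e : MeasurePreserving (fun ω : Config => Λ.restrict ω) C.gibbs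
      (Measure.pi fun _ : Λ => C.siteLaw) :=
    ⟨Finset.measurable_restrict _, Measure.infinitePi_map_restrict _⟩
  have h2 := e.integrable_comp_of_integrable h1
  refine Integrable.mono' (h2.const_mul K) hh.1.aestronglyMeasurable (ae_of_all _ fun ω => ?_)
  simp only [Function.comp_apply, Finset.restrict_def, Real.norm_eq_abs]
  rw [Finset.prod_coe_sort Λ fun i => C.weight k 2 (ω i)]
  exact hb ω

lemma Tame.memLp (hV : C.StiffnessL2) {h : Config → ℝ} (hh : C.Tame 1 h) :
    MemLp h 2 C.gibbs := by
  rw [memLp_two_iff_integrable_sq hh.1.aestronglyMeasurable]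
  simpa [sq] using (hh.mul hh).integrable hV

lemma Tame.mem_localSubmodule (hV : C.StiffnessL2) {h : Config → ℝ} (hh : C.Tame 1 h) :
    h ∈ C.localSubmodule := by
  obtain ⟨K, k, Λ, -, hd, -⟩ := hh.exists_bound
  exact ⟨hh.1, hh.memLp hV, Λ, hd⟩

/-! ### Integration by parts -/

variable (C) in
-- Resampling one coordinate from its own law leaves the Gibbs measure invariant. This gives Fubini
-- in a single coordinate without splitting the infinite product.
lemma measurePreserving_update (x : ℤ) :
    MeasurePreserving (fun q : Config × (ℝ × ℝ) => Function.update q.1 x q.2)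
      (C.gibbs.prod C.siteLaw) C.gibbs := by
  have hm : Measurable (fun q : Config × (ℝ × ℝ) => Function.update q.1 x q.2) := by
    refine measurable_pi_lambda _ fun z => ?_
    by_cases h : z = x
    · subst h
      simpa using measurable_snd
    · simpa [h, Function.comp_def] using (measurable_pi_apply z).comp measurable_fst
  refine ⟨hm, Measure.eq_infinitePi _ fun s t ht => ?_⟩
  rw [Measure.map_apply hm (MeasurableSet.pi s.countable_toSet fun i _ => ht i)]
  by_cases hx : x ∈ s
  · have : (fun q : Config × (ℝ × ℝ) => Function.update q.1 x q.2) ⁻¹' (Set.pi (s : Set ℤ) t) =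
        (Set.pi ((s.erase x : Finset ℤ) : Set ℤ) t) ×ˢ t x := by
      ext q
      simp only [Set.mem_preimage, Set.mem_pi, Finset.mem_coe, Set.mem_prod, Finset.mem_erase]
      constructor
      · intro h
        refine ⟨fun i hi => ?_, by simpa using h x hx⟩
        simpa [hi.1] using h i hi.2
      · rintro ⟨h1, h2⟩ i hi
        by_cases hix : i = x
        · subst hix
          simpa using h2
        · simpa [hix] using h1 i ⟨hix, hi⟩
    rw [this, Measure.prod_prod, gibbs, Measure.infinitePi_pi _ fun i _ => ht i,
      Finset.prod_erase_mul _ _ hx]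
  · have : (fun q : Config × (ℝ × ℝ) => Function.update q.1 x q.2) ⁻¹' (Set.pi (s : Set ℤ) t) =
        (Set.pi (s : Set ℤ) t) ×ˢ Set.univ := by
      ext q
      simp only [Set.mem_preimage, Set.mem_pi, Finset.mem_coe, Set.mem_prod, Set.mem_univ,
        and_true]
      refine forall₂_congr fun i hi => ?_
      rw [Function.update_of_ne (by rintro rfl; exact hx hi)]
    rw [this, Measure.prod_prod, gibbs, Measure.infinitePi_pi _ fun i _ => ht i, measure_univ,
      mul_one]

/-- The integrand times the Gaussian density is the derivative of `ψ` times the density. Both are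
integrable, so there is no boundary term. -/
lemma integral_gaussian_deriv_sub {ψ ψ' : ℝ → ℝ} {v : ℝ≥0} (hv : v ≠ 0)
    (hd : ∀ s, HasDerivAt ψ (ψ' s) s) (h1 : Integrable ψ (gaussianReal 0 v))
    (h2 : Integrable (fun s => ψ' s - s / v * ψ s) (gaussianReal 0 v)) :
    ∫ s, (ψ' s - s / v * ψ s) ∂(gaussianReal 0 v) = 0 := by
  have hi (f : ℝ → ℝ) (hf : Integrable f (gaussianReal 0 v)) :
      Integrable (fun s => gaussianPDFReal 0 v s * f s) := by
    rw [gaussianReal_of_var_ne_zero _ hv, integrable_withDensity_iff_integrable_smul'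
      (measurable_gaussianPDF _ _) (ae_of_all _ fun _ => ENNReal.ofReal_lt_top)] at hf
    refine hf.congr (ae_of_all _ fun s => ?_)
    simp [gaussianPDF, gaussianPDFReal_nonneg]
  rw [integral_gaussianReal_eq_integral_smul hv]
  have hv' : (v : ℝ) ≠ 0 := by exact_mod_cast hv
  refine integral_eq_zero_of_hasDerivAt_of_integrable (f := fun s => gaussianPDFReal 0 v s * ψ s)
    (fun s => ?_) (hi _ h2) (hi _ h1)
  have h3 : HasDerivAt (gaussianPDFReal 0 v) (gaussianPDFReal 0 v s * -(s / v)) s := by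
    unfold gaussianPDFReal
    have h4 : HasDerivAt (fun s : ℝ => -(s - 0) ^ 2 / (2 * (v : ℝ))) (-(s / v)) s := by
      have := (((hasDerivAt_id s).sub_const 0).pow 2).neg.div_const (2 * (v : ℝ))
      refine this.congr_deriv ?_
      simp
      field_simp
    exact (h4.exp.const_mul _).congr_deriv (by ring)
  exact (h3.mul (hd s)).congr_deriv (by simp; ring)

lemma integral_lengthLaw_deriv_sub {ψ ψ' : ℝ → ℝ}
    (hd : ∀ s, HasDerivAt ψ (ψ' s) s) (h1 : Integrable ψ C.lengthLaw)
    (h2 : Integrable (fun s => ψ' s - deriv C.V s / C.T * ψ s) C.lengthLaw) :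
    ∫ s, (ψ' s - deriv C.V s / C.T * ψ s) ∂C.lengthLaw = 0 := by
  have hi (f : ℝ → ℝ) (hf : Integrable f C.lengthLaw) :
      Integrable (fun s => Real.exp (-C.V s / C.T) * f s) := by
    rw [lengthLaw, integrable_tilted_iff C.integrable_exp] at hf
    simpa using hf
  have hT := C.T_pos.ne'
  rw [lengthLaw, integral_tilted]
  have h0 : ∫ s, Real.exp (-C.V s / C.T) * (ψ' s - deriv C.V s / C.T * ψ s) = 0 := by
    refine integral_eq_zero_of_hasDerivAt_of_integrable
      (f := fun s => Real.exp (-C.V s / C.T) * ψ s) (fun s => ?_) (hi _ h2) (hi _ h1)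
    have h3 := ((hasDerivAt_potential (C := C) s).fun_neg.div_const C.T).exp
    exact (h3.mul (hd s)).congr_deriv (by ring)
  simp only [smul_eq_mul, div_mul_eq_mul_div]
  rw [integral_div]
  simp only [div_mul_eq_mul_div] at h0
  rw [h0, zero_div]

/-- After resampling the site `x`, Fubini reduces the claim to the one-dimensional Gaussian identity
for almost every value of the other coordinates. -/
lemma integral_derivP_sub {h : Config → ℝ} {x : ℤ}
    (hd : ∀ ω : Config, DifferentiableAt ℝ (fun s : ℝ => h (Function.update ω x ((ω x).1, s)))
      (ω x).2) (h1 : Integrable h C.gibbs)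
    (h2 : Integrable (fun ω => derivP x h ω - (ω x).2 / C.T * h ω) C.gibbs) :
    ∫ ω, (derivP x h ω - (ω x).2 / C.T * h ω) ∂C.gibbs = 0 := by
  have e := C.measurePreserving_update x
  have i1 := e.integrable_comp_of_integrable h1
  have i2 := e.integrable_comp_of_integrable h2
  rw [← e.map_eq, integral_map e.measurable.aemeasurable
    (by rw [e.map_eq]; exact h2.aestronglyMeasurable)]
  refine (integral_prod _ i2).trans ?_
  refine integral_eq_zero_of_ae ?_
  filter_upwards [i1.prod_right_ae, i2.prod_right_ae] with ω j1 j2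
  rw [siteLaw] at j1 j2 ⊢
  rw [Pi.zero_apply, integral_prod _ j2]
  refine integral_eq_zero_of_ae ?_
  filter_upwards [j1.prod_right_ae, j2.prod_right_ae] with r k1 k2
  have hT : ((C.T.toNNReal : ℝ≥0) : ℝ) = C.T := Real.coe_toNNReal _ C.T_pos.le
  have := integral_gaussian_deriv_sub (v := C.T.toNNReal)
    (ψ := fun s => h (Function.update ω x (r, s)))
    (ψ' := fun s => derivP x h (Function.update ω x (r, s)))
    (by simpa using C.T_pos) (fun s => ?_) k1 (by simpa [hT] using k2)
  · simpa [hT] using this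
  · simpa [derivP] using (hd (Function.update ω x (r, s))).hasDerivAt

lemma integral_derivR_sub {h : Config → ℝ} {x : ℤ}
    (hd : ∀ ω : Config, DifferentiableAt ℝ (fun s : ℝ => h (Function.update ω x (s, (ω x).2)))
      (ω x).1) (h1 : Integrable h C.gibbs)
    (h2 : Integrable (fun ω => derivR x h ω - deriv C.V (ω x).1 / C.T * h ω) C.gibbs) :
    ∫ ω, (derivR x h ω - deriv C.V (ω x).1 / C.T * h ω) ∂C.gibbs = 0 := by
  have e := C.measurePreserving_update x
  have i1 := e.integrable_comp_of_integrable h1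
  have i2 := e.integrable_comp_of_integrable h2
  rw [← e.map_eq, integral_map e.measurable.aemeasurable
    (by rw [e.map_eq]; exact h2.aestronglyMeasurable)]
  refine (integral_prod _ i2).trans ?_
  refine integral_eq_zero_of_ae ?_
  filter_upwards [i1.prod_right_ae, i2.prod_right_ae] with ω j1 j2
  rw [siteLaw] at j1 j2 ⊢
  -- The order of integration is exchanged so that the inner integral runs over the distance.
  rw [Pi.zero_apply, integral_prod_symm _ j2]
  refine integral_eq_zero_of_ae ?_
  filter_upwards [j1.prod_left_ae, j2.prod_left_ae] with p k1 k2
  have := integral_lengthLaw_deriv_sub (C := C)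
    (ψ := fun s => h (Function.update ω x (s, p)))
    (ψ' := fun s => derivR x h (Function.update ω x (s, p)))
    (fun s => ?_) k1 (by simpa using k2)
  · simpa using this
  · simpa [derivR] using (hd (Function.update ω x (s, p))).hasDerivAt

end Chain

end OscillatorChain

namespace OscillatorChain

/-! ### Partial derivatives and symmetries -/

/-- The reflection of the momenta at the sites of `A`. -/
def reflect (A : Set ℤ) (ω : Config) : Config :=
  open scoped Classical in fun z => if z ∈ A then ((ω z).1, -(ω z).2) else ω z

lemma reflect_reflect (A : Set ℤ) (ω : Config) : reflect A (reflect A ω) = ω := by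
  ext z : 1
  by_cases h : z ∈ A <;> simp [reflect, h]

lemma flip_eq_reflect (x : ℤ) : flip x = reflect {x} := by
  ext ω z : 2
  by_cases h : z = x
  · subst h; simp [flip, reflect]
  · simp [flip, reflect, h]

lemma reflect_insert {x : ℤ} {A : Set ℤ} (hx : x ∉ A) (ω : Config) :
    reflect (insert x A) ω = reflect A (reflect {x} ω) := by
  ext z : 1
  by_cases h : z = x
  · subst h; simp [reflect, hx]
  · have e : z ∈ insert x A ↔ z ∈ A := by simp [h]
    by_cases hz : z ∈ A
    · simp [reflect, h, hz, e.2 hz]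
    · simp [reflect, h, hz, mt e.1 hz]

/-- The time reversal `p ↦ -p`. -/
abbrev reverse : Config → Config := reflect Set.univ

lemma reverse_apply (ω : Config) (z : ℤ) : reverse ω z = ((ω z).1, -(ω z).2) := by
  simp [reflect]

lemma measurable_reflect (A : Set ℤ) : Measurable (reflect A) := by
  classical
  refine measurable_pi_lambda _ fun z => ?_
  by_cases h : z ∈ A
  · simp only [reflect, h, if_true]
    fun_prop
  · simp only [reflect, h, if_false]
    fun_prop

lemma shift_update (y x : ℤ) (v : ℝ × ℝ) (ω : Config) :
    shift y (Function.update ω x v) = Function.update (shift y ω) (x - y) v := by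
  ext z : 1
  by_cases h : z = x - y
  · subst h; simp [shift]
  · have : y + z ≠ x := fun e => h (by omega)
    simp [shift, h, this]

lemma shift_shift (x y : ℤ) (ω : Config) : shift x (shift y ω) = shift (y + x) ω := by
  ext z : 1
  simp [shift, add_assoc]

lemma shift_zero (ω : Config) : shift 0 ω = ω := by
  ext z : 1
  simp [shift]

lemma shift_flip (y x : ℤ) (ω : Config) : shift y (flip x ω) = flip (x - y) (shift y ω) := by
  rw [flip, shift_update, flip]
  simp [shift]

lemma shift_reverse (y : ℤ) (ω : Config) : shift y (reverse ω) = reverse (shift y ω) := by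
  ext z : 1
  simp [shift, reflect]

lemma flip_reverse (x : ℤ) (ω : Config) : flip x (reverse ω) = reverse (flip x ω) := by
  ext z : 1
  by_cases h : z = x
  · subst h; simp [flip, reflect]
  · simp [flip, reflect, h]

lemma reverse_update (x : ℤ) (r s : ℝ) (ω : Config) :
    reverse (Function.update ω x (r, s)) = Function.update (reverse ω) x (r, -s) := by
  ext z : 1
  by_cases h : z = x
  · subst h; simp [reflect]
  · simp [reflect, h]

lemma derivP_shift (y x : ℤ) (f : Config → ℝ) (ω : Config) :
    derivP x (fun η => f (shift y η)) ω = derivP (x - y) f (shift y ω) := by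
  simp [derivP, shift_update, shift]

lemma derivR_shift (y x : ℤ) (f : Config → ℝ) (ω : Config) :
    derivR x (fun η => f (shift y η)) ω = derivR (x - y) f (shift y ω) := by
  simp [derivR, shift_update, shift]

lemma derivP_reverse (x : ℤ) (f : Config → ℝ) (ω : Config) :
    derivP x (fun η => f (reverse η)) ω = -derivP x f (reverse ω) := by
  simp only [derivP, reverse_update, reverse_apply]
  exact deriv_comp_neg (fun s => f (Function.update (reverse ω) x ((ω x).1, s))) _

lemma derivR_reverse (x : ℤ) (f : Config → ℝ) (ω : Config) :
    derivR x (fun η => f (reverse η)) ω = derivR x f (reverse ω) := by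
  simp only [derivR, reverse_update, reverse_apply]

lemma rotation_shift (y z : ℤ) (f : Config → ℝ) :
    rotation z (fun η => f (shift y η)) = fun ω => rotation (z - y) f (shift y ω) := by
  ext ω
  simp only [rotation, derivP_shift, shift]
  rw [show y + (z - y + 1) = z + 1 by ring, show y + (z - y) = z by ring,
    show z + 1 - y = z - y + 1 by ring]

lemma rotation_reverse (z : ℤ) (f : Config → ℝ) :
    rotation z (fun η => f (reverse η)) = fun ω => rotation z f (reverse ω) := by
  ext ω
  simp only [rotation, derivP_reverse, reverse_apply]
  ring

lemma flipNoise_shift (y : ℤ) (f : Config → ℝ) (ω : Config) :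
    flipNoise (fun η => f (shift y η)) ω = flipNoise f (shift y ω) := by
  simp only [flipNoise, shift_flip]
  rw [← (Equiv.addRight y).tsum_eq]
  simp

lemma exchangeNoise_shift (y : ℤ) (f : Config → ℝ) (ω : Config) :
    exchangeNoise (fun η => f (shift y η)) ω = exchangeNoise f (shift y ω) := by
  simp only [exchangeNoise]
  rw [← (Equiv.addRight y).tsum_eq]
  congr 2
  ext z
  rw [rotation_shift, rotation_shift]
  simp

lemma flipNoise_reverse (f : Config → ℝ) (ω : Config) :
    flipNoise (fun η => f (reverse η)) ω = flipNoise f (reverse ω) := by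
  simp only [flipNoise, flip_reverse]

lemma exchangeNoise_reverse (f : Config → ℝ) (ω : Config) :
    exchangeNoise (fun η => f (reverse η)) ω = exchangeNoise f (reverse ω) := by
  simp only [exchangeNoise, rotation_reverse]

lemma derivP_eq_zero {f : Config → ℝ} {Λ : Set ℤ} (hf : DependsOn f Λ) {x : ℤ} (hx : x ∉ Λ)
    (ω : Config) : derivP x f ω = 0 := by
  have : (fun s : ℝ => f (Function.update ω x ((ω x).1, s))) = fun _ => f ω := by
    ext s
    exact hf fun i hi => Function.update_of_ne (by rintro rfl; exact hx hi) _ _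
  simp [derivP, this]

lemma derivR_eq_zero {f : Config → ℝ} {Λ : Set ℤ} (hf : DependsOn f Λ) {x : ℤ} (hx : x ∉ Λ)
    (ω : Config) : derivR x f ω = 0 := by
  have : (fun s : ℝ => f (Function.update ω x (s, (ω x).2))) = fun _ => f ω := by
    ext s
    exact hf fun i hi => Function.update_of_ne (by rintro rfl; exact hx hi) _ _
  simp [derivR, this]

lemma flip_eq_of_notMem {f : Config → ℝ} {Λ : Set ℤ} (hf : DependsOn f Λ) {x : ℤ} (hx : x ∉ Λ)
    (ω : Config) : f (flip x ω) = f ω :=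
  hf fun i hi => Function.update_of_ne (by rintro rfl; exact hx hi) _ _

lemma rotation_eq_zero {f : Config → ℝ} {Λ : Set ℤ} (hf : DependsOn f Λ) {x : ℤ} (hx : x ∉ Λ)
    (hx' : x + 1 ∉ Λ) (ω : Config) : rotation x f ω = 0 := by
  simp [rotation, derivP_eq_zero hf hx, derivP_eq_zero hf hx']

lemma rotation_zero (x : ℤ) (ω : Config) : rotation x (fun _ => 0) ω = 0 := by
  simp [rotation, derivP]

/-- The sites `-N, …, N`. -/
abbrev box (N : ℕ) : Finset ℤ := Finset.Icc (-(N : ℤ)) N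

lemma box_mono {M N : ℕ} (h : M ≤ N) : box M ⊆ box N := by
  intro i hi
  simp only [Finset.mem_Icc] at hi ⊢
  omega

lemma exists_subset_box (Λ : Finset ℤ) : ∃ N, Λ ⊆ box N := by
  refine ⟨∑ i ∈ Λ, i.natAbs, fun i hi => ?_⟩
  have := Finset.single_le_sum (f := fun i : ℤ => i.natAbs) (fun _ _ => Nat.zero_le _) hi
  rw [Finset.mem_Icc]
  omega

lemma sum_box_telescope (b : ℤ → ℝ) (N : ℕ) :
    ∑ x ∈ box N, (b (x + 1) - b x) = b (N + 1) - b (-N) := by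
  induction N with
  | zero => simp [box]
  | succ n ih =>
    have h : box (n + 1) = insert (-((n : ℤ) + 1)) (insert ((n : ℤ) + 1) (box n)) := by
      ext i
      simp only [Finset.mem_insert, Finset.mem_Icc]
      push_cast
      omega
    rw [h, Finset.sum_insert, Finset.sum_insert, ih]
    · push_cast
      rw [show -((n : ℤ) + 1) + 1 = -n by ring]
      ring
    · simp
    · simp only [Finset.mem_insert, Finset.mem_Icc, not_or]
      omega

lemma flipNoise_eq_sum {f : Config → ℝ} {N M : ℕ} (hf : DependsOn f (box N : Set ℤ))
    (hM : N ≤ M) (ω : Config) : flipNoise f ω = ∑ x ∈ box M, (f (flip x ω) - f ω) :=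
  tsum_eq_sum fun x hx => by
    rw [flip_eq_of_notMem hf fun h => hx (box_mono hM h), sub_self]

/-- The bond `x` joins `x` and `x + 1`, so the bond `-N - 1` still meets `box N`; this is why a box
larger by one is required. -/
lemma exchangeNoise_eq_sum {f : Config → ℝ} {N M : ℕ} (hf : DependsOn f (box N : Set ℤ))
    (hM : N + 1 ≤ M) (ω : Config) :
    exchangeNoise f ω = (1 / 2) * ∑ x ∈ box M, rotation x (rotation x f) ω := by
  unfold exchangeNoise
  rw [tsum_eq_sum]
  intro x hx
  have h0 : rotation x f = fun _ => 0 := by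
    ext η
    refine rotation_eq_zero hf ?_ ?_ η <;>
      (simp only [Finset.coe_Icc, Set.mem_Icc, Finset.mem_Icc] at hx ⊢; omega)
  rw [h0, rotation_zero]

namespace Chain

variable {C : Chain}

/-- The centered Gaussian law of each momentum is symmetric. -/
lemma measurePreserving_reflect (A : Set ℤ) : MeasurePreserving (reflect A) C.gibbs C.gibbs := by
  classical
  refine ⟨measurable_reflect A, ?_⟩
  have hg : (gaussianReal 0 C.T.toNNReal).map (fun p => -p) = gaussianReal 0 C.T.toNNReal := by
    simpa using gaussianReal_map_neg (μ := 0) (v := C.T.toNNReal)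
  have hs : MeasurePreserving (fun z : ℝ × ℝ => (z.1, -z.2)) C.siteLaw C.siteLaw :=
    (MeasurePreserving.id C.lengthLaw).prod ⟨measurable_neg, hg⟩
  have h := Measure.infinitePi_map_pi (μ := fun _ : ℤ => C.siteLaw)
    (f := fun z v => if z ∈ A then (v.1, -v.2) else v) fun z => by
      by_cases h : z ∈ A
      · simpa [h] using hs.measurable
      · simpa [h] using measurable_id'
  have e : (fun (ω : Config) i => if i ∈ A then ((ω i).1, -(ω i).2) else ω i) = reflect A := by
    ext ω i : 2
    by_cases h : i ∈ A <;> simp [reflect, h]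
  rw [gibbs, ← e]
  refine h.trans ?_
  congr 1
  ext i : 1
  by_cases hi : i ∈ A
  · simpa [hi] using hs.map_eq
  · simp [hi]

lemma integral_reflect (A : Set ℤ) {f : Config → ℝ} (hf : Measurable f) :
    ∫ ω, f (reflect A ω) ∂C.gibbs = ∫ ω, f ω ∂C.gibbs := by
  have h := C.measurePreserving_reflect A
  conv_rhs => rw [← h.map_eq]
  rw [integral_map h.measurable.aemeasurable hf.aestronglyMeasurable]

lemma liouville_shift (y : ℤ) (f : Config → ℝ) (ω : Config) :
    C.liouville (fun η => f (shift y η)) ω = C.liouville f (shift y ω) := by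
  simp only [liouville, derivP_shift, derivR_shift]
  rw [← (Equiv.addRight y).tsum_eq]
  congr 1
  ext z
  simp only [Equiv.coe_addRight, shift, add_sub_cancel_right]
  rw [add_comm z y, add_sub_assoc, add_assoc]

/-- In the first term the velocities change sign, in the second the derivative does: the Hamiltonian
part is odd under time reversal, whereas both noises are even. -/
lemma liouville_reverse (f : Config → ℝ) (ω : Config) :
    C.liouville (fun η => f (reverse η)) ω = -C.liouville f (reverse ω) := by
  simp only [liouville, derivP_reverse, derivR_reverse, reverse_apply]
  rw [← tsum_neg]
  congr 1
  ext z
  ring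

lemma formalGenerator_shift (γ : ℝ) (y : ℤ) (f : Config → ℝ) (ω : Config) :
    C.formalGenerator γ (fun η => f (shift y η)) ω = C.formalGenerator γ f (shift y ω) := by
  simp only [formalGenerator, liouville_shift, flipNoise_shift, exchangeNoise_shift]

lemma liouville_eq_sum {f : Config → ℝ} {N M : ℕ} (hf : DependsOn f (box N : Set ℤ))
    (hM : N ≤ M) (ω : Config) :
    C.liouville f ω = ∑ x ∈ box M, (((ω x).2 - (ω (x - 1)).2) * derivR x f ω
      + (deriv C.V (ω (x + 1)).1 - deriv C.V (ω x).1) * derivP x f ω) :=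
  tsum_eq_sum fun x hx => by
    have hx' : x ∉ (box N : Set ℤ) := fun h => hx (box_mono hM h)
    rw [derivP_eq_zero hf hx', derivR_eq_zero hf hx']
    simp

namespace Tame

variable {a : ℕ} {h : Config → ℝ}

lemma exists_dependsOn_box (hh : C.Tame a h) : ∃ N, DependsOn h (box N : Set ℤ) := by
  obtain ⟨-, K, k, Λ, hd, -⟩ := hh
  obtain ⟨N, hN⟩ := exists_subset_box Λ
  exact ⟨N, dependsOn_mono hd hN⟩

lemma shift (hh : C.Tame a h) (y : ℤ) : C.Tame a (fun ω => h (shift y ω)) := by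
  obtain ⟨hm, K, k, Λ, hd, hb⟩ := hh
  refine ⟨hm.comp (measurable_shift y), K, k, Λ.map (addLeftEmbedding y), fun ω η hωη => ?_,
    fun ω => ?_⟩
  · exact hd fun i hi => hωη (y + i) (by simpa using hi)
  · rw [Finset.prod_map]
    exact hb _

lemma reflect (hh : C.Tame a h) (A : Set ℤ) : C.Tame a (fun ω => h (reflect A ω)) := by
  obtain ⟨hm, K, k, Λ, hd, hb⟩ := hh
  refine ⟨hm.comp (measurable_reflect A), K, k, Λ, fun ω η hωη => ?_, fun ω => ?_⟩
  · refine hd fun i hi => ?_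
    simp [OscillatorChain.reflect, hωη i hi]
  · refine (hb _).trans (le_of_eq ?_)
    congr 1
    refine Finset.prod_congr rfl fun i _ => ?_
    by_cases h : i ∈ A <;> simp [OscillatorChain.reflect, h, weight]

lemma flip (hh : C.Tame a h) (x : ℤ) : C.Tame a (fun ω => h (flip x ω)) := by
  rw [flip_eq_reflect]
  exact hh.reflect _

end Tame

end Chain

/-- Differentiability in the momentum at `x`. -/
def DiffP (x : ℤ) (h : Config → ℝ) : Prop :=
  ∀ ω : Config, DifferentiableAt ℝ (fun s : ℝ => h (Function.update ω x ((ω x).1, s))) (ω x).2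

/-- Differentiability in the distance at `x`. -/
def DiffR (x : ℤ) (h : Config → ℝ) : Prop :=
  ∀ ω : Config, DifferentiableAt ℝ (fun s : ℝ => h (Function.update ω x (s, (ω x).2))) (ω x).1

/-! ### Sum and product rules for the partial derivatives. -/

section Diff

variable {x : ℤ} {h k : Config → ℝ}

lemma DiffP.mul (hh : DiffP x h) (hk : DiffP x k) : DiffP x (fun ω => h ω * k ω) :=
  fun ω => (hh ω).fun_mul (hk ω)

lemma DiffR.mul (hh : DiffR x h) (hk : DiffR x k) : DiffR x (fun ω => h ω * k ω) :=
  fun ω => (hh ω).fun_mul (hk ω)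

lemma DiffP.add (hh : DiffP x h) (hk : DiffP x k) : DiffP x (fun ω => h ω + k ω) :=
  fun ω => (hh ω).fun_add (hk ω)

lemma DiffR.add (hh : DiffR x h) (hk : DiffR x k) : DiffR x (fun ω => h ω + k ω) :=
  fun ω => (hh ω).fun_add (hk ω)

lemma derivP_mul (hh : DiffP x h) (hk : DiffP x k) (ω : Config) :
    derivP x (fun ω => h ω * k ω) ω = derivP x h ω * k ω + h ω * derivP x k ω := by
  have := ((hh ω).hasDerivAt.fun_mul (hk ω).hasDerivAt).deriv
  simpa [derivP] using this

lemma derivR_mul (hh : DiffR x h) (hk : DiffR x k) (ω : Config) :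
    derivR x (fun ω => h ω * k ω) ω = derivR x h ω * k ω + h ω * derivR x k ω := by
  have := ((hh ω).hasDerivAt.fun_mul (hk ω).hasDerivAt).deriv
  simpa [derivR] using this

lemma derivP_add (hh : DiffP x h) (hk : DiffP x k) (ω : Config) :
    derivP x (fun ω => h ω + k ω) ω = derivP x h ω + derivP x k ω :=
  ((hh ω).hasDerivAt.fun_add (hk ω).hasDerivAt).deriv

lemma derivR_add (hh : DiffR x h) (hk : DiffR x k) (ω : Config) :
    derivR x (fun ω => h ω + k ω) ω = derivR x h ω + derivR x k ω :=
  ((hh ω).hasDerivAt.fun_add (hk ω).hasDerivAt).deriv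

lemma DiffP.shift (hh : ∀ x, DiffP x h) (y x : ℤ) : DiffP x (fun ω => h (shift y ω)) := by
  intro ω
  have := hh (x - y) (OscillatorChain.shift y ω)
  simpa [shift_update, OscillatorChain.shift] using this

lemma DiffR.shift (hh : ∀ x, DiffR x h) (y x : ℤ) : DiffR x (fun ω => h (shift y ω)) := by
  intro ω
  have := hh (x - y) (OscillatorChain.shift y ω)
  simpa [shift_update, OscillatorChain.shift] using this

lemma DiffP.reverse (hh : DiffP x h) : DiffP x (fun ω => h (reverse ω)) := by
  intro ω
  have := hh (OscillatorChain.reverse ω)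
  simp only [reverse_apply] at this
  simp only [reverse_update]
  exact DifferentiableAt.comp (f := fun s : ℝ => -s) (ω x).2 this differentiableAt_id.neg

lemma DiffR.reverse (hh : DiffR x h) : DiffR x (fun ω => h (reverse ω)) := by
  intro ω
  have := hh (OscillatorChain.reverse ω)
  simpa only [reverse_update, reverse_apply] using this

lemma rotation_mul (hh : ∀ x, DiffP x h) (hk : ∀ x, DiffP x k) (z : ℤ) (ω : Config) :
    rotation z (fun ω => h ω * k ω) ω = h ω * rotation z k ω + k ω * rotation z h ω := by
  simp only [rotation, derivP_mul (hh _) (hk _)]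
  ring

end Diff

namespace Chain

variable {C : Chain}

lemma liouville_mul {h k : Config → ℝ} {N : ℕ} (hN : DependsOn h (box N : Set ℤ))
    (kN : DependsOn k (box N : Set ℤ)) (hh : ∀ x, DiffP x h) (hk : ∀ x, DiffP x k)
    (hh' : ∀ x, DiffR x h) (hk' : ∀ x, DiffR x k) (ω : Config) :
    C.liouville (fun ω => h ω * k ω) ω = h ω * C.liouville k ω + k ω * C.liouville h ω := by
  have hkN : DependsOn (fun ω => h ω * k ω) (box N : Set ℤ) :=
    fun _ _ e => congrArg₂ (· * ·) (hN e) (kN e)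
  rw [liouville_eq_sum hN le_rfl, liouville_eq_sum kN le_rfl, liouville_eq_sum hkN le_rfl,
    Finset.mul_sum, Finset.mul_sum, ← Finset.sum_add_distrib]
  refine Finset.sum_congr rfl fun x _ => ?_
  rw [derivP_mul (hh _) (hk _), derivR_mul (hh' _) (hk' _)]
  ring

variable (C) in
/-- Functions of controlled growth whose derivatives in the momenta have the same growth. -/
structure RegP (a : ℕ) (h : Config → ℝ) : Prop where
  tame : C.Tame a h
  diff : ∀ x, DiffP x h
  tame_deriv : ∀ x, C.Tame a (derivP x h)

variable (C) in
/-- Functions of controlled growth whose derivatives in the distances have the same growth. -/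
structure RegR (a : ℕ) (h : Config → ℝ) : Prop where
  tame : C.Tame a h
  diff : ∀ x, DiffR x h
  tame_deriv : ∀ x, C.Tame a (derivR x h)

/-! ### Functions whose first derivatives have controlled growth. -/

section Reg

variable {a b : ℕ} {h k : Config → ℝ}

lemma RegP.mono (hh : C.RegP a h) (hab : a ≤ b) : C.RegP b h :=
  ⟨hh.tame.mono hab, hh.diff, fun x => (hh.tame_deriv x).mono hab⟩

lemma RegR.mono (hh : C.RegR a h) (hab : a ≤ b) : C.RegR b h :=
  ⟨hh.tame.mono hab, hh.diff, fun x => (hh.tame_deriv x).mono hab⟩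

lemma RegP.mul (hh : C.RegP a h) (hk : C.RegP b k) : C.RegP (a + b) (fun ω => h ω * k ω) := by
  refine ⟨hh.tame.mul hk.tame, fun x => (hh.diff x).mul (hk.diff x), fun x => ?_⟩
  rw [funext (derivP_mul (hh.diff x) (hk.diff x))]
  exact ((hh.tame_deriv x).mul hk.tame).add (hh.tame.mul (hk.tame_deriv x))

lemma RegR.mul (hh : C.RegR a h) (hk : C.RegR b k) : C.RegR (a + b) (fun ω => h ω * k ω) := by
  refine ⟨hh.tame.mul hk.tame, fun x => (hh.diff x).mul (hk.diff x), fun x => ?_⟩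
  rw [funext (derivR_mul (hh.diff x) (hk.diff x))]
  exact ((hh.tame_deriv x).mul hk.tame).add (hh.tame.mul (hk.tame_deriv x))

lemma RegP.add (hh : C.RegP a h) (hk : C.RegP a k) : C.RegP a (fun ω => h ω + k ω) := by
  refine ⟨hh.tame.add hk.tame, fun x => (hh.diff x).add (hk.diff x), fun x => ?_⟩
  rw [funext (derivP_add (hh.diff x) (hk.diff x))]
  exact (hh.tame_deriv x).add (hk.tame_deriv x)

lemma RegR.add (hh : C.RegR a h) (hk : C.RegR a k) : C.RegR a (fun ω => h ω + k ω) := by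
  refine ⟨hh.tame.add hk.tame, fun x => (hh.diff x).add (hk.diff x), fun x => ?_⟩
  rw [funext (derivR_add (hh.diff x) (hk.diff x))]
  exact (hh.tame_deriv x).add (hk.tame_deriv x)

/-- Functions which do not depend on the momenta. -/
lemma RegP.of_forall_update (hh : C.Tame a h)
    (hu : ∀ x s ω, h (Function.update ω x ((ω x).1, s)) = h ω) : C.RegP a h := by
  refine ⟨hh, fun x ω => ?_, fun x => ?_⟩
  · simp only [hu]
    fun_prop
  · have : derivP x h = fun _ => 0 := by
      ext ω
      simp [derivP, hu]
    rw [this]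
    exact Tame.const 0

/-- Functions which do not depend on the distances. -/
lemma RegR.of_forall_update (hh : C.Tame a h)
    (hu : ∀ x s ω, h (Function.update ω x (s, (ω x).2)) = h ω) : C.RegR a h := by
  refine ⟨hh, fun x ω => ?_, fun x => ?_⟩
  · simp only [hu]
    fun_prop
  · have : derivR x h = fun _ => 0 := by
      ext ω
      simp [derivR, hu]
    rw [this]
    exact Tame.const 0

lemma RegP.const (c : ℝ) : C.RegP a (fun _ => c) :=
  .of_forall_update (Tame.const c) fun _ _ _ => rfl

lemma RegR.const (c : ℝ) : C.RegR a (fun _ => c) :=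
  .of_forall_update (Tame.const c) fun _ _ _ => rfl

lemma RegP.const_mul (hh : C.RegP a h) (c : ℝ) : C.RegP a (fun ω => c * h ω) := by
  simpa using (RegP.const (C := C) (a := 0) c).mul hh

lemma RegR.const_mul (hh : C.RegR a h) (c : ℝ) : C.RegR a (fun ω => c * h ω) := by
  simpa using (RegR.const (C := C) (a := 0) c).mul hh

lemma RegP.neg (hh : C.RegP a h) : C.RegP a (fun ω => -h ω) := by
  simpa using hh.const_mul (-1)

lemma RegR.neg (hh : C.RegR a h) : C.RegR a (fun ω => -h ω) := by
  simpa using hh.const_mul (-1)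

lemma RegP.sub (hh : C.RegP a h) (hk : C.RegP a k) : C.RegP a (fun ω => h ω - k ω) := by
  simpa [sub_eq_add_neg] using hh.add hk.neg

lemma update_fst_of_momentum (x y : ℤ) (s : ℝ) (ω : Config) :
    (Function.update ω x ((ω x).1, s) y).1 = (ω y).1 := by
  by_cases h : y = x
  · subst h; simp
  · simp [h]

lemma update_snd_of_length (x y : ℤ) (s : ℝ) (ω : Config) :
    (Function.update ω x (s, (ω x).2) y).2 = (ω y).2 := by
  by_cases h : y = x
  · subst h; simp
  · simp [h]

lemma derivP_momentum (x y : ℤ) (ω : Config) :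
    derivP x (fun ω => (ω y).2) ω = if x = y then 1 else 0 := by
  by_cases h : y = x
  · subst h; simp [derivP]
  · simp [derivP, h, Ne.symm h]

lemma RegP.momentum (y : ℤ) : C.RegP a (fun ω => (ω y).2) := by
  refine ⟨Tame.momentum y, fun x ω => ?_, fun x => ?_⟩
  · by_cases h : y = x
    · subst h; simp
    · simp [h]
  · rw [funext (derivP_momentum x y)]
    exact Tame.const _

lemma RegR.momentum (y : ℤ) : C.RegR a (fun ω => (ω y).2) :=
  .of_forall_update (Tame.momentum y) fun x s ω => update_snd_of_length x y s ω

lemma RegP.force (y : ℤ) : C.RegP 1 (fun ω => deriv C.V (ω y).1) :=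
  .of_forall_update (Tame.force y) fun x s ω => by rw [update_fst_of_momentum]

lemma RegP.deriv_force (y : ℤ) : C.RegP 1 (fun ω => deriv (deriv C.V) (ω y).1) :=
  .of_forall_update (Tame.deriv_force y) fun x s ω => by rw [update_fst_of_momentum]

lemma derivR_force (x y : ℤ) (ω : Config) :
    derivR x (fun ω => deriv C.V (ω y).1) ω =
      if x = y then deriv (deriv C.V) (ω y).1 else 0 := by
  by_cases h : y = x
  · subst h; simp [derivR]
  · simp [derivR, h, Ne.symm h]

lemma RegR.force (y : ℤ) : C.RegR 1 (fun ω => deriv C.V (ω y).1) := by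
  refine ⟨Tame.force y, fun x ω => ?_, fun x => ?_⟩
  · by_cases h : y = x
    · subst h
      simpa using (hasDerivAt_force _).differentiableAt
    · simp [h]
  · rw [funext (derivR_force x y)]
    split_ifs
    · exact Tame.deriv_force y
    · exact Tame.const _

lemma RegP.shift (hh : C.RegP a h) (y : ℤ) : C.RegP a (fun ω => h (shift y ω)) := by
  refine ⟨hh.tame.shift y, DiffP.shift hh.diff y, fun x => ?_⟩
  rw [funext (derivP_shift y x h)]
  exact (hh.tame_deriv _).shift y

lemma RegR.shift (hh : C.RegR a h) (y : ℤ) : C.RegR a (fun ω => h (shift y ω)) := by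
  refine ⟨hh.tame.shift y, DiffR.shift hh.diff y, fun x => ?_⟩
  rw [funext (derivR_shift y x h)]
  exact (hh.tame_deriv _).shift y

lemma RegP.reverse (hh : C.RegP a h) : C.RegP a (fun ω => h (reverse ω)) := by
  refine ⟨hh.tame.reflect _, fun x => (hh.diff x).reverse, fun x => ?_⟩
  rw [funext (derivP_reverse x h)]
  exact ((hh.tame_deriv _).reflect _).neg

lemma RegR.reverse (hh : C.RegR a h) : C.RegR a (fun ω => h (reverse ω)) := by
  refine ⟨hh.tame.reflect _, fun x => (hh.diff x).reverse, fun x => ?_⟩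
  rw [funext (derivR_reverse x h)]
  exact (hh.tame_deriv _).reflect _

lemma RegP.tame_rotation (hh : C.RegP a h) (z : ℤ) : C.Tame a (rotation z h) := by
  have h1 := (Tame.momentum (C := C) (a := 0) (z + 1)).mul (hh.tame_deriv z)
  have h2 := (Tame.momentum (C := C) (a := 0) z).mul (hh.tame_deriv (z + 1))
  rw [zero_add] at h1 h2
  exact h1.sub h2

lemma tame_liouville (hh : C.RegP a h) (hh' : C.RegR a h) : C.Tame (a + 1) (C.liouville h) := by
  obtain ⟨N, hN⟩ := hh.tame.exists_dependsOn_box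
  rw [funext (liouville_eq_sum hN le_rfl)]
  refine Tame.sum _ fun x _ => Tame.add ?_ ?_
  · exact (((Tame.momentum (a := 1) x).sub (Tame.momentum (x - 1))).mul
      (hh'.tame_deriv x)).mono (by omega)
  · exact (((Tame.force (x + 1)).sub (Tame.force x)).mul (hh.tame_deriv x)).mono (by omega)

lemma tame_flipNoise (hh : C.Tame a h) : C.Tame a (flipNoise h) := by
  obtain ⟨N, hN⟩ := hh.exists_dependsOn_box
  rw [funext (flipNoise_eq_sum hN le_rfl)]
  exact Tame.sum _ fun x _ => (hh.flip x).sub hh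

/-! ### Integration by parts for functions of controlled growth -/

lemma integral_momentum_mul (hV : C.StiffnessL2) (hh : C.RegP 2 h) (x : ℤ) :
    ∫ ω, (ω x).2 * h ω ∂C.gibbs = C.T * ∫ ω, derivP x h ω ∂C.gibbs := by
  have i1 := (hh.tame_deriv x).integrable hV
  have h2 : C.Tame 2 (fun ω => (ω x).2 * h ω) := by
    simpa using (Tame.momentum (C := C) (a := 0) x).mul hh.tame
  have i2 := (h2.const_mul C.T⁻¹).integrable hV
  have e : (fun ω => derivP x h ω - (ω x).2 / C.T * h ω) =
      fun ω => derivP x h ω - C.T⁻¹ * ((ω x).2 * h ω) := by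
    ext ω
    ring
  have := integral_derivP_sub (C := C) (hh.diff x) (hh.tame.integrable hV)
    (by rw [e]; exact i1.sub i2)
  rw [e, integral_sub i1 i2, integral_const_mul] at this
  have hT := C.T_pos.ne'
  field_simp at this
  linarith

lemma integral_force_mul (hV : C.StiffnessL2) (hh : C.RegR 1 h) (x : ℤ) :
    ∫ ω, deriv C.V (ω x).1 * h ω ∂C.gibbs = C.T * ∫ ω, derivR x h ω ∂C.gibbs := by
  have i1 := ((hh.tame_deriv x).mono (by omega : 1 ≤ 2)).integrable hV
  have h2 : C.Tame 2 (fun ω => deriv C.V (ω x).1 * h ω) := (Tame.force (C := C) x).mul hh.tame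
  have i2 := (h2.const_mul C.T⁻¹).integrable hV
  have e : (fun ω => derivR x h ω - deriv C.V (ω x).1 / C.T * h ω) =
      fun ω => derivR x h ω - C.T⁻¹ * (deriv C.V (ω x).1 * h ω) := by
    ext ω
    ring
  have := integral_derivR_sub (C := C) (hh.diff x)
    ((hh.tame.mono (by omega : 1 ≤ 2)).integrable hV) (by rw [e]; exact i1.sub i2)
  rw [e, integral_sub i1 i2, integral_const_mul] at this
  have hT := C.T_pos.ne'
  field_simp at this
  linarith

lemma integral_momentum_mul_eq_zero (hV : C.StiffnessL2) (hh : C.RegP 2 h) {x : ℤ}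
    (hx : ∀ ω, derivP x h ω = 0) : ∫ ω, (ω x).2 * h ω ∂C.gibbs = 0 := by
  rw [integral_momentum_mul hV hh]
  simp [hx]

/-- Integrating by parts in `p_z` or in `p_{z+1}`, both terms become `T⁻¹ ∫ p_z p_{z+1} h`: the
Gaussian law is rotation invariant. -/
lemma integral_rotation (hV : C.StiffnessL2) (hh : C.RegP 2 h) (z : ℤ) :
    ∫ ω, rotation z h ω ∂C.gibbs = 0 := by
  have hp (u : ℤ) : C.RegP 2 (fun ω => (ω u).2 * h ω) := by
    simpa using (RegP.momentum (C := C) (a := 0) u).mul hh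
  have ht (u w : ℤ) : C.Tame 2 (fun ω => (ω u).2 * derivP w h ω) := by
    simpa using (Tame.momentum (C := C) (a := 0) u).mul (hh.tame_deriv w)
  have h1 := integral_momentum_mul hV (hp (z + 1)) z
  have h2 := integral_momentum_mul hV (hp z) (z + 1)
  simp only [derivP_mul ((RegP.momentum (C := C) (a := 0) _).diff _) (hh.diff _),
    derivP_momentum] at h1 h2
  simp only [show ¬ z = z + 1 by omega, show ¬ z + 1 = z by omega, if_false, zero_mul,
    zero_add] at h1 h2
  have e : (fun ω : Config => (ω z).2 * ((ω (z + 1)).2 * h ω)) =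
      fun ω => (ω (z + 1)).2 * ((ω z).2 * h ω) := by
    ext ω
    ring
  rw [e, h2] at h1
  have h3 := mul_left_cancel₀ C.T_pos.ne' h1
  unfold rotation
  rw [integral_sub ((ht _ _).integrable hV) ((ht _ _).integrable hV), h3, sub_self]

/-- A derivation with zero mean is antisymmetric. -/
lemma integral_mul_rotation (hV : C.StiffnessL2) (hh : C.RegP a h) (hk : C.RegP b k)
    (hab : a + b ≤ 2) (z : ℤ) :
    ∫ ω, h ω * rotation z k ω ∂C.gibbs = -∫ ω, rotation z h ω * k ω ∂C.gibbs := by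
  have h1 := integral_rotation hV ((hh.mul hk).mono hab) z
  simp only [rotation_mul hh.diff hk.diff] at h1
  rw [integral_add (((hh.tame.mul (hk.tame_rotation z)).mono hab).integrable hV)
    (((hk.tame.mul (hh.tame_rotation z)).mono (by omega)).integrable hV)] at h1
  simp only [mul_comm (rotation z h _)]
  linarith

/-- Integration by parts replaces each derivative by a force or a momentum. The products `p_x
V'(r_x)` cancel within the site `x`, and what remains is the telescoping difference of `b(x) = ∫
p_{x-1} V'(r_x) h`, which vanishes far away because the momentum is centered. -/
lemma integral_liouville (hV : C.StiffnessL2) (hh : C.RegP 1 h) (hh' : C.RegR 1 h) :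
    ∫ ω, C.liouville h ω ∂C.gibbs = 0 := by
  obtain ⟨N, hN⟩ := hh.tame.exists_dependsOn_box
  have hp (u : ℤ) : C.RegR 1 (fun ω => (ω u).2 * h ω) := by
    simpa using (RegR.momentum (C := C) (a := 0) u).mul hh'
  have hf (u : ℤ) : C.RegP 2 (fun ω => deriv C.V (ω u).1 * h ω) :=
    (RegP.force (C := C) u).mul hh
  have tp (u w : ℤ) : C.Tame 2 (fun ω => (ω u).2 * derivR w h ω) := by
    simpa using (Tame.momentum (C := C) (a := 1) u).mul (hh'.tame_deriv w)
  have tf (u w : ℤ) : C.Tame 2 (fun ω => deriv C.V (ω u).1 * derivP w h ω) :=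
    (Tame.force (C := C) u).mul (hh.tame_deriv w)
  have e1 (u w : ℤ) : C.T * ∫ ω, (ω u).2 * derivR w h ω ∂C.gibbs =
      ∫ ω, deriv C.V (ω w).1 * ((ω u).2 * h ω) ∂C.gibbs := by
    rw [integral_force_mul hV (hp u) w]
    congr 1
    refine integral_congr_ae (ae_of_all _ fun ω => ?_)
    have : derivR w (fun ω : Config => (ω u).2) ω = 0 := by
      simp [derivR, update_snd_of_length]
    simp only
    rw [derivR_mul ((RegR.momentum (C := C) (a := 0) u).diff w) (hh'.diff w), this]
    ring
  have e0 (u w : ℤ) (ω : Config) : derivP w (fun ω => deriv C.V (ω u).1 * h ω) ω =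
      deriv C.V (ω u).1 * derivP w h ω := by
    have : derivP w (fun ω : Config => deriv C.V (ω u).1) ω = 0 := by
      simp [derivP, update_fst_of_momentum]
    rw [derivP_mul ((RegP.force (C := C) u).diff w) (hh.diff w), this]
    ring
  have e2 (u w : ℤ) : C.T * ∫ ω, deriv C.V (ω u).1 * derivP w h ω ∂C.gibbs =
      ∫ ω, (ω w).2 * (deriv C.V (ω u).1 * h ω) ∂C.gibbs := by
    rw [integral_momentum_mul hV (hf u) w]
    simp only [e0]
  set b : ℤ → ℝ := fun x => ∫ ω, (ω (x - 1)).2 * (deriv C.V (ω x).1 * h ω) ∂C.gibbs with hb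
  have hterm (x : ℤ) : C.T * ∫ ω, (((ω x).2 - (ω (x - 1)).2) * derivR x h ω
      + (deriv C.V (ω (x + 1)).1 - deriv C.V (ω x).1) * derivP x h ω) ∂C.gibbs =
      b (x + 1) - b x := by
    simp only [sub_mul]
    rw [integral_add (((tp _ _).sub (tp _ _)).integrable hV)
        (((tf _ _).sub (tf _ _)).integrable hV),
      integral_sub ((tp _ _).integrable hV) ((tp _ _).integrable hV),
      integral_sub ((tf _ _).integrable hV) ((tf _ _).integrable hV), mul_add, mul_sub, mul_sub,
      e1, e1, e2, e2, hb]
    simp only [add_sub_cancel_right]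
    simp only [mul_left_comm (deriv C.V _) (Prod.snd _) (h _)]
    ring
  have hzero (x : ℤ) (hx : x - 1 ∉ (box N : Set ℤ)) : b x = 0 := by
    refine integral_momentum_mul_eq_zero hV (hf x) fun ω => ?_
    rw [e0, derivP_eq_zero hN hx, mul_zero]
  have hs : C.T * ∫ ω, C.liouville h ω ∂C.gibbs = 0 := by
    -- The box is enlarged by one so that the momenta in both boundary terms, at `N + 1` and `-N -
    -- 2`, lie outside the support of `h`.
    simp only [liouville_eq_sum hN (Nat.le_succ N)]
    rw [integral_finsetSum, Finset.mul_sum]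
    · simp only [hterm]
      rw [sum_box_telescope, hzero, hzero, sub_zero]
      · simp only [Finset.coe_Icc, Set.mem_Icc]
        push_cast
        omega
      · simp only [Finset.coe_Icc, Set.mem_Icc]
        push_cast
        omega
    · intro x _
      simp only [sub_mul]
      exact (((tp _ _).sub (tp _ _)).add ((tf _ _).sub (tf _ _))).integrable hV
  exact (mul_eq_zero.1 hs).resolve_left C.T_pos.ne'

/-- As `𝔄` is a derivation with zero mean, it is antisymmetric. Its force coefficients cost one
power of the budget, hence `a + b ≤ 1`. -/
lemma integral_mul_liouville (hV : C.StiffnessL2) (hh : C.RegP a h) (hk : C.RegP b k)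
    (hh' : C.RegR a h) (hk' : C.RegR b k) (hab : a + b ≤ 1) :
    ∫ ω, h ω * C.liouville k ω ∂C.gibbs = -∫ ω, C.liouville h ω * k ω ∂C.gibbs := by
  have h1 := integral_liouville hV ((hh.mul hk).mono hab) ((hh'.mul hk').mono hab)
  obtain ⟨N, hN⟩ := hh.tame.exists_dependsOn_box
  obtain ⟨M, hM⟩ := hk.tame.exists_dependsOn_box
  simp only [liouville_mul (dependsOn_mono hN (box_mono (le_max_left N M)))
    (dependsOn_mono hM (box_mono (le_max_right N M))) hh.diff hk.diff hh'.diff hk'.diff] at h1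
  rw [integral_add (((hh.tame.mul (tame_liouville hk hk')).mono (by omega)).integrable hV)
    (((hk.tame.mul (tame_liouville hh hh')).mono (by omega)).integrable hV)] at h1
  simp only [mul_comm (C.liouville h _)]
  linarith

end Reg

end Chain

end OscillatorChain

namespace OscillatorChain

/-! ### The core of the generator -/

/-- Local functions of class `C^n` with compact support. -/
def IsLocalCc (n : ℕ) (f : Config → ℝ) : Prop :=
  ∃ (Λ : Finset ℤ) (φ : (Λ → ℝ × ℝ) → ℝ),
    ContDiff ℝ n φ ∧ HasCompactSupport φ ∧ f = fun ω => φ (fun x => ω x)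

section IsLocalCc

variable {n : ℕ} {f : Config → ℝ}

/-- The direction of a partial derivative at the site `x`. -/
def siteDirection (Λ : Finset ℤ) (x : ℤ) (e : ℝ × ℝ) : Λ → ℝ × ℝ :=
  fun i => if (i : ℤ) = x then e else 0

lemma hasDerivAt_update_comp {Λ : Finset ℤ} {φ : (Λ → ℝ × ℝ) → ℝ} (hφ : ContDiff ℝ 1 φ)
    (ω : Config) (x : ℤ) {c : ℝ → ℝ × ℝ} {e : ℝ × ℝ} {s : ℝ} (hc : HasDerivAt c e s)
    (hs : c s = ω x) :
    HasDerivAt (fun t => φ (fun i : Λ => Function.update ω x (c t) i))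
      (fderiv ℝ φ (fun i : Λ => ω i) (siteDirection Λ x e)) s := by
  have h1 : HasDerivAt (fun t => (fun i : Λ => Function.update ω x (c t) i))
      (siteDirection Λ x e) s := by
    rw [hasDerivAt_pi]
    intro i
    by_cases h : (i : ℤ) = x
    · have : (fun t => Function.update ω x (c t) i) = c := by
        ext t : 1
        rw [h, Function.update_self]
      simpa [siteDirection, h, this] using hc
    · have : (fun t => Function.update ω x (c t) i) = fun _ => ω i := by
        ext t : 1
        rw [Function.update_of_ne h]
      simpa [siteDirection, h, this] using hasDerivAt_const s (ω i)
  have h2 : (fun i : Λ => Function.update ω x (c s) i) = fun i : Λ => ω i := by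
    rw [hs, Function.update_eq_self]
  have h3 := (hφ.differentiable (by norm_num)) (fun i : Λ => ω i)
  rw [← h2] at h3 ⊢
  exact h3.hasFDerivAt.comp_hasDerivAt s h1

lemma IsLocalCc.hasDerivAt {Λ : Finset ℤ} {φ : (Λ → ℝ × ℝ) → ℝ} (hφ : ContDiff ℝ (n + 1 : ℕ) φ)
    (hs : HasCompactSupport φ) (x : ℤ) (e : ℝ × ℝ) :
    IsLocalCc n (fun ω => fderiv ℝ φ (fun i : Λ => ω i) (siteDirection Λ x e)) := by
  refine ⟨Λ, fun v => fderiv ℝ φ v (siteDirection Λ x e), ?_, ?_, rfl⟩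
  · have : ContDiff ℝ (n : ℕ) (fderiv ℝ φ) := hφ.fderiv_right (by norm_cast)
    exact this.clm_apply contDiff_const
  · exact hs.fderiv_apply ℝ _

lemma IsLocalCc.derivP (hf : IsLocalCc (n + 1) f) (x : ℤ) :
    DiffP x f ∧ IsLocalCc n (derivP x f) := by
  obtain ⟨Λ, φ, hφ, hs, rfl⟩ := hf
  have h1 : ContDiff ℝ 1 φ := hφ.of_le (by norm_cast; omega)
  have hd (ω : Config) := hasDerivAt_update_comp h1 ω x
    ((hasDerivAt_const (ω x).2 (ω x).1).prodMk (hasDerivAt_id (ω x).2)) rfl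
  refine ⟨fun ω => (hd ω).differentiableAt, ?_⟩
  convert IsLocalCc.hasDerivAt hφ hs x (0, 1) using 1
  ext ω
  exact (hd ω).deriv

lemma IsLocalCc.derivR (hf : IsLocalCc (n + 1) f) (x : ℤ) :
    DiffR x f ∧ IsLocalCc n (derivR x f) := by
  obtain ⟨Λ, φ, hφ, hs, rfl⟩ := hf
  have h1 : ContDiff ℝ 1 φ := hφ.of_le (by norm_cast; omega)
  have hd (ω : Config) := hasDerivAt_update_comp h1 ω x
    ((hasDerivAt_id (ω x).1).prodMk (hasDerivAt_const (ω x).1 (ω x).2)) rfl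
  refine ⟨fun ω => (hd ω).differentiableAt, ?_⟩
  convert IsLocalCc.hasDerivAt hφ hs x (1, 0) using 1
  ext ω
  exact (hd ω).deriv

end IsLocalCc

namespace Chain

variable {C : Chain}

lemma tame_of_isLocalCc {n : ℕ} {f : Config → ℝ} (hf : IsLocalCc n f) : C.Tame 0 f := by
  obtain ⟨Λ, φ, hφ, hs, rfl⟩ := hf
  obtain ⟨K, hK⟩ := hφ.continuous.bounded_above_of_compact_support hs
  refine Tame.of_bounded (Λ := Λ) (K := K) ?_ ?_ fun ω => hK _
  · exact hφ.continuous.measurable.comp (measurable_pi_lambda _ fun i => measurable_pi_apply _)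
  · intro ω η h
    exact congrArg φ (funext fun i => h i i.2)

variable (C) in
/-- The functions on which the operators are computed: bounded growth of all the derivatives which
occur in the generator. -/
structure Core (f : Config → ℝ) : Prop where
  regP : C.RegP 0 f
  regR : C.RegR 0 f
  regP_deriv : ∀ x, C.RegP 0 (derivP x f)

lemma core_of_isTestFunction {f : Config → ℝ} (hf : IsTestFunction f) : C.Core f := by
  have h2 : IsLocalCc 2 f := hf
  refine ⟨⟨tame_of_isLocalCc h2, fun x => (h2.derivP x).1, fun x =>
    tame_of_isLocalCc (h2.derivP x).2⟩, ⟨tame_of_isLocalCc h2, fun x => (h2.derivR x).1, fun x =>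
    tame_of_isLocalCc (h2.derivR x).2⟩, fun y => ?_⟩
  have h1 : IsLocalCc 1 (derivP y f) := (h2.derivP y).2
  exact ⟨tame_of_isLocalCc h1, fun x => (h1.derivP x).1, fun x =>
    tame_of_isLocalCc (h1.derivP x).2⟩

namespace Core

variable {f g : Config → ℝ}

lemma shift (hf : C.Core f) (y : ℤ) : C.Core (fun ω => f (shift y ω)) := by
  refine ⟨hf.regP.shift y, hf.regR.shift y, fun x => ?_⟩
  rw [funext (derivP_shift y x f)]
  exact (hf.regP_deriv _).shift y

lemma reverse (hf : C.Core f) : C.Core (fun ω => f (reverse ω)) := by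
  refine ⟨hf.regP.reverse, hf.regR.reverse, fun x => ?_⟩
  rw [funext (derivP_reverse x f)]
  exact (hf.regP_deriv _).reverse.neg

lemma add (hf : C.Core f) (hg : C.Core g) : C.Core (fun ω => f ω + g ω) := by
  refine ⟨hf.regP.add hg.regP, hf.regR.add hg.regR, fun x => ?_⟩
  rw [funext (derivP_add (hf.regP.diff x) (hg.regP.diff x))]
  exact (hf.regP_deriv x).add (hg.regP_deriv x)

lemma const (c : ℝ) : C.Core (fun _ => c) := by
  refine ⟨.const c, .const c, fun x => ?_⟩
  have : derivP x (fun _ => c) = fun _ => 0 := by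
    ext ω
    simp [derivP]
  rw [this]
  exact .const 0

lemma const_mul (hf : C.Core f) (c : ℝ) : C.Core (fun ω => c * f ω) := by
  refine ⟨hf.regP.const_mul c, hf.regR.const_mul c, fun x => ?_⟩
  have : derivP x (fun ω => c * f ω) = fun ω => c * derivP x f ω := by
    ext ω
    exact deriv_const_mul c (hf.regP.diff x ω)
  rw [this]
  exact (hf.regP_deriv x).const_mul c

lemma regP_rotation (hf : C.Core f) (z : ℤ) : C.RegP 0 (rotation z f) := by
  have h1 := (RegP.momentum (C := C) (a := 0) (z + 1)).mul (hf.regP_deriv z)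
  have h2 := (RegP.momentum (C := C) (a := 0) z).mul (hf.regP_deriv (z + 1))
  rw [zero_add] at h1 h2
  exact h1.sub h2

lemma tame_exchangeNoise (hf : C.Core f) : C.Tame 0 (exchangeNoise f) := by
  obtain ⟨N, hN⟩ := hf.regP.tame.exists_dependsOn_box
  rw [funext (exchangeNoise_eq_sum hN le_rfl)]
  exact (Tame.sum _ fun x _ => (hf.regP_rotation x).tame_rotation x).const_mul _

lemma tame_formalGenerator (hf : C.Core f) (γ : ℝ) : C.Tame 1 (C.formalGenerator γ f) :=
  (tame_liouville hf.regP hf.regR).add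
    (((((tame_flipNoise hf.regP.tame).add hf.tame_exchangeNoise)).const_mul γ).mono zero_le_one)

end Core

lemma rotation_add {f g : Config → ℝ} (hf : ∀ x, DiffP x f) (hg : ∀ x, DiffP x g) (z : ℤ) :
    rotation z (fun ω => f ω + g ω) = fun ω => rotation z f ω + rotation z g ω := by
  ext ω
  simp only [rotation, derivP_add (hf _) (hg _)]
  ring

lemma exists_box_two {a b : ℕ} {f g : Config → ℝ} (hf : C.Tame a f) (hg : C.Tame b g) :
    ∃ N, DependsOn f (box N : Set ℤ) ∧ DependsOn g (box N : Set ℤ) := by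
  obtain ⟨N, hN⟩ := hf.exists_dependsOn_box
  obtain ⟨M, hM⟩ := hg.exists_dependsOn_box
  exact ⟨max N M, dependsOn_mono hN (box_mono (le_max_left _ _)),
    dependsOn_mono hM (box_mono (le_max_right _ _))⟩

lemma formalGenerator_add (γ : ℝ) {f g : Config → ℝ} (hf : C.Core f) (hg : C.Core g)
    (ω : Config) : C.formalGenerator γ (fun ω => f ω + g ω) ω =
      C.formalGenerator γ f ω + C.formalGenerator γ g ω := by
  obtain ⟨N, hN, hN'⟩ := exists_box_two hf.regP.tame hg.regP.tame
  have hs : DependsOn (fun ω => f ω + g ω) (box N : Set ℤ) :=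
    fun _ _ e => congrArg₂ (· + ·) (hN e) (hN' e)
  simp only [formalGenerator, liouville_eq_sum hN le_rfl, liouville_eq_sum hN' le_rfl,
    liouville_eq_sum hs le_rfl, flipNoise_eq_sum hN le_rfl, flipNoise_eq_sum hN' le_rfl,
    flipNoise_eq_sum hs le_rfl, exchangeNoise_eq_sum hN le_rfl, exchangeNoise_eq_sum hN' le_rfl,
    exchangeNoise_eq_sum hs le_rfl, rotation_add hf.regP.diff hg.regP.diff,
    rotation_add (hf.regP_rotation _).diff (hg.regP_rotation _).diff,
    derivP_add (hf.regP.diff _) (hg.regP.diff _), derivR_add (hf.regR.diff _) (hg.regR.diff _),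
    add_sub_add_comm, mul_add, Finset.sum_add_distrib]
  ring

lemma formalGenerator_const_mul (γ c : ℝ) {f : Config → ℝ} (hf : C.Core f) (ω : Config) :
    C.formalGenerator γ (fun ω => c * f ω) ω = c * C.formalGenerator γ f ω := by
  have hP {h : Config → ℝ} (hh : C.RegP 0 h) (x : ℤ) (ω : Config) :
      derivP x (fun ω => c * h ω) ω = c * derivP x h ω := deriv_const_mul c (hh.diff x ω)
  have hR (x : ℤ) (ω : Config) : derivR x (fun ω => c * f ω) ω = c * derivR x f ω :=
    deriv_const_mul c (hf.regR.diff x ω)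
  have hrot {h : Config → ℝ} (hh : C.RegP 0 h) (z : ℤ) :
      rotation z (fun ω => c * h ω) = fun ω => c * rotation z h ω := by
    ext ω
    simp only [rotation, hP hh]
    ring
  simp only [formalGenerator, liouville, flipNoise, exchangeNoise, hP hf.regP, hR,
    hrot hf.regP, hrot (hf.regP_rotation _), ← mul_sub, tsum_mul_left, mul_left_comm _ c,
    ← mul_add]

/-! ### The Dirichlet form -/

section Dirichlet

variable {a b : ℕ} {h k : Config → ℝ}

/-- The increment of `f` under the flip of the momentum at `x`. -/
def flipDiff (x : ℤ) (f : Config → ℝ) (ω : Config) : ℝ := f ω - f (flip x ω)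

lemma flipDiff_shift (y x : ℤ) (f : Config → ℝ) :
    flipDiff x (fun η => f (shift y η)) = fun ω => flipDiff (x - y) f (shift y ω) := by
  ext ω
  simp only [flipDiff, shift_flip]

lemma flipDiff_eq_zero {f : Config → ℝ} {Λ : Set ℤ} (hf : DependsOn f Λ) {x : ℤ} (hx : x ∉ Λ)
    (ω : Config) : flipDiff x f ω = 0 := by
  rw [flipDiff, flip_eq_of_notMem hf hx, sub_self]

lemma Tame.flipDiff (hh : C.Tame a h) (x : ℤ) : C.Tame a (flipDiff x h) := hh.sub (hh.flip x)

lemma Tame.integrable_mul (hV : C.StiffnessL2) (hh : C.Tame a h) (hk : C.Tame b k)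
    (hab : a + b ≤ 2) : Integrable (fun ω => h ω * k ω) C.gibbs :=
  ((hh.mul hk).mono hab).integrable hV

/-- A reflection `R_A` is a symmetric involution of `L²(μ)`, so `(1 - R_A)² = 2 (1 - R_A)`. -/
lemma integral_mul_sub_reflect (hV : C.StiffnessL2) (hh : C.Tame a h) (hk : C.Tame b k)
    (hab : a + b ≤ 2) (A : Set ℤ) :
    ∫ ω, h ω * (k ω - k (reflect A ω)) ∂C.gibbs =
      (1 / 2) * ∫ ω, (h ω - h (reflect A ω)) * (k ω - k (reflect A ω)) ∂C.gibbs := by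
  have hK := hk.sub (hk.reflect A)
  have e : ∫ ω, h (reflect A ω) * (k ω - k (reflect A ω)) ∂C.gibbs =
      -∫ ω, h ω * (k ω - k (reflect A ω)) ∂C.gibbs := by
    rw [← integral_reflect A ((hh.reflect A).mul hK).1, ← integral_neg]
    simp only [reflect_reflect]
    congr 1
    ext ω
    ring
  simp only [sub_mul (h _)]
  rw [integral_sub (hh.integrable_mul hV hK hab) ((hh.reflect A).integrable_mul hV hK hab), e]
  ring

lemma integral_mul_flipDiff (hV : C.StiffnessL2) (hh : C.Tame a h) (hk : C.Tame b k)
    (hab : a + b ≤ 2) (x : ℤ) :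
    ∫ ω, h ω * flipDiff x k ω ∂C.gibbs =
      (1 / 2) * ∫ ω, flipDiff x h ω * flipDiff x k ω ∂C.gibbs := by
  simp only [flipDiff, flip_eq_reflect]
  exact integral_mul_sub_reflect hV hh hk hab _

lemma integral_mul_flipNoise (hV : C.StiffnessL2) (hh : C.Tame a h) (hk : C.Tame b k)
    (hab : a + b ≤ 2) {N M : ℕ} (hN : DependsOn k (box N : Set ℤ)) (hM : N ≤ M) :
    ∫ ω, h ω * flipNoise k ω ∂C.gibbs =
      -((1 / 2) * ∑ x ∈ box M, ∫ ω, flipDiff x h ω * flipDiff x k ω ∂C.gibbs) := by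
  have e (ω : Config) : h ω * flipNoise k ω = ∑ x ∈ box M, -(h ω * flipDiff x k ω) := by
    rw [flipNoise_eq_sum hN hM, Finset.mul_sum]
    refine Finset.sum_congr rfl fun x _ => ?_
    rw [flipDiff]
    ring
  simp only [e]
  rw [integral_finsetSum _ fun x _ => ((hh.mul (hk.flipDiff x)).neg.mono hab).integrable hV,
    Finset.mul_sum, ← Finset.sum_neg_distrib]
  refine Finset.sum_congr rfl fun x _ => ?_
  rw [integral_neg, integral_mul_flipDiff hV hh hk hab]

lemma integral_mul_exchangeNoise (hV : C.StiffnessL2) (hh : C.RegP a h) (hk : C.Core k)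
    (ha : a ≤ 2) {N M : ℕ} (hN : DependsOn k (box N : Set ℤ)) (hM : N + 1 ≤ M) :
    ∫ ω, h ω * exchangeNoise k ω ∂C.gibbs =
      -((1 / 2) * ∑ x ∈ box M, ∫ ω, rotation x h ω * rotation x k ω ∂C.gibbs) := by
  have e (ω : Config) : h ω * exchangeNoise k ω =
      (1 / 2) * ∑ x ∈ box M, h ω * rotation x (rotation x k) ω := by
    rw [exchangeNoise_eq_sum hN hM, Finset.mul_sum, Finset.mul_sum, Finset.mul_sum]
    refine Finset.sum_congr rfl fun x _ => ?_
    ring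
  simp only [e]
  rw [integral_const_mul, integral_finsetSum _ fun x _ =>
    hh.tame.integrable_mul hV ((hk.regP_rotation x).tame_rotation x) (by omega), ← mul_neg,
    ← Finset.sum_neg_distrib]
  congr 1
  refine Finset.sum_congr rfl fun x _ => ?_
  rw [integral_mul_rotation hV hh (hk.regP_rotation x) (by omega)]

variable (C) in
/-- The Dirichlet form of the noise, restricted to the sites of `box M`. -/
def dirichlet (M : ℕ) (h k : Config → ℝ) : ℝ :=
  (1 / 2) * ∑ x ∈ box M, ∫ ω, flipDiff x h ω * flipDiff x k ω ∂C.gibbs +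
    (1 / 2) * ∑ x ∈ box M, ∫ ω, rotation x h ω * rotation x k ω ∂C.gibbs

lemma dirichlet_comm (M : ℕ) (h k : Config → ℝ) : C.dirichlet M h k = C.dirichlet M k h := by
  unfold dirichlet
  simp only [mul_comm (flipDiff _ h _), mul_comm (rotation _ h _)]

lemma integral_mul_noise (hV : C.StiffnessL2) (hh : C.RegP a h) (hk : C.Core k)
    (ha : a ≤ 2) {N M : ℕ} (hN : DependsOn k (box N : Set ℤ)) (hM : N + 1 ≤ M) :
    ∫ ω, h ω * (flipNoise k ω + exchangeNoise k ω) ∂C.gibbs = -C.dirichlet M h k := by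
  simp only [mul_add]
  rw [integral_add (hh.tame.integrable_mul hV (tame_flipNoise hk.regP.tame) (by omega))
    (hh.tame.integrable_mul hV hk.tame_exchangeNoise (by omega)),
    integral_mul_flipNoise hV hh.tame hk.regP.tame (by omega) hN (by omega : N ≤ M),
    integral_mul_exchangeNoise hV hh hk ha hN hM, dirichlet]
  ring

/-- The Liouville part is moved to `h` by antisymmetry, and the noise becomes the Dirichlet form.
The case `a = 1` is the one needed for the trial function. -/
lemma integral_mul_formalGenerator (hV : C.StiffnessL2) (hh : C.RegP a h) (hh' : C.RegR a h)
    (hk : C.Core k) (ha : a ≤ 1) (γ : ℝ) {N M : ℕ} (hN : DependsOn k (box N : Set ℤ))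
    (hM : N + 1 ≤ M) :
    ∫ ω, h ω * C.formalGenerator γ k ω ∂C.gibbs =
      -(∫ ω, C.liouville h ω * k ω ∂C.gibbs) - γ * C.dirichlet M h k := by
  have e (ω : Config) : h ω * C.formalGenerator γ k ω = h ω * C.liouville k ω +
      γ * (h ω * (flipNoise k ω + exchangeNoise k ω)) := by
    rw [formalGenerator]
    ring
  simp only [e]
  rw [integral_add (hh.tame.integrable_mul hV (tame_liouville hk.regP hk.regR) (by omega))
    ((hh.tame.integrable_mul hV ((tame_flipNoise hk.regP.tame).add hk.tame_exchangeNoise)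
      (by omega)).const_mul γ), integral_const_mul, integral_mul_noise hV hh hk (by omega) hN hM,
    integral_mul_liouville hV hh hk.regP hh' hk.regR (by omega)]
  ring

/-- Invariance of the Gibbs measure, from testing against `1`. It removes the products of means from
`≪·, 𝔏' k≫`. -/
lemma integral_formalGenerator (hV : C.StiffnessL2) (hk : C.Core k) (γ : ℝ) :
    ∫ ω, C.formalGenerator γ k ω ∂C.gibbs = 0 := by
  obtain ⟨N, hN⟩ := hk.regP.tame.exists_dependsOn_box
  have h := integral_mul_formalGenerator hV (RegP.const (C := C) (a := 0) 1)
    (RegR.const (C := C) (a := 0) 1) hk zero_le_one γ hN le_rfl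
  simpa [liouville, dirichlet, flipDiff, rotation, derivP, derivR] using h

/-- Time reversal symmetry of the generator. -/
lemma integral_reverse_mul_formalGenerator (hV : C.StiffnessL2) (hh : C.Core h)
    (hk : C.Core k) (γ : ℝ) :
    ∫ ω, h (reverse ω) * C.formalGenerator γ k ω ∂C.gibbs =
      ∫ ω, C.formalGenerator γ h ω * k (reverse ω) ∂C.gibbs := by
  obtain ⟨N, hN, hN'⟩ := exists_box_two hh.reverse.regP.tame hk.regP.tame
  have h1 := integral_mul_formalGenerator hV hh.reverse.regP hh.reverse.regR hk zero_le_one γ hN'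
    le_rfl
  have h2 := integral_mul_noise hV hk.regP hh.reverse (by omega) hN le_rfl
  have t1 := tame_liouville hh.regP hh.regR
  have t2 := (tame_flipNoise hh.regP.tame).add hh.tame_exchangeNoise
  -- The right side is reflected as well. Then the two signs in the Liouville terms agree, and both
  -- noise terms are the same Dirichlet form over the same box, up to the order of its arguments.
  rw [h1, ← integral_reflect Set.univ
    ((hh.tame_formalGenerator γ).mul (hk.regP.tame.reflect Set.univ)).1]
  simp only [reflect_reflect, liouville_reverse]
  have e (ω : Config) : C.formalGenerator γ h (reverse ω) * k ω =
      C.liouville h (reverse ω) * k ω + γ * (k ω * (flipNoise (fun η => h (reverse η)) ω +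
        exchangeNoise (fun η => h (reverse η)) ω)) := by
    rw [formalGenerator, flipNoise_reverse, exchangeNoise_reverse]
    ring
  simp only [e]
  rw [integral_add ((t1.reflect _).integrable_mul hV hk.regP.tame (by omega)), integral_const_mul,
    h2, dirichlet_comm]
  · simp only [neg_mul, integral_neg]
    ring
  · simp only [flipNoise_reverse, exchangeNoise_reverse]
    exact (hk.regP.tame.integrable_mul hV (t2.reflect _) (by omega)).const_mul γ

/-! ### The spectral gap of the flips on odd functions -/

lemma reflect_comm {x : ℤ} {A : Set ℤ} (hx : x ∉ A) (ω : Config) :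
    reflect A (reflect {x} ω) = reflect {x} (reflect A ω) := by
  ext z : 1
  by_cases h : z = x
  · subst h; simp [reflect, hx]
  · simp [reflect, h]

/-- For commuting reflections, `1 - R_x R_A ≤ (1 - R_x) + (1 - R_A)`, because the difference is `(1
- R_x)(1 - R_A) ≥ 0`. Induction on the sites gives the gap with a constant independent of their
number. -/
lemma integral_mul_sub_reflect_le (hV : C.StiffnessL2) (hh : C.Tame 1 h) (A : Finset ℤ) :
    ∫ ω, h ω * (h ω - h (reflect A ω)) ∂C.gibbs ≤
      ∑ x ∈ A, ∫ ω, h ω * flipDiff x h ω ∂C.gibbs := by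
  induction A using Finset.induction_on with
  | empty =>
    have (ω : Config) : reflect (∅ : Set ℤ) ω = ω := by
      ext z : 1
      simp [reflect]
    simp [this]
  | insert x A hx ih =>
    have hx' : x ∉ (A : Set ℤ) := hx
    rw [Finset.sum_insert hx]
    set u : Config → ℝ := fun ω => h ω - h (reflect {x} ω) with hu
    set v : Config → ℝ := fun ω => h ω - h (reflect A ω) with hv
    have tu : C.Tame 1 u := hh.sub (hh.reflect _)
    have tv : C.Tame 1 v := hh.sub (hh.reflect _)
    have h1 := integral_mul_sub_reflect hV hh tv (by omega) {x}
    have h2 := integral_mul_sub_reflect hV tu tu (by omega) (A : Set ℤ)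
    -- Since the reflections commute, the quadratic form of `(1 - R_x)(1 - R_A)` at `h` is half that
    -- of `1 - R_A` at `u = (1 - R_x) h`, which is nonnegative.
    have e1 : (fun ω => (h ω - h (reflect {x} ω)) * (v ω - v (reflect {x} ω))) =
        fun ω => u ω * (u ω - u (reflect A ω)) := by
      ext ω
      simp only [hu, hv, reflect_comm hx']
      ring
    rw [e1, h2] at h1
    have h3 : 0 ≤ ∫ ω, (u ω - u (reflect A ω)) * (u ω - u (reflect A ω)) ∂C.gibbs :=
      integral_nonneg fun ω => mul_self_nonneg _
    have e2 (ω : Config) : h ω * (v ω - v (reflect {x} ω)) =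
        h ω * flipDiff x h ω + h ω * v ω - h ω * (h ω - h (reflect (insert x A : Set ℤ) ω)) := by
      rw [reflect_insert hx']
      simp only [hv, flipDiff, flip_eq_reflect]
      ring
    have i1 := hh.integrable_mul hV (hh.flipDiff x) (le_refl 2)
    have i2 := hh.integrable_mul hV tv (le_refl 2)
    have i12 : Integrable (fun ω => h ω * flipDiff x h ω + h ω * v ω) C.gibbs := i1.add i2
    simp only [e2] at h1
    rw [integral_sub i12 (hh.integrable_mul hV (hh.sub (hh.reflect _)) (le_refl 2)),
      integral_add i1 i2] at h1
    rw [Finset.coe_insert]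
    linarith

lemma integral_mul_flipNoise_le (hV : C.StiffnessL2) (hh : C.Tame 1 h) :
    ∫ ω, h ω * (h ω - h (reverse ω)) ∂C.gibbs ≤ -∫ ω, h ω * flipNoise h ω ∂C.gibbs := by
  obtain ⟨N, hN⟩ := hh.exists_dependsOn_box
  have h1 := integral_mul_sub_reflect_le hV hh (box N)
  -- For a function supported in the box, reflecting the box is the same as reversing all momenta.
  have e1 (ω : Config) : h (reflect (box N) ω) = h (reverse ω) :=
    hN fun i hi => by
      have : i ∈ (box N : Set ℤ) := hi
      simp only [reflect, this, Set.mem_univ]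
  have e2 (ω : Config) : h ω * flipNoise h ω = ∑ x ∈ box N, -(h ω * flipDiff x h ω) := by
    rw [flipNoise_eq_sum hN le_rfl, Finset.mul_sum]
    refine Finset.sum_congr rfl fun x _ => ?_
    rw [flipDiff]
    ring
  simp only [e1] at h1
  simp only [e2]
  rw [integral_finsetSum _ fun x _ => (hh.mul (hh.flipDiff x)).neg.integrable hV]
  simp only [integral_neg, Finset.sum_neg_distrib, neg_neg]
  exact h1

end Dirichlet

/-- Positivity of `≪f, g≫` from the positivity of the finite volume covariances. -/
lemma corr_nonneg_of_covariance_sum_nonneg {f g : Config → ℝ} (hf : f ∈ C.localSubmodule)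
    (hg : g ∈ C.localSubmodule)
    (hpos : ∀ n : ℕ, 0 ≤ cov[fun ω => ∑ x ∈ Finset.range n, f (shift (x : ℤ) ω),
      fun ω => ∑ x ∈ Finset.range n, g (shift (x : ℤ) ω); C.gibbs]) : 0 ≤ C.corr f g := by
  obtain ⟨M, hM⟩ := exists_covariance_eq_zero hf hg
  set c : ℤ → ℝ := fun x => cov[f, fun ω => g (shift x ω); C.gibbs] with hc
  have hS : C.corr f g = ∑ x ∈ box M, c x := corr_eq_sum hf hg hM
  set K : ℝ := ∑ x ∈ box M, |c x| with hK
  have hvar (n : ℕ) : 0 ≤ ∑ x ∈ Finset.range n, ∑ y ∈ Finset.range n, c ((y : ℤ) - x) := by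
    have h1 := covariance_fun_sum_fun_sum' (μ := C.gibbs) (s := Finset.range n)
      (t := Finset.range n) (X := fun (x : ℕ) ω => f (shift (x : ℤ) ω))
      (Y := fun (x : ℕ) ω => g (shift (x : ℤ) ω))
      (fun i _ => memLp_shift hf.2.1 i) (fun i _ => memLp_shift hg.2.1 i)
    simp only [covariance_shift hf.1 hg.1] at h1
    rw [← h1]
    exact hpos n
  have hrow (n x : ℕ) : ∑ y ∈ Finset.range n, c ((y : ℤ) - x) =
      ∑ z ∈ (box M).filter (fun z => -(x : ℤ) ≤ z ∧ z < n - x), c z := by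
    have h2 : ∑ y ∈ Finset.range n, c ((y : ℤ) - x) =
        ∑ z ∈ (Finset.range n).image (fun y : ℕ => (y : ℤ) - x), c z := by
      rw [Finset.sum_image]
      intro a _ b _ h
      simpa using h
    rw [h2]
    symm
    refine Finset.sum_subset ?_ ?_
    · intro z hz
      simp only [Finset.mem_filter, Finset.mem_Icc] at hz
      simp only [Finset.mem_image, Finset.mem_range]
      exact ⟨(z + x).toNat, by omega, by omega⟩
    · intro z hz hz'
      simp only [Finset.mem_image, Finset.mem_range] at hz
      obtain ⟨y, hy, rfl⟩ := hz
      refine hM _ ?_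
      simp only [Finset.mem_filter, Finset.mem_Icc, not_and_or, not_le, not_lt] at hz'
      rw [lt_abs]
      omega
  have hle (n x : ℕ) : ∑ y ∈ Finset.range n, c ((y : ℤ) - x) ≤ K := by
    rw [hrow]
    refine (Finset.sum_le_sum fun z _ => le_abs_self (c z)).trans ?_
    exact Finset.sum_le_sum_of_subset_of_nonneg (Finset.filter_subset _ _)
      fun z _ _ => abs_nonneg _
  have heq (n x : ℕ) (h1 : M ≤ x) (h2 : x + M < n) :
      ∑ y ∈ Finset.range n, c ((y : ℤ) - x) = C.corr f g := by
    rw [hrow, hS, Finset.filter_true_of_mem]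
    intro z hz
    simp only [Finset.mem_Icc] at hz
    omega
  -- Of `n + 2 M + 1` rows, `n` interior ones sum to `≪f, g≫` exactly, while the `M` first and `M +
  -- 1` last ones are at most `K` each. A negative `≪f, g≫` would lose for large `n`.
  have hbound (n : ℕ) : 0 ≤ (n : ℝ) * C.corr f g + (2 * M + 1) * K := by
    have h := hvar (M + n + (M + 1))
    rw [Finset.sum_range_add _ (M + n), Finset.sum_range_add _ M] at h
    have a1 : ∑ x ∈ Finset.range M,
        ∑ y ∈ Finset.range (M + n + (M + 1)), c ((y : ℤ) - x) ≤ M * K := by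
      refine (Finset.sum_le_sum fun x _ => hle _ x).trans ?_
      simp
    have a2 : ∑ x ∈ Finset.range n,
        ∑ y ∈ Finset.range (M + n + (M + 1)), c ((y : ℤ) - ((M + x : ℕ) : ℤ)) =
          n * C.corr f g := by
      rw [Finset.sum_congr rfl fun x hx => heq _ (M + x) (by omega) (by
        have := Finset.mem_range.1 hx
        omega)]
      simp
    have a3 : ∑ x ∈ Finset.range (M + 1),
        ∑ y ∈ Finset.range (M + n + (M + 1)), c ((y : ℤ) - ((M + n + x : ℕ) : ℤ)) ≤
          (M + 1) * K := by
      refine (Finset.sum_le_sum fun x _ => hle _ (M + n + x)).trans ?_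
      simp
    rw [a2] at h
    linarith
  by_contra hneg
  push Not at hneg
  obtain ⟨n, hn⟩ := exists_nat_gt ((2 * M + 1) * K / -C.corr f g)
  rw [div_lt_iff₀ (by linarith)] at hn
  linarith [hbound n]

end Chain

end OscillatorChain

namespace OscillatorChain

namespace Chain

variable {C : Chain}

/-! ### The semi-inner product on the core -/

lemma sum_box_neg (N : ℕ) (F : ℤ → ℝ) : ∑ x ∈ box N, F (-x) = ∑ x ∈ box N, F x := by
  refine Finset.sum_nbij' (fun x => -x) (fun x => -x) ?_ ?_ ?_ ?_ ?_
  all_goals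
    intro x hx
    simp only [Finset.mem_Icc, neg_neg] at hx ⊢
  all_goals omega

/-- When one mean vanishes the covariances are plain integrals. The formula holds for every large
box, so that several such sums can be taken over a common one. -/
lemma exists_corr_eq_sum {f g : Config → ℝ} (hf : f ∈ C.localSubmodule)
    (hg : g ∈ C.localSubmodule) (h0 : (∫ ω, f ω ∂C.gibbs) * ∫ ω, g ω ∂C.gibbs = 0) :
    ∃ K₀ : ℕ, ∀ K, K₀ ≤ K →
      C.corr f g = ∑ x ∈ box K, ∫ ω, f ω * g (shift x ω) ∂C.gibbs := by
  obtain ⟨K₀, hK₀⟩ := exists_covariance_eq_zero hf hg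
  refine ⟨K₀, fun K hK => ?_⟩
  rw [corr_eq_sum hf hg (M := K) fun x hx => hK₀ x (by omega)]
  refine Finset.sum_congr rfl fun x _ => ?_
  rw [covariance_eq_sub hf.2.1 (memLp_shift hg.2.1 x), integral_shift hg.1, h0, sub_zero]
  rfl

/-! ### Sums over all shifts as pairings in `L²(μ)`. -/

section Gather

variable {a b : ℕ} {u v : ℤ → Config → ℝ} {M : ℕ}

/-- `∑_y θ_{-y} u_y` over the sites of `box M`. -/
def gather (M : ℕ) (u : ℤ → Config → ℝ) (ω : Config) : ℝ := ∑ y ∈ box M, u y (shift (-y) ω)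

lemma tame_gather (hu : ∀ y, C.Tame a (u y)) : C.Tame a (gather M u) :=
  Tame.sum _ fun y _ => (hu y).shift (-y)

lemma sum_integral_shift_mul (hV : C.StiffnessL2) {h : Config → ℝ} (hh : C.Tame a h)
    (hu : ∀ y, C.Tame b (u y)) (hab : a + b ≤ 2) :
    ∑ y ∈ box M, ∫ ω, h (shift y ω) * u y ω ∂C.gibbs = ∫ ω, h ω * gather M u ω ∂C.gibbs := by
  simp only [gather, Finset.mul_sum]
  rw [integral_finsetSum _ fun y _ => hh.integrable_mul hV ((hu y).shift (-y)) hab]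
  refine Finset.sum_congr rfl fun y _ => ?_
  rw [← integral_shift ((hh.shift y).mul (hu y)).1 (-y)]
  simp only [shift_shift, neg_add_cancel, shift_zero]

/-- By stationarity the summand only depends on `y` and `z = y - x`, and the double sum factorises.
This turns forms in `≪·,·≫` into honest `L²` pairings. -/
lemma sum_sum_integral_mul_shift (hV : C.StiffnessL2) (hu : ∀ y, C.Tame a (u y))
    (hv : ∀ y, C.Tame b (v y)) (hab : a + b ≤ 2) (hv0 : ∀ y, y ∉ box M → v y = fun _ => 0)
    {K : ℕ} (hK : 2 * M ≤ K) :
    ∑ x ∈ box K, ∑ y ∈ box M, ∫ ω, u y ω * v (y - x) (shift x ω) ∂C.gibbs =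
      ∫ ω, gather M u ω * gather M v ω ∂C.gibbs := by
  simp only [gather, Finset.sum_mul_sum]
  rw [Finset.sum_comm, integral_finsetSum _ fun y _ => integrable_finsetSum _ fun z _ =>
    ((hu y).shift (-y)).integrable_mul hV ((hv z).shift (-z)) hab]
  refine Finset.sum_congr rfl fun y hy => ?_
  rw [integral_finsetSum _ fun z _ =>
    ((hu y).shift (-y)).integrable_mul hV ((hv z).shift (-z)) hab]
  have e (x : ℤ) : ∫ ω, u y ω * v (y - x) (shift x ω) ∂C.gibbs =
      ∫ ω, u y (shift (-y) ω) * v (y - x) (shift (-(y - x)) ω) ∂C.gibbs := by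
    rw [← integral_shift ((hu y).mul ((hv (y - x)).shift x)).1 (-y)]
    simp only [shift_shift, show -y + x = -(y - x) by ring]
  simp only [e]
  refine Eq.trans (Finset.sum_map (box K) (Equiv.subLeft y).toEmbedding fun z =>
    ∫ ω, u y (shift (-y) ω) * v z (shift (-z) ω) ∂C.gibbs).symm ?_
  symm
  -- All differences of two sites of `box M` lie in `box (2 M)`, hence in `box K`; the other values
  -- of `z` contribute nothing.
  refine Finset.sum_subset ?_ fun z _ hz => ?_
  · intro z hz
    rw [Finset.mem_map]
    refine ⟨y - z, ?_, by simp⟩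
    simp only [Finset.mem_Icc] at hy hz ⊢
    omega
  · simp [hv0 z hz]

end Gather

/-! ### Dirichlet form, spectral gap and time reversal in the semi-inner product. -/

section Forms

variable {f : Config → ℝ} {N : ℕ}

/-- Here the box is dictated by `h`. For `k = θ_x f` the support of `k` moves with `x`, whereas a
fixed box is needed when summing over `x`. -/
lemma integral_mul_flipNoise_of_dependsOn (hV : C.StiffnessL2) {a b : ℕ} {h k : Config → ℝ}
    (hh : C.Tame a h) (hk : C.Tame b k) (hab : a + b ≤ 2) {M : ℕ}
    (hN : DependsOn h (box N : Set ℤ)) (hM : N ≤ M) :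
    ∫ ω, h ω * flipNoise k ω ∂C.gibbs =
      -((1 / 2) * ∑ x ∈ box M, ∫ ω, flipDiff x h ω * flipDiff x k ω ∂C.gibbs) := by
  obtain ⟨N', hN'⟩ := hk.exists_dependsOn_box
  rw [integral_mul_flipNoise hV hh hk hab hN' (le_max_left N' M)]
  congr 2
  symm
  refine Finset.sum_subset (box_mono (le_max_right N' M)) fun x _ hx => ?_
  simp [flipDiff_eq_zero hN fun h => hx (box_mono hM h)]

lemma integral_mul_noise_of_dependsOn (hV : C.StiffnessL2) {a : ℕ} {h k : Config → ℝ}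
    (hh : C.RegP a h) (hk : C.Core k) (ha : a ≤ 2) {M : ℕ}
    (hN : DependsOn h (box N : Set ℤ)) (hM : N + 1 ≤ M) :
    ∫ ω, h ω * (flipNoise k ω + exchangeNoise k ω) ∂C.gibbs = -C.dirichlet M h k := by
  obtain ⟨N', hN'⟩ := hk.regP.tame.exists_dependsOn_box
  rw [integral_mul_noise hV hh hk ha hN' (le_max_left (N' + 1) M), dirichlet, dirichlet]
  have h1 : ∑ x ∈ box (max (N' + 1) M), ∫ ω, flipDiff x h ω * flipDiff x k ω ∂C.gibbs =
      ∑ x ∈ box M, ∫ ω, flipDiff x h ω * flipDiff x k ω ∂C.gibbs := by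
    symm
    refine Finset.sum_subset (box_mono (le_max_right (N' + 1) M)) fun x _ hx => ?_
    simp [flipDiff_eq_zero hN fun h => hx (box_mono (by omega) h)]
  have h2 : ∑ x ∈ box (max (N' + 1) M), ∫ ω, rotation x h ω * rotation x k ω ∂C.gibbs =
      ∑ x ∈ box M, ∫ ω, rotation x h ω * rotation x k ω ∂C.gibbs := by
    symm
    refine Finset.sum_subset (box_mono (le_max_right (N' + 1) M)) fun x _ hx => ?_
    have : ∀ ω, rotation x h ω = 0 := by
      refine rotation_eq_zero hN ?_ ?_ <;>
        (simp only [Finset.coe_Icc, Set.mem_Icc, Finset.mem_Icc] at hx ⊢; omega)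
    simp [this]
  rw [h1, h2]

lemma flipDiff_eq_zero_of_notMem_box (hN : DependsOn f (box N : Set ℤ)) {y : ℤ}
    (hy : y ∉ box (N + 1)) : flipDiff y f = fun _ => 0 := by
  ext ω
  exact flipDiff_eq_zero hN (fun h => hy (box_mono (by omega) h)) ω

lemma rotation_eq_zero_of_notMem_box (hN : DependsOn f (box N : Set ℤ)) {y : ℤ}
    (hy : y ∉ box (N + 1)) : rotation y f = fun _ => 0 := by
  ext ω
  refine rotation_eq_zero hN ?_ ?_ ω <;>
    (simp only [Finset.coe_Icc, Set.mem_Icc, Finset.mem_Icc] at hy ⊢; omega)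

lemma sum_integral_flipDiff (hV : C.StiffnessL2) (hf : C.Core f)
    (hN : DependsOn f (box N : Set ℤ)) {K : ℕ} (hK : 2 * (N + 1) ≤ K) :
    ∑ x ∈ box K, ∑ y ∈ box (N + 1),
      ∫ ω, flipDiff y f ω * flipDiff y (fun η => f (shift x η)) ω ∂C.gibbs =
      ∫ ω, gather (N + 1) (fun y => flipDiff y f) ω ^ 2 ∂C.gibbs := by
  simp only [flipDiff_shift, sq]
  exact sum_sum_integral_mul_shift hV (fun y => hf.regP.tame.flipDiff y)
    (fun y => hf.regP.tame.flipDiff y) (by omega)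
    (fun y hy => flipDiff_eq_zero_of_notMem_box hN hy) hK

lemma sum_integral_rotation (hV : C.StiffnessL2) (hf : C.Core f)
    (hN : DependsOn f (box N : Set ℤ)) {K : ℕ} (hK : 2 * (N + 1) ≤ K) :
    ∑ x ∈ box K, ∑ y ∈ box (N + 1),
      ∫ ω, rotation y f ω * rotation y (fun η => f (shift x η)) ω ∂C.gibbs =
      ∫ ω, gather (N + 1) (fun y => rotation y f) ω ^ 2 ∂C.gibbs := by
  simp only [rotation_shift, sq]
  exact sum_sum_integral_mul_shift hV (fun y => hf.regP.tame_rotation y)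
    (fun y => hf.regP.tame_rotation y) (by omega)
    (fun y hy => rotation_eq_zero_of_notMem_box hN hy) hK

/-- The Dirichlet form of the generator on the core. -/
lemma corr_formalGenerator_self (hV : C.StiffnessL2) (hf : C.Core f) (γ : ℝ)
    (hN : DependsOn f (box N : Set ℤ)) :
    C.corr f (C.formalGenerator γ f) =
      -(γ / 2) * (∫ ω, gather (N + 1) (fun y => flipDiff y f) ω ^ 2 ∂C.gibbs +
        ∫ ω, gather (N + 1) (fun y => rotation y f) ω ^ 2 ∂C.gibbs) := by
  obtain ⟨K₀, hK₀⟩ := exists_corr_eq_sum ((hf.regP.tame.mono zero_le_one).mem_localSubmodule hV)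
    ((hf.tame_formalGenerator γ).mem_localSubmodule hV)
    (by rw [integral_formalGenerator hV hf, mul_zero])
  set K := max K₀ (2 * (N + 1))
  have hK2 : 2 * (N + 1) ≤ K := le_max_right _ _
  rw [hK₀ K (le_max_left _ _)]
  -- By antisymmetry of `𝔄` and stationarity, the summand is odd in `x`, and the box is symmetric.
  have hA : ∑ x ∈ box K, ∫ ω, f ω * C.liouville f (shift x ω) ∂C.gibbs = 0 := by
    have h1 (x : ℤ) : ∫ ω, f ω * C.liouville f (shift x ω) ∂C.gibbs =
        -∫ ω, f ω * C.liouville f (shift (-x) ω) ∂C.gibbs := by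
      simp only [← liouville_shift]
      rw [integral_mul_liouville hV hf.regP (hf.shift x).regP hf.regR (hf.shift x).regR
        (by omega), ← integral_shift
          ((tame_liouville hf.regP hf.regR).mul (hf.regP.tame.shift x)).1 (-x)]
      simp only [shift_shift, neg_add_cancel, shift_zero, liouville_shift,
        mul_comm (C.liouville f _)]
    have h2 := sum_box_neg K fun x => ∫ ω, f ω * C.liouville f (shift x ω) ∂C.gibbs
    rw [Finset.sum_congr rfl fun x _ => h1 x, Finset.sum_neg_distrib] at *
    linarith
  have e (x : ℤ) : ∫ ω, f ω * C.formalGenerator γ f (shift x ω) ∂C.gibbs =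
      ∫ ω, f ω * C.liouville f (shift x ω) ∂C.gibbs +
        γ * -C.dirichlet (N + 1) f (fun η => f (shift x η)) := by
    rw [← integral_mul_noise_of_dependsOn hV hf.regP (hf.shift x) (by omega) hN le_rfl,
      ← integral_const_mul, ← integral_add]
    · congr 1
      ext ω
      rw [formalGenerator, flipNoise_shift, exchangeNoise_shift]
      ring
    · exact hf.regP.tame.integrable_mul hV ((tame_liouville hf.regP hf.regR).shift x) (by omega)
    · exact (hf.regP.tame.integrable_mul hV ((tame_flipNoise (hf.shift x).regP.tame).add
        (hf.shift x).tame_exchangeNoise) (by omega)).const_mul γ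
  simp only [e, Finset.sum_add_distrib, hA, dirichlet, ← Finset.mul_sum, Finset.sum_neg_distrib]
  rw [sum_integral_flipDiff hV hf hN hK2, sum_integral_rotation hV hf hN hK2]
  ring

lemma integral_flipNoise (hV : C.StiffnessL2) {a : ℕ} (ha : a ≤ 2) (hf : C.Tame a f) :
    ∫ ω, flipNoise f ω ∂C.gibbs = 0 := by
  obtain ⟨N, hN⟩ := hf.exists_dependsOn_box
  have := integral_mul_flipNoise hV (Tame.const (C := C) (a := 0) 1) hf (by omega) hN le_rfl
  simpa [flipDiff] using this

lemma flipNoise_add {a b : ℕ} {h k : Config → ℝ} (hh : C.Tame a h) (hk : C.Tame b k)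
    (ω : Config) : flipNoise (fun ω => h ω + k ω) ω = flipNoise h ω + flipNoise k ω := by
  obtain ⟨N, hN, hN'⟩ := exists_box_two hh hk
  have hs : DependsOn (fun ω => h ω + k ω) (box N : Set ℤ) :=
    fun _ _ e => congrArg₂ (· + ·) (hN e) (hN' e)
  simp only [flipNoise_eq_sum hN le_rfl, flipNoise_eq_sum hN' le_rfl, flipNoise_eq_sum hs le_rfl,
    add_sub_add_comm, Finset.sum_add_distrib]

lemma flipNoise_sum_shift {a : ℕ} (hf : C.Tame a f) (n : ℕ) (ω : Config) :
    flipNoise (fun η => ∑ x ∈ Finset.range n, f (shift (x : ℤ) η)) ω =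
      ∑ x ∈ Finset.range n, flipNoise f (shift (x : ℤ) ω) := by
  induction n with
  | zero => simp [flipNoise]
  | succ n ih =>
    simp only [Finset.sum_range_succ]
    have h1 : C.Tame a (fun ω => ∑ x ∈ Finset.range n, f (shift (x : ℤ) ω)) :=
      Tame.sum _ fun x _ => hf.shift (x : ℤ)
    rw [flipNoise_add h1 (hf.shift n), ih, flipNoise_shift]

/-- The spectral gap of the flips, in the semi-inner product. -/
lemma corr_sub_reverse_le (hV : C.StiffnessL2) (hf : C.Core f)
    (hN : DependsOn f (box N : Set ℤ)) :
    C.corr f (fun ω => f ω - f (reverse ω)) ≤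
      (1 / 2) * ∫ ω, gather (N + 1) (fun y => flipDiff y f) ω ^ 2 ∂C.gibbs := by
  have tf : C.Tame 1 f := hf.regP.tame.mono zero_le_one
  have tS : C.Tame 1 (flipNoise f) := tame_flipNoise tf
  have tO : C.Tame 1 (fun ω => f ω - f (reverse ω)) := tf.sub (tf.reflect _)
  have tg : C.Tame 1 (fun ω => -flipNoise f ω - (f ω - f (reverse ω))) := tS.neg.sub tO
  have hO0 : ∫ ω, (f ω - f (reverse ω)) ∂C.gibbs = 0 := by
    rw [integral_sub ((tf.mono one_le_two).integrable hV)
      (((tf.reflect _).mono one_le_two).integrable hV), integral_reflect _ tf.1, sub_self]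
  have hS0 := integral_flipNoise hV one_le_two tf
  have hg0 : ∫ ω, (-flipNoise f ω - (f ω - f (reverse ω))) ∂C.gibbs = 0 := by
    rw [integral_sub ((tS.neg.mono one_le_two).integrable hV)
      ((tO.mono one_le_two).integrable hV), hO0, integral_neg, hS0, neg_zero, sub_zero]
  have mf := tf.mem_localSubmodule hV
  -- The gap holds for the finite sums `F = ∑_{x<n} θ_x f` with a constant independent of `n`, so it
  -- passes to the semi-inner product through the finite volume covariances.
  have hpos : 0 ≤ C.corr f (fun ω => -flipNoise f ω - (f ω - f (reverse ω))) := by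
    refine corr_nonneg_of_covariance_sum_nonneg mf (tg.mem_localSubmodule hV) fun n => ?_
    set F : Config → ℝ := fun ω => ∑ x ∈ Finset.range n, f (shift (x : ℤ) ω) with hF
    have tF : C.Tame 1 F := Tame.sum _ fun x _ => tf.shift x
    have e : (fun ω => ∑ x ∈ Finset.range n, (-flipNoise f (shift (x : ℤ) ω) -
        (f (shift (x : ℤ) ω) - f (reverse (shift (x : ℤ) ω))))) =
        fun ω => -flipNoise F ω - (F ω - F (reverse ω)) := by
      ext ω
      simp only [hF, flipNoise_sum_shift tf, Finset.sum_sub_distrib, Finset.sum_neg_distrib,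
        shift_reverse]
    have tG : C.Tame 1 (fun ω => -flipNoise F ω - (F ω - F (reverse ω))) :=
      (tame_flipNoise tF).neg.sub (tF.sub (tF.reflect _))
    have hG0 : ∫ ω, (-flipNoise F ω - (F ω - F (reverse ω))) ∂C.gibbs = 0 := by
      rw [← e, integral_finsetSum _ fun (x : ℕ) _ =>
        ((tg.shift (x : ℤ)).mono one_le_two).integrable hV]
      refine Finset.sum_eq_zero fun x _ => ?_
      exact (integral_shift tg.1 (x : ℤ)).trans hg0
    rw [e, covariance_eq_sub (tF.memLp hV) (tG.memLp hV), hG0, mul_zero, sub_zero]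
    have h1 := integral_mul_flipNoise_le hV tF
    have h2 : ∫ ω, (F * fun ω => -flipNoise F ω - (F ω - F (reverse ω))) ω ∂C.gibbs =
        -(∫ ω, F ω * flipNoise F ω ∂C.gibbs) - ∫ ω, F ω * (F ω - F (reverse ω)) ∂C.gibbs := by
      rw [← integral_neg, ← integral_sub]
      · congr 1
        ext ω
        simp only [Pi.mul_apply]
        ring
      · exact (tF.mul (tame_flipNoise tF)).neg.integrable hV
      · exact (tF.mul (tF.sub (tF.reflect _))).integrable hV
    rw [h2]
    linarith
  obtain ⟨K₁, hK₁⟩ := exists_corr_eq_sum mf (tg.mem_localSubmodule hV) (by rw [hg0, mul_zero])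
  obtain ⟨K₂, hK₂⟩ := exists_corr_eq_sum mf (tO.mem_localSubmodule hV) (by rw [hO0, mul_zero])
  set K := max (max K₁ K₂) (2 * (N + 1))
  have hK : 2 * (N + 1) ≤ K := le_max_right _ _
  rw [hK₁ K (by omega)] at hpos
  rw [hK₂ K (by omega)]
  have e (x : ℤ) : ∫ ω, f ω * (-flipNoise f (shift x ω) -
      (f (shift x ω) - f (reverse (shift x ω)))) ∂C.gibbs =
      (1 / 2) * ∑ y ∈ box (N + 1),
        ∫ ω, flipDiff y f ω * flipDiff y (fun η => f (shift x η)) ω ∂C.gibbs -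
      ∫ ω, f ω * (f (shift x ω) - f (reverse (shift x ω))) ∂C.gibbs := by
    have h1 := integral_mul_flipNoise_of_dependsOn hV tf (tf.shift x) (le_refl 2) hN
      (Nat.le_succ N)
    have h2 : (1 / 2) * ∑ y ∈ box (N + 1),
        ∫ ω, flipDiff y f ω * flipDiff y (fun η => f (shift x η)) ω ∂C.gibbs =
        ∫ ω, -(f ω * flipNoise (fun η => f (shift x η)) ω) ∂C.gibbs := by
      rw [integral_neg, h1, neg_neg]
    rw [h2, ← integral_sub]
    · congr 1
      ext ω
      rw [flipNoise_shift]
      ring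
    · exact (tf.mul (tame_flipNoise (tf.shift x))).neg.integrable hV
    · exact (tf.mul (tO.shift x)).integrable hV
  simp only [e, Finset.sum_sub_distrib, ← Finset.mul_sum] at hpos
  rw [sum_integral_flipDiff hV hf hN hK] at hpos
  linarith

/-- Time reversal symmetry of the generator, in the semi-inner product. -/
lemma corr_reverse_formalGenerator (hV : C.StiffnessL2) (γ : ℝ) {g : Config → ℝ}
    (hf : C.Core f) (hg : C.Core g) :
    C.corr (fun ω => f (reverse ω)) (C.formalGenerator γ g) =
      C.corr (C.formalGenerator γ f) (fun ω => g (reverse ω)) := by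
  unfold corr
  congr 1
  ext x
  rw [integral_formalGenerator hV hf, integral_formalGenerator hV hg, mul_zero, zero_mul,
    sub_zero, sub_zero]
  simp only [← formalGenerator_shift]
  rw [integral_reverse_mul_formalGenerator hV hf (hg.shift x)]
  simp only [shift_reverse]

end Forms

end Chain

end OscillatorChain

namespace OscillatorChain

namespace Chain

variable {C : Chain}

/-! ### Moments -/

section Moments

lemma integral_momentum_sq_mul (hV : C.StiffnessL2) {h : Config → ℝ} (hh : C.RegP 2 h) {x : ℤ}
    (hx : ∀ ω, derivP x h ω = 0) :
    ∫ ω, (ω x).2 * ((ω x).2 * h ω) ∂C.gibbs = C.T * ∫ ω, h ω ∂C.gibbs := by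
  have h1 : C.RegP 2 (fun ω => (ω x).2 * h ω) := by
    simpa using (RegP.momentum (C := C) (a := 0) x).mul hh
  rw [integral_momentum_mul hV h1 x]
  congr 2
  ext ω
  rw [derivP_mul ((RegP.momentum (C := C) (a := 0) x).diff x) (hh.diff x), derivP_momentum, hx]
  simp

lemma diffP_momentum (x y : ℤ) : DiffP x (fun ω => (ω y).2) := fun ω => by
  by_cases h : y = x
  · subst h; simp
  · simp [h]

lemma derivP_momentum_mul {h : Config → ℝ} (hd : ∀ x, DiffP x h) (hh : ∀ x ω, derivP x h ω = 0)
    {x y : ℤ} (hxy : x ≠ y) (ω : Config) : derivP x (fun ω => (ω y).2 * h ω) ω = 0 := by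
  rw [derivP_mul (diffP_momentum x y) (hd x), derivP_momentum, hh]
  simp [hxy]

/-- Integration by parts against the constant `1`: the mean force is the pressure, which is zero. -/
lemma integral_force (hV : C.StiffnessL2) (x : ℤ) :
    ∫ ω, deriv C.V (ω x).1 ∂C.gibbs = 0 := by
  have := integral_force_mul hV (RegR.const (C := C) 1) x
  simpa [derivR] using this

lemma integral_force_mul_force (hV : C.StiffnessL2) {x y : ℤ} (hxy : x ≠ y) :
    ∫ ω, deriv C.V (ω x).1 * deriv C.V (ω y).1 ∂C.gibbs = 0 := by
  rw [integral_force_mul hV (RegR.force y) x]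
  simp [derivR_force, hxy]

lemma integral_force_sq (hV : C.StiffnessL2) (x : ℤ) :
    ∫ ω, deriv C.V (ω x).1 * deriv C.V (ω x).1 ∂C.gibbs =
      Var[fun ω => deriv C.V (ω 0).1; C.gibbs] := by
  rw [variance_of_integral_eq_zero (Tame.force 0).1.aemeasurable (integral_force hV 0)]
  have := integral_shift (C := C) (((Tame.force (C := C) 0).mul (Tame.force 0)).1) x
  simp only [shift, add_zero] at this
  rw [this]
  simp only [sq]

lemma integral_deriv_force_sub_sq (x : ℤ) :
    ∫ ω, (deriv (deriv C.V) (ω x).1 - ∫ η, deriv (deriv C.V) (η 0).1 ∂C.gibbs) ^ 2 ∂C.gibbs =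
      Var[fun ω => deriv (deriv C.V) (ω 0).1; C.gibbs] := by
  have h0 := Tame.deriv_force (C := C) 0
  rw [variance_eq_integral h0.1.aemeasurable]
  have := integral_shift (C := C) ((h0.sub (Tame.const
    (∫ η : Config, deriv (deriv C.V) (η 0).1 ∂C.gibbs))).1.pow_const 2) x
  simpa [shift] using this

variable {α β δ : Config → ℝ}

/-- The second moment of `p_1 α + p_0 β + p_0 p_1 δ`, for functions `α, β, δ` of the distances. -/
lemma integral_momentum_comb_sq (hV : C.StiffnessL2) (hα : C.RegP 1 α) (hβ : C.RegP 1 β)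
    (hδ : C.RegP 1 δ) (dα : ∀ x ω, derivP x α ω = 0) (dβ : ∀ x ω, derivP x β ω = 0)
    (dδ : ∀ x ω, derivP x δ ω = 0) :
    ∫ ω, ((ω 1).2 * α ω + (ω 0).2 * β ω + (ω 0).2 * ((ω 1).2 * δ ω)) ^ 2 ∂C.gibbs =
      C.T * ∫ ω, α ω * α ω ∂C.gibbs + C.T * ∫ ω, β ω * β ω ∂C.gibbs +
        C.T ^ 2 * ∫ ω, δ ω * δ ω ∂C.gibbs := by
  have hz {h k : Config → ℝ} (hh : C.RegP 1 h) (hk : C.RegP 1 k) (dh : ∀ x ω, derivP x h ω = 0)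
      (dk : ∀ x ω, derivP x k ω = 0) (x : ℤ) (ω : Config) :
      derivP x (fun ω => h ω * k ω) ω = 0 := by
    rw [derivP_mul (hh.diff x) (hk.diff x), dh, dk]
    ring
  have hm {a : ℕ} {h : Config → ℝ} (hh : C.RegP a h) (x : ℤ) :
      C.RegP a (fun ω => (ω x).2 * h ω) := by
    simpa using (RegP.momentum (C := C) (a := 0) x).mul hh
  have aa := hα.mul hα
  have bb := hβ.mul hβ
  have dd := hδ.mul hδ
  have ab := hα.mul hβ
  have ad := hα.mul hδ
  have bd := hβ.mul hδ
  have e1 := integral_momentum_sq_mul hV aa (hz hα hα dα dα 1)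
  have e2 := integral_momentum_sq_mul hV bb (hz hβ hβ dβ dβ 0)
  have e3 : ∫ ω, (ω 0).2 * ((ω 0).2 * ((ω 1).2 * ((ω 1).2 * (δ ω * δ ω)))) ∂C.gibbs =
      C.T ^ 2 * ∫ ω, δ ω * δ ω ∂C.gibbs := by
    rw [integral_momentum_sq_mul hV (hm (hm dd 1) 1),
      integral_momentum_sq_mul hV dd (hz hδ hδ dδ dδ 1)]
    · ring
    · intro ω
      rw [derivP_mul ((RegP.momentum (C := C) (a := 0) 1).diff 0) ((hm dd 1).diff 0),
        derivP_momentum_mul dd.diff (hz hδ hδ dδ dδ) (zero_ne_one (α := ℤ)), derivP_momentum]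
      simp
  -- Each of the three cross terms is linear in one of the centered momenta and therefore vanishes.
  have e4 : ∫ ω, (ω 0).2 * ((ω 1).2 * (α ω * β ω)) ∂C.gibbs = 0 :=
    integral_momentum_mul_eq_zero hV (hm ab 1)
      (derivP_momentum_mul ab.diff (hz hα hβ dα dβ) (zero_ne_one (α := ℤ)))
  have e5 : ∫ ω, (ω 0).2 * ((ω 1).2 * ((ω 1).2 * (α ω * δ ω))) ∂C.gibbs = 0 := by
    refine integral_momentum_mul_eq_zero hV (hm (hm ad 1) 1) fun ω => ?_
    rw [derivP_mul ((RegP.momentum (C := C) (a := 0) 1).diff 0) ((hm ad 1).diff 0),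
      derivP_momentum_mul ad.diff (hz hα hδ dα dδ) (zero_ne_one (α := ℤ)), derivP_momentum]
    simp
  have e6 : ∫ ω, (ω 1).2 * ((ω 0).2 * ((ω 0).2 * (β ω * δ ω))) ∂C.gibbs = 0 := by
    refine integral_momentum_mul_eq_zero hV (hm (hm bd 0) 0) fun ω => ?_
    rw [derivP_mul ((RegP.momentum (C := C) (a := 0) 0).diff 1) ((hm bd 0).diff 1),
      derivP_momentum_mul bd.diff (hz hβ hδ dβ dδ) (one_ne_zero (α := ℤ)), derivP_momentum]
    simp
  have i1 := (hm (hm aa 1) 1).tame.integrable hV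
  have i2 := (hm (hm bb 0) 0).tame.integrable hV
  have i3 := (hm (hm (hm (hm dd 1) 1) 0) 0).tame.integrable hV
  have i4 := ((hm (hm ab 1) 0).const_mul 2).tame.integrable hV
  have i5 := ((hm (hm (hm ad 1) 1) 0).const_mul 2).tame.integrable hV
  have i6 := ((hm (hm (hm bd 0) 0) 1).const_mul 2).tame.integrable hV
  have e : (fun ω : Config =>
      ((ω 1).2 * α ω + (ω 0).2 * β ω + (ω 0).2 * ((ω 1).2 * δ ω)) ^ 2) =
      (fun ω => (ω 1).2 * ((ω 1).2 * (α ω * α ω))) + (fun ω => (ω 0).2 * ((ω 0).2 * (β ω * β ω))) +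
      (fun ω => (ω 0).2 * ((ω 0).2 * ((ω 1).2 * ((ω 1).2 * (δ ω * δ ω))))) +
      (fun ω => 2 * ((ω 0).2 * ((ω 1).2 * (α ω * β ω)))) +
      (fun ω => 2 * ((ω 0).2 * ((ω 1).2 * ((ω 1).2 * (α ω * δ ω))))) +
      (fun ω => 2 * ((ω 1).2 * ((ω 0).2 * ((ω 0).2 * (β ω * δ ω))))) := by
    ext ω
    simp only [Pi.add_apply]
    ring
  rw [e, integral_add' ((((i1.add i2).add i3).add i4).add i5) i6,
    integral_add' (((i1.add i2).add i3).add i4) i5, integral_add' ((i1.add i2).add i3) i4,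
    integral_add' (i1.add i2) i3, integral_add' i1 i2]
  simp only [integral_const_mul, e1, e2, e3, e4, e5, e6]
  ring

end Moments

/-! ### The trial function -/

variable (C) in
/-- The trial function `-p_0 (V'(r_0) + V'(r_1))`. -/
def trialFun (ω : Config) : ℝ := -((ω 0).2 * (deriv C.V (ω 0).1 + deriv C.V (ω 1).1))

variable (C) in
/-- The function `p_0 (V'(r_1) + V'(r_2)) - p_1 (V'(r_0) + V'(r_1))`, the rotation at `0` of the
sum of all the shifts of the trial function. -/
def trialRotation (ω : Config) : ℝ :=
  -((ω 1).2 * (deriv C.V (ω 0).1 + deriv C.V (ω 1).1)) +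
    (ω 0).2 * (deriv C.V (ω 1).1 + deriv C.V (ω 2).1)

variable (C) in
/-- The function `p_0 p_1 (V''(r_1) - m)`. -/
def stiffnessFun (m : ℝ) (ω : Config) : ℝ :=
  (ω 0).2 * ((ω 1).2 * (deriv (deriv C.V) (ω 1).1 - m))

lemma regP_force_add (x y : ℤ) :
    C.RegP 1 (fun ω => deriv C.V (ω x).1 + deriv C.V (ω y).1) :=
  (RegP.force x).add (RegP.force y)

lemma regP_trialFun : C.RegP 1 C.trialFun := by
  have := (RegP.momentum (C := C) (a := 0) 0).mul (regP_force_add (C := C) 0 1)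
  exact this.neg

lemma regR_trialFun : C.RegR 1 C.trialFun := by
  have := (RegR.momentum (C := C) (a := 0) 0).mul ((RegR.force (C := C) 0).add (RegR.force 1))
  exact this.neg

lemma regP_stiffnessFun (m : ℝ) : C.RegP 1 (C.stiffnessFun m) := by
  have h := (RegP.deriv_force (C := C) 1).sub (RegP.const m)
  have := (RegP.momentum (C := C) (a := 0) 0).mul ((RegP.momentum (a := 0) 1).mul h)
  rw [zero_add, zero_add] at this
  exact this

lemma tame_trialRotation : C.Tame 1 C.trialRotation := by
  have h1 := ((Tame.momentum (C := C) (a := 0) 1).mul ((Tame.force 0).add (Tame.force 1))).neg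
  have h2 := (Tame.momentum (C := C) (a := 0) 0).mul ((Tame.force 1).add (Tame.force 2))
  exact h1.add h2

lemma derivP_trialFun (x : ℤ) (ω : Config) : derivP x C.trialFun ω =
    if x = 0 then -(deriv C.V (ω 0).1 + deriv C.V (ω 1).1) else 0 := by
  unfold derivP trialFun
  simp only [update_fst_of_momentum]
  by_cases h : x = 0
  · subst h
    simp only [Function.update_self, if_true]
    simp
  · simp [Ne.symm h, h]

lemma derivR_trialFun (x : ℤ) (ω : Config) : derivR x C.trialFun ω =
    -((ω 0).2 * ((if x = 0 then deriv (deriv C.V) (ω 0).1 else 0) +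
      if x = 1 then deriv (deriv C.V) (ω 1).1 else 0)) := by
  have h0 : derivR x (fun ω => (ω 0).2) ω = 0 := by
    simp [derivR, update_snd_of_length]
  have h1 := derivR_mul ((RegR.momentum (C := C) (a := 0) 0).diff x)
    (((RegR.force (C := C) 0).add (RegR.force 1)).diff x) ω
  rw [h0, derivR_add ((RegR.force (C := C) 0).diff x) ((RegR.force (C := C) 1).diff x),
    derivR_force, derivR_force, zero_mul, zero_add] at h1
  rw [← h1]
  exact deriv.fun_neg

lemma dependsOn_trialFun : DependsOn C.trialFun (box 1 : Set ℤ) := fun ω η h => by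
  simp [trialFun, h 0 (by simp), h 1 (by simp)]

lemma box_one : box 1 = {-1, 0, 1} := by decide

lemma liouville_trialFun (ω : Config) : C.liouville C.trialFun ω =
    -((deriv C.V (ω 1).1 - deriv C.V (ω 0).1) * (deriv C.V (ω 0).1 + deriv C.V (ω 1).1)) -
      ((ω 0).2 - (ω (-1)).2) * (ω 0).2 * deriv (deriv C.V) (ω 0).1 -
      ((ω 1).2 - (ω 0).2) * (ω 0).2 * deriv (deriv C.V) (ω 1).1 := by
  rw [liouville_eq_sum dependsOn_trialFun le_rfl, box_one]
  simp only [derivP_trialFun, derivR_trialFun]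
  rw [Finset.sum_insert (by decide), Finset.sum_insert (by decide), Finset.sum_singleton]
  norm_num
  ring

lemma flipDiff_trialFun (x : ℤ) (ω : Config) :
    flipDiff x C.trialFun ω = if x = 0 then 2 * C.trialFun ω else 0 := by
  by_cases h : x = 0
  · subst h
    simp [flipDiff, trialFun, flip]
    ring
  · have h0 : (flip x ω 0) = ω 0 := by simp [flip, Ne.symm h]
    have h1 : (flip x ω 1).1 = (ω 1).1 := by
      by_cases h' : x = 1
      · subst h'; simp [flip]
      · simp [flip, Ne.symm h']
    simp [flipDiff, trialFun, h0, h1, h]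

lemma rotation_trialFun (x : ℤ) (ω : Config) :
    rotation x C.trialFun ω =
      (if x = 0 then -((ω 1).2 * (deriv C.V (ω 0).1 + deriv C.V (ω 1).1)) else 0) +
      if x = -1 then (ω (-1)).2 * (deriv C.V (ω 0).1 + deriv C.V (ω 1).1) else 0 := by
  simp only [rotation, derivP_trialFun]
  by_cases h : x = 0
  · subst h; simp; ring
  · by_cases h' : x = -1
    · subst h'; simp; ring
    · have : x + 1 ≠ 0 := by omega
      simp [h, h', this]

lemma rotation_stiffnessFun (m : ℝ) (ω : Config) : rotation 0 (C.stiffnessFun m) ω =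
    ((ω 1).2 * (ω 1).2 - (ω 0).2 * (ω 0).2) * (deriv (deriv C.V) (ω 1).1 - m) := by
  have h := (RegP.deriv_force (C := C) 1).sub (RegP.const m)
  have hz (x : ℤ) : derivP x (fun ω => deriv (deriv C.V) (ω 1).1 - m) ω = 0 := by
    simp [derivP, update_fst_of_momentum]
  have h1 := (RegP.momentum (C := C) (a := 0) 1).mul h
  have hd (x : ℤ) : derivP x (C.stiffnessFun m) ω =
      (if x = 0 then 1 else 0) * ((ω 1).2 * (deriv (deriv C.V) (ω 1).1 - m)) +
        (ω 0).2 * ((if x = 1 then 1 else 0) * (deriv (deriv C.V) (ω 1).1 - m)) := by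
    have := derivP_mul ((RegP.momentum (C := C) (a := 0) 0).diff x) (h1.diff x) ω
    rw [derivP_mul ((RegP.momentum (C := C) (a := 0) 1).diff x) (h.diff x), hz, derivP_momentum,
      derivP_momentum, mul_zero, add_zero] at this
    exact this
  simp only [rotation, hd]
  norm_num
  ring

variable (C) in
/-- The discrete primitive of `𝔄 f + X_0 g`, where `f` is the trial function, `g` is
`stiffnessFun`, and `X_0` is the rotation at `0`. -/
def primitiveFun (m : ℝ) (ω : Config) : ℝ :=
  (ω 0).2 * (ω 0).2 * (deriv (deriv C.V) (ω 0).1 - m) -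
    (ω 0).2 * (ω (-1)).2 * deriv (deriv C.V) (ω 0).1 - deriv C.V (ω 0).1 * deriv C.V (ω 0).1

lemma tame_primitiveFun (m : ℝ) : C.Tame 2 (C.primitiveFun m) := by
  have h1 := ((Tame.momentum (C := C) (a := 0) 0).mul (Tame.momentum (a := 0) 0)).mul
    ((Tame.deriv_force (C := C) 0).sub (Tame.const m))
  have h2 := ((Tame.momentum (C := C) (a := 0) 0).mul (Tame.momentum (a := 0) (-1))).mul
    (Tame.deriv_force (C := C) 0)
  exact ((h1.sub h2).mono (by omega)).sub ((Tame.force 0).mul (Tame.force 0))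

/-- The squares of the forces already form a gradient. Adding `(p_1² - p_0²)(V''(r_1) - m)` converts
`p_0² V''(r_1)` into `p_1² V''(r_1)`, so that the remaining terms pair up under the shift by one
site. -/
lemma liouville_trialFun_add_rotation (m : ℝ) (ω : Config) :
    C.liouville C.trialFun ω + rotation 0 (C.stiffnessFun m) ω =
      C.primitiveFun m (shift 1 ω) - C.primitiveFun m ω := by
  rw [liouville_trialFun, rotation_stiffnessFun]
  simp only [primitiveFun, shift, add_zero]
  norm_num
  ring

/-- The primitive depends on the sites `0` and `-1` only; shifted away from the support of `f` it is
independent of `f`. -/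
lemma integral_primitiveFun_shift_mul (m : ℝ) {f : Config → ℝ}
    (hf : C.Tame 0 f) {N : ℕ} (hN : DependsOn f (box N : Set ℤ)) {y : ℤ} (hy : y ∉ box N)
    (hy' : y - 1 ∉ box N) :
    ∫ ω, C.primitiveFun m (shift y ω) * f ω ∂C.gibbs =
      (∫ ω, C.primitiveFun m ω ∂C.gibbs) * ∫ ω, f ω ∂C.gibbs := by
  have hB := tame_primitiveFun (C := C) m
  have hd : DependsOn (fun ω => C.primitiveFun m (shift y ω)) (({y, y - 1} : Finset ℤ) : Set ℤ) := by
    intro ω η h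
    have h0 : ω (y + 0) = η (y + 0) := h (y + 0) (by simp)
    have h1 : ω (y + -1) = η (y + -1) := h (y - 1) (by simp)
    simp only [primitiveFun, shift, h0, h1]
  have hi := indepFun_of_dependsOn (C := C) (Λ := {y, y - 1}) (Λ' := box N)
    (by simp only [Finset.disjoint_insert_left, Finset.disjoint_singleton_left]
        exact ⟨hy, hy'⟩) (hB.shift y).1 hf.1 hd hN
  have h1 := hi.integral_fun_mul_eq_mul_integral (hB.shift y).1.aestronglyMeasurable
    hf.1.aestronglyMeasurable
  rw [h1, integral_shift hB.1]

/-! ### The generator tested against the trial function. -/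

section Trial

variable {f : Config → ℝ} {N K : ℕ}

lemma sum_integral_liouville_trialFun (hV : C.StiffnessL2) (m : ℝ) (hf : C.Core f)
    (hN : DependsOn f (box N : Set ℤ)) (hK : N + 1 ≤ K) :
    ∑ y ∈ box K, ∫ ω, C.liouville C.trialFun (shift y ω) * f ω ∂C.gibbs =
      ∫ ω, C.stiffnessFun m ω * gather (N + 1) (fun y => rotation y f) ω ∂C.gibbs := by
  have tA : C.Tame 2 (C.liouville C.trialFun) := tame_liouville regP_trialFun regR_trialFun
  have tR : C.Tame 1 (rotation 0 (C.stiffnessFun m)) := (regP_stiffnessFun m).tame_rotation 0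
  have hB := tame_primitiveFun (C := C) m
  have h1 (y : ℤ) : ∫ ω, C.stiffnessFun m (shift y ω) * rotation y f ω ∂C.gibbs =
      -∫ ω, rotation 0 (C.stiffnessFun m) (shift y ω) * f ω ∂C.gibbs := by
    rw [integral_mul_rotation hV ((regP_stiffnessFun m).shift y) hf.regP (by omega)]
    simp only [rotation_shift, sub_self]
  have h2 (y : ℤ) : ∫ ω, C.liouville C.trialFun (shift y ω) * f ω ∂C.gibbs =
      ∫ ω, C.stiffnessFun m (shift y ω) * rotation y f ω ∂C.gibbs +
        ((∫ ω, C.primitiveFun m (shift (y + 1) ω) * f ω ∂C.gibbs) -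
          ∫ ω, C.primitiveFun m (shift y ω) * f ω ∂C.gibbs) := by
    rw [h1, ← integral_sub ((hB.shift _).integrable_mul hV hf.regP.tame (by omega))
      ((hB.shift _).integrable_mul hV hf.regP.tame (by omega)), neg_add_eq_sub,
      eq_sub_iff_add_eq, ← integral_add
        ((tA.shift _).integrable_mul hV hf.regP.tame (by omega))
        ((tR.shift _).integrable_mul hV hf.regP.tame (by omega))]
    congr 1
    ext ω
    rw [← add_mul, liouville_trialFun_add_rotation, shift_shift, sub_mul]
  -- After telescoping, both boundary terms equal the same product of means, by independence, and
  -- cancel; neither mean has to be zero.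
  rw [Finset.sum_congr rfl fun y _ => h2 y, Finset.sum_add_distrib,
    sum_box_telescope fun y => ∫ ω, C.primitiveFun m (shift y ω) * f ω ∂C.gibbs,
    integral_primitiveFun_shift_mul m hf.regP.tame hN,
    integral_primitiveFun_shift_mul m hf.regP.tame hN, sub_self, add_zero,
    ← sum_integral_shift_mul hV (regP_stiffnessFun m).tame (fun y => hf.regP.tame_rotation y)
      (by omega)]
  · symm
    refine Finset.sum_subset (box_mono hK) fun y _ hy => ?_
    simp [rotation_eq_zero_of_notMem_box hN hy]
  all_goals
    simp only [Finset.mem_Icc]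
    omega

/-- Only the shift by `z` involves `p_z`, and the trial function is odd in it: whence the factor
`2`. -/
lemma sum_flipDiff_trialFun (z : ℤ) (hz : z ∈ box K) (ω : Config) :
    ∑ y ∈ box K, flipDiff z (fun η => C.trialFun (shift y η)) ω =
      2 * C.trialFun (shift z ω) := by
  simp only [flipDiff_shift, flipDiff_trialFun, sub_eq_zero]
  rw [Finset.sum_ite_eq]
  simp [hz]

/-- The bond `z` meets the momenta of exactly two shifts, by `z` and by `z + 1`; both must belong to
the box. -/
lemma sum_rotation_trialFun (z : ℤ) (hz : z ∈ box K) (hz' : z + 1 ∈ box K) (ω : Config) :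
    ∑ y ∈ box K, rotation z (fun η => C.trialFun (shift y η)) ω =
      C.trialRotation (shift z ω) := by
  simp only [rotation_shift, rotation_trialFun, sub_eq_zero]
  have e (y : ℤ) : z - y = -1 ↔ z + 1 = y := by omega
  simp only [e]
  rw [Finset.sum_add_distrib, Finset.sum_ite_eq, Finset.sum_ite_eq]
  simp only [hz, hz', if_true, trialRotation, shift]
  congr 2
  · ring_nf
  · ring_nf

lemma sum_dirichlet_trialFun (hV : C.StiffnessL2) (hf : C.Core f) (hK : N + 2 ≤ K) :
    ∑ y ∈ box K, C.dirichlet (N + 1) (fun ω => C.trialFun (shift y ω)) f =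
      ∫ ω, C.trialFun ω * gather (N + 1) (fun y => flipDiff y f) ω ∂C.gibbs +
      (1 / 2) * ∫ ω, C.trialRotation ω * gather (N + 1) (fun y => rotation y f) ω ∂C.gibbs := by
  have tt : C.Tame 1 C.trialFun := regP_trialFun.tame
  have hmem (z : ℤ) (hz : z ∈ box (N + 1)) : z ∈ box K ∧ z + 1 ∈ box K := by
    simp only [Finset.mem_Icc] at hz ⊢
    push_cast at hz
    omega
  have h1 : ∑ y ∈ box K, ∑ z ∈ box (N + 1),
      ∫ ω, flipDiff z (fun ω => C.trialFun (shift y ω)) ω * flipDiff z f ω ∂C.gibbs =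
      2 * ∫ ω, C.trialFun ω * gather (N + 1) (fun y => flipDiff y f) ω ∂C.gibbs := by
    rw [Finset.sum_comm, ← sum_integral_shift_mul hV tt (fun y => hf.regP.tame.flipDiff y)
      (by omega), Finset.mul_sum]
    refine Finset.sum_congr rfl fun z hz => ?_
    rw [← integral_finsetSum _ fun y _ => ((tt.shift y).flipDiff z).integrable_mul hV
      (hf.regP.tame.flipDiff z) (by omega), ← integral_const_mul]
    congr 1
    ext ω
    rw [← Finset.sum_mul, sum_flipDiff_trialFun z (hmem z hz).1, mul_assoc]
  have h2 : ∑ y ∈ box K, ∑ z ∈ box (N + 1),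
      ∫ ω, rotation z (fun ω => C.trialFun (shift y ω)) ω * rotation z f ω ∂C.gibbs =
      ∫ ω, C.trialRotation ω * gather (N + 1) (fun y => rotation y f) ω ∂C.gibbs := by
    rw [Finset.sum_comm, ← sum_integral_shift_mul hV tame_trialRotation
      (fun y => hf.regP.tame_rotation y) (by omega)]
    refine Finset.sum_congr rfl fun z hz => ?_
    rw [← integral_finsetSum _ fun y _ => ((regP_trialFun.shift y).tame_rotation z).integrable_mul
      hV (hf.regP.tame_rotation z) (by omega)]
    congr 1
    ext ω
    rw [← Finset.sum_mul, sum_rotation_trialFun z (hmem z hz).1 (hmem z hz).2]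
  simp only [dirichlet, Finset.sum_add_distrib, ← Finset.mul_sum, h1, h2]
  ring

lemma integral_trialFun (hV : C.StiffnessL2) : ∫ ω, C.trialFun ω ∂C.gibbs = 0 := by
  have h1 := regP_force_add (C := C) 0 1
  have := integral_momentum_mul_eq_zero hV (h1.mono one_le_two) (x := 0) fun ω => by
    simp [derivP]
  simp only [trialFun, integral_neg, this, neg_zero]

/-- The generator tested against the trial function. -/
lemma corr_trialFun_formalGenerator (hV : C.StiffnessL2) (γ m : ℝ) (hf : C.Core f)
    (hN : DependsOn f (box N : Set ℤ)) :
    C.corr C.trialFun (C.formalGenerator γ f) =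
      -((∫ ω, γ * C.trialFun ω * gather (N + 1) (fun y => flipDiff y f) ω ∂C.gibbs) +
        ∫ ω, (γ / 2 * C.trialRotation ω + C.stiffnessFun m ω) *
          gather (N + 1) (fun y => rotation y f) ω ∂C.gibbs) := by
  have tt : C.Tame 1 C.trialFun := regP_trialFun.tame
  have tL := hf.tame_formalGenerator γ
  obtain ⟨K₀, hK₀⟩ := exists_corr_eq_sum (tt.mem_localSubmodule hV) (tL.mem_localSubmodule hV)
    (by rw [integral_formalGenerator hV hf, mul_zero])
  set K := max K₀ (N + 2)
  have hK : N + 2 ≤ K := le_max_right _ _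
  -- Stationarity transfers the shift to the trial function, so that the support of `f` and the box
  -- of the Dirichlet form stay fixed during the summation.
  have e (x : ℤ) : ∫ ω, C.trialFun ω * C.formalGenerator γ f (shift (-x) ω) ∂C.gibbs =
      -(∫ ω, C.liouville C.trialFun (shift x ω) * f ω ∂C.gibbs) -
        γ * C.dirichlet (N + 1) (fun ω => C.trialFun (shift x ω)) f := by
    rw [← integral_shift (tt.mul (tL.shift (-x))).1 x]
    simp only [shift_shift, add_neg_cancel, shift_zero]
    rw [integral_mul_formalGenerator hV (regP_trialFun.shift x) (regR_trialFun.shift x) hf le_rfl γ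
      hN le_rfl]
    simp only [liouville_shift]
  rw [hK₀ K (le_max_left _ _), ← sum_box_neg K, Finset.sum_congr rfl fun x _ => e x,
    Finset.sum_sub_distrib, Finset.sum_neg_distrib, ← Finset.mul_sum,
    sum_dirichlet_trialFun hV hf hK, sum_integral_liouville_trialFun hV m hf hN (by omega)]
  have tX : C.Tame 0 (gather (N + 1) (fun y => rotation y f)) :=
    tame_gather fun y => hf.regP.tame_rotation y
  simp only [add_mul, mul_assoc]
  rw [integral_add ((tame_trialRotation.integrable_mul hV tX (by omega)).const_mul _)
    ((regP_stiffnessFun m).tame.integrable_mul hV tX (by omega)), integral_const_mul,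
    integral_const_mul]
  ring

/-- The flip part contributes `2 γ² T Var V'` and the rotation part `γ² T Var V'`. The stiffness
part is orthogonal to the latter and contributes `T² Var V''`, because `m` is the mean of `V''`. -/
lemma integral_trial_comb_sq (hV : C.StiffnessL2) (γ : ℝ) :
    (∫ ω, (γ * C.trialFun ω) ^ 2 ∂C.gibbs) +
      ∫ ω, (γ / 2 * C.trialRotation ω +
        C.stiffnessFun (∫ η, deriv (deriv C.V) (η 0).1 ∂C.gibbs) ω) ^ 2 ∂C.gibbs =
      3 * γ ^ 2 * C.T * Var[fun ω => deriv C.V (ω 0).1; C.gibbs] +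
        C.T ^ 2 * Var[fun ω => deriv (deriv C.V) (ω 0).1; C.gibbs] := by
  set m := ∫ η, deriv (deriv C.V) (η 0).1 ∂C.gibbs with hm
  set v := Var[fun ω => deriv C.V (ω 0).1; C.gibbs] with hv
  have hF (c : ℝ) (x y : ℤ) : C.RegP 1 (fun ω => c * (deriv C.V (ω x).1 + deriv C.V (ω y).1)) :=
    (regP_force_add x y).const_mul c
  have hF0 (c : ℝ) (x y z : ℤ) (ω : Config) :
      derivP z (fun ω => c * (deriv C.V (ω x).1 + deriv C.V (ω y).1)) ω = 0 := by
    simp [derivP, update_fst_of_momentum]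
  have hd := (RegP.deriv_force (C := C) 1).sub (RegP.const m)
  have hd0 (z : ℤ) (ω : Config) : derivP z (fun ω => deriv (deriv C.V) (ω 1).1 - m) ω = 0 := by
    simp [derivP, update_fst_of_momentum]
  have hz0 (z : ℤ) (ω : Config) : derivP z (fun _ : Config => (0 : ℝ)) ω = 0 := by
    simp [derivP]
  have hsq (c : ℝ) {x y : ℤ} (hxy : x ≠ y) :
      ∫ ω, c * (deriv C.V (ω x).1 + deriv C.V (ω y).1) *
        (c * (deriv C.V (ω x).1 + deriv C.V (ω y).1)) ∂C.gibbs = c ^ 2 * (2 * v) := by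
    have e : (fun ω : Config => c * (deriv C.V (ω x).1 + deriv C.V (ω y).1) *
        (c * (deriv C.V (ω x).1 + deriv C.V (ω y).1))) =
        fun ω => c ^ 2 * (deriv C.V (ω x).1 * deriv C.V (ω x).1 +
          deriv C.V (ω y).1 * deriv C.V (ω y).1 +
          (deriv C.V (ω x).1 * deriv C.V (ω y).1 + deriv C.V (ω x).1 * deriv C.V (ω y).1)) := by
      ext ω
      ring
    have i (x y : ℤ) : Integrable (fun ω : Config => deriv C.V (ω x).1 * deriv C.V (ω y).1)
        C.gibbs := (Tame.force x).integrable_mul hV (Tame.force y) le_rfl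
    have i1 : Integrable (fun ω : Config => deriv C.V (ω x).1 * deriv C.V (ω x).1 +
        deriv C.V (ω y).1 * deriv C.V (ω y).1) C.gibbs := (i x x).add (i y y)
    have i2 : Integrable (fun ω : Config => deriv C.V (ω x).1 * deriv C.V (ω y).1 +
        deriv C.V (ω x).1 * deriv C.V (ω y).1) C.gibbs := (i x y).add (i x y)
    rw [e, integral_const_mul, integral_add i1 i2, integral_add (i x x) (i y y), integral_add (i x y) (i x y), integral_force_sq hV,
      integral_force_sq hV, integral_force_mul_force hV hxy]
    ring
  have e1 := integral_momentum_comb_sq hV (RegP.const 0) (hF (-γ) 0 1) (RegP.const 0) hz0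
    (hF0 (-γ) 0 1) hz0
  have e2 := integral_momentum_comb_sq hV (hF (-(γ / 2)) 0 1) (hF (γ / 2) 1 2) hd
    (hF0 (-(γ / 2)) 0 1) (hF0 (γ / 2) 1 2) hd0
  rw [hsq _ (by norm_num)] at e1
  rw [hsq _ (by norm_num), hsq _ (by norm_num)] at e2
  have e3 := integral_deriv_force_sub_sq (C := C) 1
  rw [← hm] at e3
  simp only [sq] at e3
  rw [e3] at e2
  have f1 : (fun ω : Config => (γ * C.trialFun ω) ^ 2) = fun ω => ((ω 1).2 * 0 +
      (ω 0).2 * (-γ * (deriv C.V (ω 0).1 + deriv C.V (ω 1).1)) + (ω 0).2 * ((ω 1).2 * 0)) ^ 2 := by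
    ext ω
    simp only [trialFun]
    ring
  have f2 : (fun ω : Config => (γ / 2 * C.trialRotation ω + C.stiffnessFun m ω) ^ 2) = fun ω =>
      ((ω 1).2 * (-(γ / 2) * (deriv C.V (ω 0).1 + deriv C.V (ω 1).1)) +
        (ω 0).2 * (γ / 2 * (deriv C.V (ω 1).1 + deriv C.V (ω 2).1)) +
        (ω 0).2 * ((ω 1).2 * (deriv (deriv C.V) (ω 1).1 - m))) ^ 2 := by
    ext ω
    simp only [trialRotation, stiffnessFun]
    ring
  rw [f1, f2, e1, e2]
  simp only [mul_zero, integral_zero]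
  ring

/-- Cauchy–Schwarz in `L² ⊕ L²`, by the discriminant of a nonnegative quadratic polynomial. -/
lemma sq_integral_add_integral_le {a b p q : Config → ℝ} (ha : MemLp a 2 C.gibbs)
    (hb : MemLp b 2 C.gibbs) (hp : MemLp p 2 C.gibbs) (hq : MemLp q 2 C.gibbs) :
    ((∫ ω, a ω * p ω ∂C.gibbs) + ∫ ω, b ω * q ω ∂C.gibbs) ^ 2 ≤
      ((∫ ω, a ω ^ 2 ∂C.gibbs) + ∫ ω, b ω ^ 2 ∂C.gibbs) *
        ((∫ ω, p ω ^ 2 ∂C.gibbs) + ∫ ω, q ω ^ 2 ∂C.gibbs) := by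
  have key {u w : Config → ℝ} (hu : MemLp u 2 C.gibbs) (hw : MemLp w 2 C.gibbs) (t : ℝ) :
      0 ≤ (∫ ω, u ω ^ 2 ∂C.gibbs) * (t * t) + 2 * (∫ ω, u ω * w ω ∂C.gibbs) * t +
        ∫ ω, w ω ^ 2 ∂C.gibbs := by
    have h1 : ∫ ω, (u ω * t + w ω) ^ 2 ∂C.gibbs = (∫ ω, u ω ^ 2 ∂C.gibbs) * (t * t) +
        2 * (∫ ω, u ω * w ω ∂C.gibbs) * t + ∫ ω, w ω ^ 2 ∂C.gibbs := by
      have e : (fun ω => (u ω * t + w ω) ^ 2) = fun ω => u ω ^ 2 * (t * t) +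
          u ω * w ω * (2 * t) + w ω ^ 2 := by
        ext ω
        ring
      have i1 := hu.integrable_sq.mul_const (t * t)
      have i2 : Integrable (fun ω => u ω * w ω * (2 * t)) C.gibbs :=
        (hu.integrable_mul hw).mul_const (2 * t)
      have i12 : Integrable (fun ω => u ω ^ 2 * (t * t) + u ω * w ω * (2 * t)) C.gibbs :=
        i1.add i2
      rw [e, integral_add i12 hw.integrable_sq, integral_add i1 i2, integral_mul_const,
        integral_mul_const]
      ring
    rw [← h1]
    exact integral_nonneg fun ω => sq_nonneg _
  have h := discrim_le_zero (a := (∫ ω, a ω ^ 2 ∂C.gibbs) + ∫ ω, b ω ^ 2 ∂C.gibbs)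
    (b := 2 * ((∫ ω, a ω * p ω ∂C.gibbs) + ∫ ω, b ω * q ω ∂C.gibbs))
    (c := (∫ ω, p ω ^ 2 ∂C.gibbs) + ∫ ω, q ω ^ 2 ∂C.gibbs) fun t => by
      have h1 := key ha hp t
      have h2 := key hb hq t
      linarith
  rw [discrim] at h
  linarith

/-- The Dirichlet form controls the generator tested against the trial function. -/
lemma sq_corr_trialFun_le (hV : C.StiffnessL2) {γ : ℝ} (hγ : 0 < γ) (hf : C.Core f) :
    C.corr C.trialFun (C.formalGenerator γ f) ^ 2 ≤
      (6 * γ * C.T * Var[fun ω => deriv C.V (ω 0).1; C.gibbs] +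
        2 * C.T ^ 2 * γ⁻¹ * Var[fun ω => deriv (deriv C.V) (ω 0).1; C.gibbs]) *
        -C.corr f (C.formalGenerator γ f) := by
  obtain ⟨N, hN⟩ := hf.regP.tame.exists_dependsOn_box
  rw [corr_trialFun_formalGenerator hV γ (∫ η, deriv (deriv C.V) (η 0).1 ∂C.gibbs) hf hN,
    corr_formalGenerator_self hV hf γ hN, neg_sq]
  have tD : C.Tame 1 (gather (N + 1) (fun y => flipDiff y f)) :=
    tame_gather fun y => (hf.regP.tame.flipDiff y).mono zero_le_one
  have tX : C.Tame 1 (gather (N + 1) (fun y => rotation y f)) :=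
    tame_gather fun y => (hf.regP.tame_rotation y).mono zero_le_one
  refine (sq_integral_add_integral_le ((regP_trialFun.tame.const_mul γ).memLp hV)
    (((tame_trialRotation.const_mul (γ / 2)).add (regP_stiffnessFun _).tame).memLp hV)
    (tD.memLp hV) (tX.memLp hV)).trans (le_of_eq ?_)
  -- The Dirichlet form carries the factor `γ / 2`, so the constant is `2 / γ` times the second
  -- moment just computed.
  rw [integral_trial_comb_sq hV]
  field_simp
  ring

/-- The correlation of the trial function with the energy current. -/
lemma corr_trialFun_currentFun (hV : C.StiffnessL2) :
    C.corr C.trialFun C.currentFun = C.T * Var[fun ω => deriv C.V (ω 0).1; C.gibbs] := by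
  have tt : C.Tame 1 C.trialFun := regP_trialFun.tame
  obtain ⟨K, hK⟩ := exists_corr_eq_sum (tt.mem_localSubmodule hV) C.currentFun_mem
    (by rw [integral_trialFun hV, zero_mul])
  have hr (x : ℤ) : C.RegP 2 (fun ω => (deriv C.V (ω 0).1 + deriv C.V (ω 1).1) *
      deriv C.V (ω (x + 1)).1) := (regP_force_add 0 1).mul (RegP.force (x + 1))
  have hz (x y : ℤ) (ω : Config) : derivP y (fun ω => (deriv C.V (ω 0).1 + deriv C.V (ω 1).1) *
      deriv C.V (ω (x + 1)).1) ω = 0 := by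
    simp [derivP, update_fst_of_momentum]
  have e (x : ℤ) : (fun ω => C.trialFun ω * C.currentFun (shift x ω)) =
      fun ω => (ω 0).2 * ((ω x).2 * ((deriv C.V (ω 0).1 + deriv C.V (ω 1).1) *
        deriv C.V (ω (x + 1)).1)) := by
    ext ω
    simp only [trialFun, currentFun, shift, add_zero]
    ring
  -- For `x ≠ 0` the product is linear in `p_0`. For `x = 0` only `V'(r_1)²` survives, as distinct
  -- forces are uncorrelated.
  rw [hK K le_rfl, Finset.sum_eq_single 0]
  · rw [e, integral_momentum_sq_mul hV (hr 0) (hz 0 0)]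
    have i (x y : ℤ) : Integrable (fun ω : Config => deriv C.V (ω x).1 * deriv C.V (ω y).1)
        C.gibbs := (Tame.force x).integrable_mul hV (Tame.force y) le_rfl
    simp only [zero_add, add_mul]
    rw [integral_add (i 0 1) (i 1 1), integral_force_mul_force hV (by norm_num),
      integral_force_sq hV, zero_add]
  · intro x _ hx
    rw [e]
    refine integral_momentum_mul_eq_zero hV ?_
      (derivP_momentum_mul (hr x).diff (hz x) (Ne.symm hx))
    simpa using (RegP.momentum (C := C) (a := 0) x).mul (hr x)
  · intro h
    simp at h

end Trial

end Chain

end OscillatorChain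

namespace OscillatorChain

namespace Chain

variable {C : Chain}

/-! ### Momentum reversal on `𝓗` -/

lemma reverse_mem_localSubmodule {f : Config → ℝ} (hf : f ∈ C.localSubmodule) :
    (fun ω => f (reverse ω)) ∈ C.localSubmodule := by
  obtain ⟨hm, h2, Λ, hΛ⟩ := hf
  refine ⟨hm.comp (measurable_reflect _),
    h2.comp_measurePreserving (C.measurePreserving_reflect Set.univ), Λ, fun ω η h => ?_⟩
  exact hΛ fun i hi => by rw [reverse_apply, reverse_apply, h i hi]

lemma corr_reverse_reverse {f g : Config → ℝ} (hf : Measurable f) (hg : Measurable g) :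
    C.corr (fun ω => f (reverse ω)) (fun ω => g (reverse ω)) = C.corr f g := by
  unfold corr
  congr 1
  ext x
  rw [integral_reflect _ hf, integral_reflect _ hg]
  simp only [← shift_reverse]
  congr 1
  exact integral_reflect _ (hf.mul (hg.comp (measurable_shift x)))

variable (C) in
/-- Momentum reversal on the square integrable local functions. -/
def reverseFun : C.LocalFun →ₗ[ℝ] C.LocalFun where
  toFun f := ⟨fun ω => f (reverse ω), reverse_mem_localSubmodule f.2⟩
  map_add' _ _ := rfl
  map_smul' _ _ := rfl

lemma reverseFun_reverseFun (f : C.LocalFun) : C.reverseFun (C.reverseFun f) = f :=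
  Subtype.ext (funext fun ω => congrArg f.1 (reflect_reflect _ ω))

lemma inner_reverseFun (f g : C.LocalFun) :
    inner ℝ (C.reverseFun f) (C.reverseFun g) = inner ℝ f g :=
  corr_reverse_reverse f.2.1 g.2.1

lemma uniformContinuous_reverseFun : UniformContinuous C.reverseFun :=
  (C.reverseFun.isometryOfInner inner_reverseFun).isometry.uniformContinuous

variable (C) in
/-- Momentum reversal on `𝓗`. -/
def reverseH : C.H → C.H := UniformSpace.Completion.map C.reverseFun

lemma continuous_reverseH : Continuous C.reverseH := UniformSpace.Completion.continuous_map

lemma reverseH_toH (f : C.LocalFun) : C.reverseH (C.toH f) = C.toH (C.reverseFun f) :=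
  UniformSpace.Completion.map_coe uniformContinuous_reverseFun f

lemma reverseH_reverseH (x : C.H) : C.reverseH (C.reverseH x) = x := by
  induction x using UniformSpace.Completion.induction_on with
  | hp => exact isClosed_eq (continuous_reverseH.comp continuous_reverseH) continuous_id
  | ih f =>
    change C.reverseH (C.reverseH (C.toH f)) = C.toH f
    rw [reverseH_toH, reverseH_toH, reverseFun_reverseFun]

lemma inner_reverseH (x y : C.H) : inner ℝ (C.reverseH x) y = inner ℝ x (C.reverseH y) := by
  induction x, y using UniformSpace.Completion.induction_on₂ with
  | hp =>
    have h := continuous_reverseH (C := C)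
    exact isClosed_eq ((h.comp continuous_fst).inner continuous_snd)
      (continuous_fst.inner (h.comp continuous_snd))
  | ih f g =>
    change inner ℝ (C.reverseH (C.toH f)) (C.toH g) = inner ℝ (C.toH f) (C.reverseH (C.toH g))
    rw [reverseH_toH, reverseH_toH, inner_toH, inner_toH]
    have := corr_reverse_reverse (C := C) f.2.1 (C.reverseFun g).2.1
    have e : (fun ω => (C.reverseFun g) (reverse ω)) = g.1 :=
      congrArg Subtype.val (reverseFun_reverseFun g)
    rw [e] at this
    exact this

/-- Reversal is a symmetric involution, so `(1 - R)² = 2 (1 - R)`. -/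
lemma norm_sub_reverseH_sq (x : C.H) :
    ‖x - C.reverseH x‖ ^ 2 = 2 * inner ℝ x (x - C.reverseH x) := by
  have h := inner_reverseH x (C.reverseH x)
  rw [reverseH_reverseH] at h
  rw [← real_inner_self_eq_norm_sq, inner_sub_left, inner_sub_right (C.reverseH x), h,
    inner_reverseH x x, inner_sub_right]
  ring

/-! ### The generator on `𝓗` -/

/-- A sum of test functions with different supports need not be compactly supported on the union of
their sites. The class `Core` is linear, so every element of the span is still represented by a
function and its formal generator. -/
lemma exists_core_of_mem_span {γ : ℝ} {z : C.H × C.H}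
    (hz : z ∈ Submodule.span ℝ {z : C.H × C.H | ∃ f g : C.LocalFun, IsTestFunction f ∧
      (∀ ω, g ω = C.formalGenerator γ f ω) ∧ z = (C.toH f, C.toH g)}) :
    ∃ f g : C.LocalFun, C.Core f ∧ (∀ ω, g ω = C.formalGenerator γ f ω) ∧
      z = (C.toH f, C.toH g) := by
  induction hz using Submodule.span_induction with
  | mem z hz =>
    obtain ⟨f, g, hf, hg, rfl⟩ := hz
    exact ⟨f, g, core_of_isTestFunction hf, hg, rfl⟩
  | zero =>
    have h := formalGenerator_const_mul γ 0 (Core.const (C := C) 0)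
    refine ⟨0, 0, Core.const 0, fun ω => ?_, rfl⟩
    simp only [zero_mul] at h
    exact (h ω).symm
  | add z w _ _ hz hw =>
    obtain ⟨f, g, hf, hg, rfl⟩ := hz
    obtain ⟨f', g', hf', hg', rfl⟩ := hw
    refine ⟨f + f', g + g', hf.add hf', fun ω => ?_, ?_⟩
    · exact (congrArg₂ (· + ·) (hg ω) (hg' ω)).trans (formalGenerator_add γ hf hf' ω).symm
    · exact Prod.ext (UniformSpace.Completion.coe_add f f').symm
        (UniformSpace.Completion.coe_add g g').symm
  | smul c z _ hz =>
    obtain ⟨f, g, hf, hg, rfl⟩ := hz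
    refine ⟨c • f, c • g, hf.const_mul c, fun ω => ?_, ?_⟩
    · exact (congrArg (c * ·) (hg ω)).trans (formalGenerator_const_mul γ c hf ω).symm
    · exact Prod.ext (UniformSpace.Completion.coe_smul c f).symm
        (UniformSpace.Completion.coe_smul c g).symm

/-- A closed property of pairs holds on the graph of the generator if it holds on the core. -/
lemma generator_induction {γ : ℝ} {p : C.H × C.H → Prop} (hp : IsClosed {z | p z})
    (h : ∀ f g : C.LocalFun, C.Core f → (∀ ω, g ω = C.formalGenerator γ f ω) →
      p (C.toH f, C.toH g)) {z : C.H × C.H} (hz : z ∈ C.generator γ) : p z := by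
  refine closure_minimal (fun w hw => ?_) hp hz
  obtain ⟨f, g, hf, hg, rfl⟩ := exists_core_of_mem_span hw
  exact h f g hf hg

lemma inner_generator_le (hV : C.StiffnessL2) {γ : ℝ} (hγ : 0 < γ) {z : C.H × C.H}
    (hz : z ∈ C.generator γ) :
    inner ℝ z.1 z.2 ≤ -(γ / 2) * ‖z.1 - C.reverseH z.1‖ ^ 2 := by
  refine generator_induction (p := fun z : C.H × C.H =>
    inner ℝ z.1 z.2 ≤ -(γ / 2) * ‖z.1 - C.reverseH z.1‖ ^ 2) ?_ (fun f g hf hg => ?_) hz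
  · have h := continuous_reverseH (C := C)
    exact isClosed_le (continuous_fst.inner continuous_snd)
      (continuous_const.mul ((continuous_fst.sub (h.comp continuous_fst)).norm.pow 2))
  · obtain ⟨N, hN⟩ := hf.regP.tame.exists_dependsOn_box
    have e : C.toH f - C.toH (C.reverseFun f) = C.toH (f - C.reverseFun f) :=
      (UniformSpace.Completion.coe_sub f (C.reverseFun f)).symm
    have h1 := corr_formalGenerator_self hV hf γ hN
    have h2 : C.corr f (f - C.reverseFun f : C.LocalFun) ≤ _ := corr_sub_reverse_le hV hf hN
    have h3 : 0 ≤ ∫ ω, gather (N + 1) (fun y => rotation y f) ω ^ 2 ∂C.gibbs :=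
      integral_nonneg fun ω => sq_nonneg _
    rw [norm_sub_reverseH_sq, reverseH_toH, e, inner_toH, inner_toH, funext hg, h1]
    -- The rotation part of the Dirichlet form is discarded; the flips alone give the gap.
    nlinarith

/-- The identity is closed in each of its two arguments, so it is extended from the core one
argument at a time. -/
lemma inner_reverseH_generator (hV : C.StiffnessL2) {γ : ℝ} {z w : C.H × C.H}
    (hz : z ∈ C.generator γ) (hw : w ∈ C.generator γ) :
    inner ℝ (C.reverseH z.1) w.2 = inner ℝ z.2 (C.reverseH w.1) := by
  have h := continuous_reverseH (C := C)
  refine generator_induction (p := fun z : C.H × C.H =>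
    inner ℝ (C.reverseH z.1) w.2 = inner ℝ z.2 (C.reverseH w.1)) ?_ (fun f g hf hg => ?_) hz
  · exact isClosed_eq ((h.comp continuous_fst).inner continuous_const)
      (continuous_snd.inner continuous_const)
  refine generator_induction (p := fun w : C.H × C.H =>
    inner ℝ (C.reverseH (C.toH f)) w.2 = inner ℝ (C.toH g) (C.reverseH w.1)) ?_
    (fun f' g' hf' hg' => ?_) hw
  · exact isClosed_eq (continuous_const.inner continuous_snd)
      (continuous_const.inner (h.comp continuous_fst))
  · rw [reverseH_toH, reverseH_toH, inner_toH, inner_toH, funext hg, funext hg']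
    exact corr_reverse_formalGenerator hV γ hf hf'

/-- The trial function as a square integrable local function. -/
def trialLocal (hV : C.StiffnessL2) : C.LocalFun :=
  ⟨C.trialFun, regP_trialFun.tame.mem_localSubmodule hV⟩

variable (C) in
/-- The class in `𝓗` of the trial function. -/
def trial (hV : C.StiffnessL2) : C.H := C.toH (trialLocal hV)

lemma sq_inner_trial_le (hV : C.StiffnessL2) {γ : ℝ} (hγ : 0 < γ) {z : C.H × C.H}
    (hz : z ∈ C.generator γ) :
    inner ℝ (C.trial hV) z.2 ^ 2 ≤
      (6 * γ * C.T * Var[fun ω => deriv C.V (ω 0).1; C.gibbs] +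
        2 * C.T ^ 2 * γ⁻¹ * Var[fun ω => deriv (deriv C.V) (ω 0).1; C.gibbs]) *
        -inner ℝ z.1 z.2 := by
  refine generator_induction (p := fun z : C.H × C.H => inner ℝ (C.trial hV) z.2 ^ 2 ≤
    (6 * γ * C.T * Var[fun ω => deriv C.V (ω 0).1; C.gibbs] +
      2 * C.T ^ 2 * γ⁻¹ * Var[fun ω => deriv (deriv C.V) (ω 0).1; C.gibbs]) *
      -inner ℝ z.1 z.2) ?_ (fun f g hf hg => ?_) hz
  · exact isClosed_le ((continuous_const.inner continuous_snd).pow 2)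
      (continuous_const.mul (continuous_fst.inner continuous_snd).neg)
  · rw [trial, inner_toH, inner_toH, funext hg]
    exact sq_corr_trialFun_le hV hγ hf

lemma reverseH_toH_of_odd {f : C.LocalFun} (hf : ∀ ω, f (reverse ω) = -f ω) :
    C.reverseH (C.toH f) = -C.toH f := by
  have e : C.reverseFun f = -f := Subtype.ext (funext hf)
  rw [reverseH_toH, e]
  exact UniformSpace.Completion.coe_neg f

lemma reverseH_current : C.reverseH C.current = -C.current :=
  reverseH_toH_of_odd fun ω => by simp [currentFun, reverse_apply]

lemma reverseH_trial (hV : C.StiffnessL2) : C.reverseH (C.trial hV) = -C.trial hV := by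
  have h (ω : Config) : C.trialFun (reverse ω) = -C.trialFun ω := by
    simp [trialFun, reverse_apply]
  exact reverseH_toH_of_odd h

lemma inner_trial_current (hV : C.StiffnessL2) :
    inner ℝ (C.trial hV) C.current = C.T * Var[fun ω => deriv C.V (ω 0).1; C.gibbs] := by
  refine (inner_toH C (trialLocal hV) _).trans ?_
  exact corr_trialFun_currentFun hV

end Chain

end OscillatorChain

/-! ### The lower bound for the conductivity. -/

theorem proposition6p2 (C : OscillatorChain.Chain) (γ : ℝ) (hγ : 0 < γ)
    (hV'' : MemLp (fun ω : OscillatorChain.Config => deriv (deriv C.V) (ω 0).1) 2 C.gibbs)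
    (hgen : ∃ P : ℝ≥0 → C.H →L[ℝ] C.H,
      OscillatorChain.IsC0Semigroup P ∧ OscillatorChain.IsGeneratorOf (C.generator γ) P) :
    ∃ (u : ℝ → C.H) (σ : ℝ),
      (∀ l : ℝ, 0 < l → ∀ w : C.H, (w, l • w - C.current) ∈ C.generator γ ↔ w = u l) ∧
      Tendsto (fun l : ℝ => inner ℝ C.current (u l)) (𝓝[>] 0) (𝓝 σ) ∧
      C.T ^ 2 * Var[fun ω => deriv C.V (ω 0).1; C.gibbs] ^ 2 /
          (6 * γ * C.T * Var[fun ω => deriv C.V (ω 0).1; C.gibbs] +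
            2 * C.T ^ 2 * γ⁻¹ * Var[fun ω => deriv (deriv C.V) (ω 0).1; C.gibbs]) ≤ σ := by
  obtain ⟨P, hP, hG⟩ := hgen
  have hV := OscillatorChain.Chain.stiffnessL2_of_gibbs hV''
  have hT := C.T_pos
  have hD : 0 ≤ 6 * γ * C.T * Var[fun ω => deriv C.V (ω 0).1; C.gibbs] +
      2 * C.T ^ 2 * γ⁻¹ * Var[fun ω => deriv (deriv C.V) (ω 0).1; C.gibbs] :=
    add_nonneg (mul_nonneg (by positivity) (variance_nonneg _ _))
      (mul_nonneg (by positivity) (variance_nonneg _ _))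
  obtain ⟨u, σ, hu, hσ, hσ0, hle⟩ := OscillatorChain.exists_tendsto_inner_resolvent hP hG
    (Submodule.isClosed_topologicalClosure _) C.reverseH
    OscillatorChain.Chain.inner_reverseH OscillatorChain.Chain.reverseH_reverseH (half_pos hγ)
    (fun z hz => OscillatorChain.Chain.inner_generator_le hV hγ hz)
    (fun z hz w hw => OscillatorChain.Chain.inner_reverseH_generator hV hz hw)
    OscillatorChain.Chain.reverseH_current (OscillatorChain.Chain.reverseH_trial hV) hD
    (fun z hz => OscillatorChain.Chain.sq_inner_trial_le hV hγ hz)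
  refine ⟨u, σ, hu, hσ, ?_⟩
  rw [OscillatorChain.Chain.inner_trial_current, mul_pow, mul_comm _ σ] at hle
  -- Thanks to `0 ≤ σ`, the denominator need not be shown to be positive: division by zero gives
  -- `0`.
  exact div_le_of_le_mul₀ hD hσ0 hle
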